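/- Let $\mathbb{K}$ be $\mathbb{R}$ or $\mathbb{C}$, let $\psi_{\mathbb{K}}$ be a nontrivial unitary (continuous) character of the additive group $\mathbb{K}$, and write $x^\tau$ for the transpose of a matrix $x$. Put $$L_3=\left\{\begin{pmatrix} a&0&0\\0&1&0\\0&0&a\end{pmatrix} : a\in\mathbb{K}^\times\right\},\qquad N_3=\left\{\begin{pmatrix} 1&0&d\\0&1&c\\0&0&1\end{pmatrix} : c,d\in\mathbb{K}\right\}.$$ Let $H_3=L_3\ltimes(N_3\times N_3)$, the semidirect product for the action $l(g_1,g_2)=(lg_1l^{-1},\,l^{-1}g_2l)$, where $(l,g_1,g_2)$ denotes the product $l\cdot(g_1,g_2)$, and let $\tilde H_3=\{1,\tau\}\ltimes H_3$, the semidirect product for the action $\tau(l,g_1,g_2)=(l^{-1},g_2,g_1)$. Let $\chi_{N_3}$ be the character of $N_3$ sending $\begin{pmatrix} 1&0&d\\0&1&c\\0&0&1\end{pmatrix}$ to $\psi_{\mathbb{K}}(d)$, and let $\tilde\chi_3$ be the character of $\tilde H_3$ with $$\tilde\chi_3(l,g_1,g_2)=\chi_{N_3}(g_1)\chi_{N_3}(g_2)\quad\text{for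 }(l,g_1,g_2)\in H_3,\qquad \tilde\chi_3(\tau)=-1.$$ Let $\tilde H_3$ act on the space $\mathfrak{gl}_3(\mathbb{K})$ of $3\times 3$ matrices by $$(l,g_1,g_2)\,x=l\,g_1\,x\,g_2^{\tau}\,l^{-1},\qquad \tau x=x^\tau .$$ A tempered generalized function on $\mathfrak{gl}_3(\mathbb{K})$ is a continuous linear functional on the space of Schwartz densities on $\mathfrak{gl}_3(\mathbb{K})$, regarded as a real vector space, and $f(hx)$ denotes the pull-back of $f$ under $x\mapsto hx$. Let $C^{-\xi}_{\tilde\chi_3}(\mathfrak{gl}_3(\mathbb{K}))$ be the space of those tempered generalized functions $f$ on $\mathfrak{gl}_3(\mathbb{K})$ that satisfy $f(hx)=\tilde\chi_3(h)f(x)$ for all $h\in\tilde H_3$. Then $$C^{-\xi}_{\tilde\chi_3}(\mathfrak{gl}_3(\mathbb{K}))=0.$$ -/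

import Mathlib

open scoped SchwartzMap Matrix MatrixGroups

attribute [local instance] Matrix.frobeniusNormedAddCommGroup Matrix.frobeniusNormedSpace

noncomputable section

/-! ### Equivariant tempered generalized functions on a real vector space -/

namespace Tempered

variable {E : Type*} [NormedAddCommGroup E] [NormedSpace ℝ E]

/-- A tempered generalized function on a finite dimensional real vector space `E` is a continuous
linear functional on the Schwartz densities `φ dx`, where `φ` runs over the Schwartz functions on
`E` and `dx` is a fixed Lebesgue measure; it is recorded by the functional `φ ↦ f (φ dx)`, an
element of `𝓢'(E, ℂ)`.  The push-forward of the density `φ dx` under a linear automorphism `A` is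
`|det A|⁻¹ (φ ∘ A⁻¹) dx`; this is the map `φ ↦ |det A|⁻¹ (φ ∘ A⁻¹)`. -/
def pushDensity (A : E ≃L[ℝ] E) : 𝓢(E, ℂ) →L[ℂ] 𝓢(E, ℂ) :=
  ((|LinearMap.det (A : E →ₗ[ℝ] E)|⁻¹ : ℝ) : ℂ) •
    SchwartzMap.compCLMOfContinuousLinearEquiv ℂ A.symm

/-- The pull-back `f ∘ A`, that is `x ↦ f (A x)`, of a tempered generalized function `f` under a
linear automorphism `A`: the transpose of the push-forward of Schwartz densities. -/
def pullback (A : E ≃L[ℝ] E) (f : 𝓢'(E, ℂ)) : 𝓢'(E, ℂ) :=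
  PointwiseConvergenceCLM.precomp ℂ (pushDensity A) f

theorem pullback_apply (A : E ≃L[ℝ] E) (f : 𝓢'(E, ℂ)) (φ : 𝓢(E, ℂ)) :
    pullback A f φ = ((|LinearMap.det (A : E →ₗ[ℝ] E)|⁻¹ : ℝ) : ℂ) *
      f (SchwartzMap.compCLMOfContinuousLinearEquiv ℂ A.symm φ) := by
  change f (pushDensity A φ) = _
  simp [pushDensity]

/-- For a group `H` acting linearly on `E` through `ρ` and a unitary character `χ` of `H`, the
space of `χ`-equivariant tempered generalized functions on `E`: those `f` with
`f (h x) = χ h • f x` for all `h` in `H`. -/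
def equivariant {H : Type*} [Group H] (ρ : H →* (E ≃L[ℝ] E)) (χ : H →* Circle) :
    Submodule ℂ 𝓢'(E, ℂ) where
  carrier := {f | ∀ h : H, pullback (ρ h) f = (χ h : ℂ) • f}
  zero_mem' h := by
    simp only [pullback]
    rw [map_zero, smul_zero]
  add_mem' {f g} hf hg h := by
    have hf' := hf h
    have hg' := hg h
    simp only [pullback] at hf' hg' ⊢
    rw [map_add, hf', hg', smul_add]
  smul_mem' c f hf h := by
    have hf' := hf h
    simp only [pullback] at hf' ⊢
    rw [map_smul, hf', smul_comm]

end Tempered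

/-! ### The groups -/

namespace GL3Model

/-- The homomorphism from the two element group `ℤˣ = {1, -1}` (which plays the role of `{1, τ}`)
that sends `-1` to a given element `t` with `t * t = 1`. -/
def involutionHom {G : Type*} [Group G] (t : G) (ht : t * t = 1) : ℤˣ →* G where
  toFun e := if e = 1 then 1 else t
  map_one' := by simp
  map_mul' a b := by
    rcases Int.units_eq_one_or a with rfl | rfl <;> rcases Int.units_eq_one_or b with rfl | rfl <;>
      simp [ht]

variable (K : Type*) [RCLike K]

/-- The group of matrices `diag(a, 1, a)`, `a ∈ Kˣ`. -/
def L3 : Subgroup (GL (Fin 3) K) where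
  carrier := {g | ∃ a : Kˣ, (g : Matrix (Fin 3) (Fin 3) K) = !![(a : K), 0, 0; 0, 1, 0; 0, 0, (a : K)]}
  one_mem' := ⟨1, by ext i j; fin_cases i <;> fin_cases j <;> simp⟩
  mul_mem' := by
    rintro g h ⟨a, ha⟩ ⟨b, hb⟩
    refine ⟨a * b, ?_⟩
    rw [Units.val_mul, ha, hb]
    ext i j; fin_cases i <;> fin_cases j <;> simp [Matrix.mul_apply, Fin.sum_univ_three]
  inv_mem' := by
    rintro g ⟨a, ha⟩
    refine ⟨a⁻¹, Units.inv_eq_of_mul_eq_one_right ?_⟩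
    rw [ha]
    ext i j; fin_cases i <;> fin_cases j <;> simp [Matrix.mul_apply, Fin.sum_univ_three]

/-- The group of matrices `[1, 0, d; 0, 1, c; 0, 0, 1]`, `c, d ∈ K`. -/
def N3 : Subgroup (GL (Fin 3) K) where
  carrier := {g | ∃ c d : K, (g : Matrix (Fin 3) (Fin 3) K) = !![1, 0, d; 0, 1, c; 0, 0, 1]}
  one_mem' := ⟨0, 0, by ext i j; fin_cases i <;> fin_cases j <;> simp⟩
  mul_mem' := by
    rintro g h ⟨c, d, hg⟩ ⟨c', d', hh⟩
    refine ⟨c' + c, d' + d, ?_⟩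
    rw [Units.val_mul, hg, hh]
    ext i j; fin_cases i <;> fin_cases j <;> simp [Matrix.mul_apply, Fin.sum_univ_three]
  inv_mem' := by
    rintro g ⟨c, d, hg⟩
    refine ⟨-c, -d, Units.inv_eq_of_mul_eq_one_right ?_⟩
    rw [hg]
    ext i j; fin_cases i <;> fin_cases j <;> simp [Matrix.mul_apply, Fin.sum_univ_three]

variable {K}

theorem L3_mul_comm (l m : L3 K) : l * m = m * l := by
  obtain ⟨l, a, ha⟩ := l
  obtain ⟨m, b, hb⟩ := m
  apply Subtype.ext
  apply Units.ext
  simp only [Subgroup.coe_mul, Units.val_mul, ha, hb]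
  ext i j; fin_cases i <;> fin_cases j <;> simp [Matrix.mul_apply, Fin.sum_univ_three, mul_comm]

/-- `L3` is stable under transposition, each of its elements being symmetric. -/
theorem L3_transpose (l : L3 K) :
    ((l : GL (Fin 3) K) : Matrix (Fin 3) (Fin 3) K)ᵀ = ((l : GL (Fin 3) K) : Matrix _ _ K) := by
  obtain ⟨l, a, ha⟩ := l
  simp only [ha]
  ext i j; fin_cases i <;> fin_cases j <;> simp

theorem L3_conj_eq (l : L3 K) (g : N3 K) : ∃ c d : K,
    ((g : GL (Fin 3) K) : Matrix (Fin 3) (Fin 3) K) 0 2 = d ∧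
    (((l : GL (Fin 3) K) * g * (l : GL (Fin 3) K)⁻¹ : GL (Fin 3) K) : Matrix (Fin 3) (Fin 3) K) =
      !![1, 0, d; 0, 1, c; 0, 0, 1] := by
  obtain ⟨g, c, d, hg⟩ := g
  obtain ⟨a, ha⟩ := l.2
  obtain ⟨b, hb⟩ := (l⁻¹).2
  have hab : (a : K) * b = 1 := by
    have h : ((l : GL (Fin 3) K) : Matrix (Fin 3) (Fin 3) K) *
        ((l⁻¹ : L3 K) : GL (Fin 3) K) = 1 := by
      rw [← Units.val_mul, ← Subgroup.coe_mul]; simp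
    rw [ha, hb] at h
    simpa [Matrix.mul_apply, Fin.sum_univ_three] using congrFun (congrFun h 0) 0
  refine ⟨c * b, d, by simp [hg], ?_⟩
  rw [← Subgroup.coe_inv, Units.val_mul, Units.val_mul, ha, hb]
  simp only [hg]
  ext i j
  fin_cases i <;> fin_cases j <;> simp [Matrix.mul_apply, Fin.sum_univ_three, hab]
  rw [mul_right_comm, hab, one_mul]

theorem L3_conj_mem (l : L3 K) (g : N3 K) :
    (l : GL (Fin 3) K) * g * (l : GL (Fin 3) K)⁻¹ ∈ N3 K := by
  obtain ⟨c, d, -, h⟩ := L3_conj_eq l g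
  exact ⟨c, d, h⟩

/-- The conjugation action `g ↦ l g l⁻¹` of `L3` on `N3`. -/
def conjN (l : L3 K) : N3 K →* N3 K where
  toFun g := ⟨(l : GL (Fin 3) K) * g * (l : GL (Fin 3) K)⁻¹, L3_conj_mem l g⟩
  map_one' := by ext1; simp
  map_mul' g h := by ext1; simp [mul_assoc]

theorem conjN_mul (l m : L3 K) (g : N3 K) : conjN (l * m) g = conjN l (conjN m g) := by
  ext1; simp [conjN, mul_assoc]

theorem conjN_one (g : N3 K) : conjN (1 : L3 K) g = g := by
  ext1; simp [conjN]

variable (K)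

/-- The action `l (g₁, g₂) = (l g₁ l⁻¹, l⁻¹ g₂ l)` of `L3` on `N3 × N3`. -/
def actL : L3 K →* MulAut (N3 K × N3 K) :=
  MonoidHom.mk'
    (fun l =>
      { toFun := fun n => (conjN l n.1, conjN l⁻¹ n.2)
        invFun := fun n => (conjN l⁻¹ n.1, conjN l n.2)
        left_inv := fun n => by simp [← conjN_mul, conjN_one]
        right_inv := fun n => by simp [← conjN_mul, conjN_one]
        map_mul' := fun n m => by simp })
    (fun l m => by
      refine MulEquiv.ext fun n => ?_
      change (conjN (l * m) n.1, conjN (l * m)⁻¹ n.2) =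
        (conjN l (conjN m n.1), conjN l⁻¹ (conjN m⁻¹ n.2))
      rw [← conjN_mul, ← conjN_mul, L3_mul_comm l m, mul_inv_rev])

/-- The group `L3 ⋉ (N3 × N3)`. The element `(l, g₁, g₂) = l · (g₁, g₂)` is
`inr l * inl (g₁, g₂)`. -/
abbrev H3 : Type _ := (N3 K × N3 K) ⋊[actL K] L3 K

/-- The element `(l, g₁, g₂) = l · (g₁, g₂)` of `H3`. -/
def H3.mk {K : Type*} [RCLike K] (l : L3 K) (g₁ g₂ : N3 K) : H3 K :=
  SemidirectProduct.inr l * SemidirectProduct.inl (g₁, g₂)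

/-- Inversion on the commutative group `L3`, as a homomorphism. -/
def invL : L3 K →* L3 K where
  toFun l := l⁻¹
  map_one' := inv_one
  map_mul' l m := by rw [mul_inv_rev, L3_mul_comm]

/-- The involution `τ (l, g₁, g₂) = (l⁻¹, g₂, g₁)` of `H3`. -/
def tauHom : H3 K →* H3 K :=
  SemidirectProduct.map (MulEquiv.prodComm (M := N3 K) (N := N3 K)).toMonoidHom (invL K)
    (fun l => by
      refine MonoidHom.ext fun n => ?_
      simp [actL, invL])

theorem tauHom_mk (l : L3 K) (g₁ g₂ : N3 K) :
    tauHom K (H3.mk l g₁ g₂) = H3.mk l⁻¹ g₂ g₁ := by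
  simp [H3.mk, tauHom, invL]

theorem tauHom_tauHom (h : H3 K) : tauHom K (tauHom K h) = h := by
  ext <;> simp [tauHom, invL]

/-- The automorphism `τ` of `H3`. -/
def tauAut : MulAut (H3 K) where
  toFun := tauHom K
  invFun := tauHom K
  left_inv := tauHom_tauHom K
  right_inv := tauHom_tauHom K
  map_mul' := map_mul _

theorem tauAut_mul_self : tauAut K * tauAut K = 1 :=
  MulEquiv.ext (tauHom_tauHom K)

/-- The group `{1, τ} ⋉ H3`. -/
abbrev H3tilde : Type _ := H3 K ⋊[involutionHom (tauAut K) (tauAut_mul_self K)] ℤˣ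

/-- The element `τ` of `H3tilde`. -/
def tau : H3tilde K := SemidirectProduct.inr (-1)

/-! ### The action on `3 × 3` matrices -/

/-- The space of `3 × 3` matrices. -/
abbrev gl3 : Type _ := Matrix (Fin 3) (Fin 3) K

variable {K}

/-- The automorphism `x ↦ g x h` of `gl3 K`, for invertible matrices `g` and `h`. -/
def leftRight (g h : GL (Fin 3) K) : gl3 K ≃L[ℝ] gl3 K :=
  LinearEquiv.toContinuousLinearEquiv
    { toFun := fun x => (g : gl3 K) * x * (h : gl3 K)
      invFun := fun x => ((g⁻¹ : GL (Fin 3) K) : gl3 K) * x * ((h⁻¹ : GL (Fin 3) K) : gl3 K)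
      map_add' := fun x y => by rw [mul_add, add_mul]
      map_smul' := fun c x => by simp
      left_inv := fun x => by
        beta_reduce
        rw [← mul_assoc, ← mul_assoc, Units.inv_mul, one_mul, mul_assoc, Units.mul_inv, mul_one]
      right_inv := fun x => by
        beta_reduce
        rw [← mul_assoc, ← mul_assoc, Units.mul_inv, one_mul, mul_assoc, Units.inv_mul, mul_one] }

@[simp] theorem leftRight_apply (g h : GL (Fin 3) K) (x : gl3 K) :
    leftRight g h x = (g : gl3 K) * x * (h : gl3 K) := rfl

/-- The transpose of an invertible matrix, as an invertible matrix. -/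
def transposeGL (g : GL (Fin 3) K) : GL (Fin 3) K where
  val := (g : gl3 K)ᵀ
  inv := ((g⁻¹ : GL (Fin 3) K) : gl3 K)ᵀ
  val_inv := by rw [← Matrix.transpose_mul, Units.inv_mul, Matrix.transpose_one]
  inv_val := by rw [← Matrix.transpose_mul, Units.mul_inv, Matrix.transpose_one]

variable (K)

/-- Transposition `x ↦ xᵀ` on `gl3 K`. -/
def transposeEquiv : gl3 K ≃L[ℝ] gl3 K :=
  LinearEquiv.toContinuousLinearEquiv (Matrix.transposeLinearEquiv (Fin 3) (Fin 3) ℝ K)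

@[simp] theorem transposeEquiv_apply (x : gl3 K) : transposeEquiv K x = xᵀ := rfl

theorem transposeEquiv_mul_self : transposeEquiv K * transposeEquiv K = 1 := by
  refine ContinuousLinearEquiv.ext (funext fun x => ?_)
  change xᵀᵀ = x
  simp

/-- The action `(g₁, g₂) x = g₁ x g₂ᵀ` of `N3 × N3`. -/
def rhoN : N3 K × N3 K →* (gl3 K ≃L[ℝ] gl3 K) :=
  MonoidHom.mk' (fun n => leftRight (n.1 : GL (Fin 3) K) (transposeGL (n.2 : GL (Fin 3) K)))
    (fun n m => by
      refine ContinuousLinearEquiv.ext (funext fun x => ?_)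
      change leftRight _ _ x = leftRight _ _ (leftRight _ _ x)
      simp [transposeGL, mul_assoc])

/-- The action `l x = l x l⁻¹` of `L3`. -/
def rhoL : L3 K →* (gl3 K ≃L[ℝ] gl3 K) :=
  MonoidHom.mk' (fun l => leftRight (l : GL (Fin 3) K) ((l : GL (Fin 3) K)⁻¹))
    (fun l m => by
      refine ContinuousLinearEquiv.ext (funext fun x => ?_)
      change leftRight _ _ x = leftRight _ _ (leftRight _ _ x)
      simp only [leftRight_apply, Subgroup.coe_mul, mul_inv_rev, Units.val_mul, mul_assoc])

/-- The action `(l, g₁, g₂) x = l g₁ x g₂ᵀ l⁻¹` of `H3`. -/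
def rhoH : H3 K →* (gl3 K ≃L[ℝ] gl3 K) :=
  SemidirectProduct.lift (rhoN K) (rhoL K) (fun l => by
    refine MonoidHom.ext fun n => ContinuousLinearEquiv.ext (funext fun x => ?_)
    change rhoN K (conjN l n.1, conjN l⁻¹ n.2) x = rhoL K l (rhoN K n ((rhoL K l)⁻¹ x))
    rw [← map_inv]
    have h := L3_transpose l
    have h' := L3_transpose l⁻¹
    simp only [Subgroup.coe_inv] at h'
    simp only [rhoN, rhoL, MonoidHom.mk'_apply, leftRight_apply, conjN, MonoidHom.coe_mk,
      OneHom.coe_mk, transposeGL, Units.val_mul, Matrix.transpose_mul, Subgroup.coe_inv, inv_inv,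
      h, h', mul_assoc])

theorem rhoH_mk (l : L3 K) (g₁ g₂ : N3 K) (x : gl3 K) :
    rhoH K (H3.mk l g₁ g₂) x =
      ((l : GL (Fin 3) K) : gl3 K) * ((g₁ : GL (Fin 3) K) : gl3 K) * x *
        ((g₂ : GL (Fin 3) K) : gl3 K)ᵀ * (((l : GL (Fin 3) K)⁻¹ : GL (Fin 3) K) : gl3 K) := by
  rw [H3.mk, map_mul]
  simp only [rhoH, SemidirectProduct.lift_inr, SemidirectProduct.lift_inl]
  change rhoL K l (rhoN K (g₁, g₂) x) = _
  simp only [rhoN, rhoL, MonoidHom.mk'_apply, leftRight_apply, transposeGL, mul_assoc]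

/-- Every element of `H3` is of the form `(l, g₁, g₂)`. -/
theorem H3.exists_eq_mk {K : Type*} [RCLike K] (h : H3 K) :
    ∃ (l : L3 K) (g₁ g₂ : N3 K), h = H3.mk l g₁ g₂ := by
  refine ⟨h.right, ((actL K h.right)⁻¹ h.left).1, ((actL K h.right)⁻¹ h.left).2, ?_⟩
  ext1
  · simp only [H3.mk, SemidirectProduct.mul_left, SemidirectProduct.left_inr,
      SemidirectProduct.right_inr, SemidirectProduct.left_inl, one_mul]
    exact (MulEquiv.apply_symm_apply (actL K h.right) h.left).symm
  · simp [H3.mk]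

/-- The action of `H3tilde` on `gl3 K`, given by `(l, g₁, g₂) x = l g₁ x g₂ᵀ l⁻¹` and
`τ x = xᵀ`. -/
def rho : H3tilde K →* (gl3 K ≃L[ℝ] gl3 K) :=
  SemidirectProduct.lift (rhoH K) (involutionHom (transposeEquiv K) (transposeEquiv_mul_self K))
    (fun e => by
      refine MonoidHom.ext fun h => ?_
      rcases Int.units_eq_one_or e with rfl | rfl
      · simp
      · obtain ⟨l, g₁, g₂, rfl⟩ := h.exists_eq_mk
        refine ContinuousLinearEquiv.ext (funext fun x => ?_)
        change rhoH K (tauHom K (H3.mk l g₁ g₂)) x =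
          (rhoH K (H3.mk l g₁ g₂) xᵀ)ᵀ
        rw [tauHom_mk, rhoH_mk, rhoH_mk]
        have h := L3_transpose l
        have h' := L3_transpose l⁻¹
        simp only [Subgroup.coe_inv] at h'
        simp only [Matrix.transpose_mul, Matrix.transpose_transpose, Subgroup.coe_inv, inv_inv,
          h, h', mul_assoc])

theorem rho_H3 (l : L3 K) (g₁ g₂ : N3 K) (x : gl3 K) :
    rho K (SemidirectProduct.inl (H3.mk l g₁ g₂)) x =
      ((l : GL (Fin 3) K) : gl3 K) * ((g₁ : GL (Fin 3) K) : gl3 K) * x *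
        ((g₂ : GL (Fin 3) K) : gl3 K)ᵀ * (((l : GL (Fin 3) K)⁻¹ : GL (Fin 3) K) : gl3 K) := by
  rw [rho, SemidirectProduct.lift_inl, rhoH_mk]

theorem rho_tau (x : gl3 K) : rho K (tau K) x = xᵀ := by
  rw [rho, tau, SemidirectProduct.lift_inr]
  rfl

/-! ### The character -/

variable {K}

/-- The character of `N3` that sends `[1, 0, d; 0, 1, c; 0, 0, 1]` to `ψ d`. -/
def chiN (ψ : AddChar K Circle) : N3 K →* Circle where
  toFun g := ψ (((g : GL (Fin 3) K) : gl3 K) 0 2)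
  map_one' := by simp
  map_mul' := by
    rintro ⟨g, c, d, hg⟩ ⟨h, c', d', hh⟩
    simp [hg, hh, Matrix.mul_apply, Fin.sum_univ_three, AddChar.map_add_eq_mul, mul_comm]

theorem chiN_conjN (ψ : AddChar K Circle) (l : L3 K) (g : N3 K) :
    chiN ψ (conjN l g) = chiN ψ g := by
  obtain ⟨c, d, h₁, h₂⟩ := L3_conj_eq l g
  change ψ ((((l : GL (Fin 3) K) * g * (l : GL (Fin 3) K)⁻¹ : GL (Fin 3) K) : gl3 K) 0 2) =
    ψ (((g : GL (Fin 3) K) : gl3 K) 0 2)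
  rw [h₁, h₂]
  simp

/-- The character `(l, g₁, g₂) ↦ chiN ψ g₁ * chiN ψ g₂` of `H3`. -/
def chiH (ψ : AddChar K Circle) : H3 K →* Circle :=
  SemidirectProduct.lift
    ((chiN ψ).coprod (chiN ψ)) 1
    (fun l => by
      refine MonoidHom.ext fun n => ?_
      change chiN ψ (conjN l n.1) * chiN ψ (conjN l⁻¹ n.2) =
        1 * (chiN ψ n.1 * chiN ψ n.2) * 1⁻¹
      simp [chiN_conjN])

theorem chiH_mk (ψ : AddChar K Circle) (l : L3 K) (g₁ g₂ : N3 K) :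
    chiH ψ (H3.mk l g₁ g₂) = chiN ψ g₁ * chiN ψ g₂ := by
  simp [chiH, H3.mk]

/-- The character of `H3tilde` that sends `(l, g₁, g₂)` to `chiN ψ g₁ * chiN ψ g₂`
and `τ` to `-1`. -/
def chi (ψ : AddChar K Circle) : H3tilde K →* Circle :=
  SemidirectProduct.lift (chiH ψ) (involutionHom (-1) (by ext; simp))
    (fun e => by
      refine MonoidHom.ext fun h => ?_
      rcases Int.units_eq_one_or e with rfl | rfl
      · simp
      · obtain ⟨l, g₁, g₂, rfl⟩ := h.exists_eq_mk
        change chiH ψ (tauHom K (H3.mk l g₁ g₂)) = -1 * chiH ψ (H3.mk l g₁ g₂) * (-1)⁻¹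
        rw [tauHom_mk, chiH_mk, chiH_mk, mul_comm (-1 : Circle), mul_inv_cancel_right, mul_comm])

theorem chi_H3 (ψ : AddChar K Circle) (l : L3 K) (g₁ g₂ : N3 K) :
    chi ψ (SemidirectProduct.inl (H3.mk l g₁ g₂)) = chiN ψ g₁ * chiN ψ g₂ := by
  rw [chi, SemidirectProduct.lift_inl, chiH_mk]

theorem chi_tau (ψ : AddChar K Circle) : (chi ψ (tau K) : ℂ) = -1 := by
  rw [chi, tau, SemidirectProduct.lift_inr]
  simp [involutionHom]

end GL3Model

end

/-! Write x_ij for the matrix entries, with indices 0, 1, 2, and let λ ≠ 0 be such that ψ(x) =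
exp(2πi Re(λx)). The group N₃ × N₃ adds multiples of the last row and of the last column to the
others, so its Lie algebra acts by vector fields such as x₂₀∂₀₀ + x₂₁∂₀₁ + x₂₂∂₀₂, whose
coefficients do not involve the upper left 2 × 2 block. A Fourier transform in the four entries of
that block turns ∂₀₀ and ∂₀₁ into multiplications (`eqn_of_deriv`). For every entry k of the last
row or column other than the corner, an equation (2πi e_k + x₂₂∂_k) F = 0 remains, where e_k is the
polynomial `armEqn`; for k = (0, 2) it is x₂₀x₀₀ + x₂₁x₀₁ + λ. The structure `Model` collects these
equations, the invariance under the torus and the sign under transposition.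

Vanishing rests on one principle, `apply_swap_eq`: a tempered distribution invariant under (x_i,
x_j) ↦ (a x_i, a⁻¹ x_j) is invariant under the exchange of x_i and x_j. A Fourier transform in x_j
makes it homogeneous under simultaneous scaling of both coordinates, with the homogeneity of
integration over a line. Such a functional annihilates every Schwartz function whose integrals over
all lines through the origin vanish (`IsHomogeneousOn.apply_eq_zero`), and the line integrals of the
transform of φ do not change when the two arguments of φ are exchanged. So wherever the distribution
lives on a graph on which the torus acts on two free coordinates by a and a⁻¹, and transposition
exchanges these two, it equals its own negative (`eq_zero_of_graph_of_symmetric`).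

This applies on successive strata. Where x₂₂ ≠ 0, the e_k are the partial derivatives of
`potential`, and the factor exp(-2πi Re(potential/x₂₂)) turns the equations into translation
invariance in the entries k. The hyperbolic pair is x₁₀, x₀₁ (`Model.corner_supported`). Where x₂₂ =
0, the equations become e_k = 0, and a combination of them gives λ(x₀₂ - x₂₀) = 0. If x₂₀ ≠ 0, the
equations can be solved for x₀₁, x₁₀ and x₀₀, and the pair is x₂₁, x₁₂
(`Residual.eq_zero_of_invertible`). If x₂₀ = 0 and x₂₁x₁₂ ≠ 0, the same pair works
(`Residual.eq_zero_of_invertible_mul`). If x₂₀ = 0 and x₂₁x₁₂ = 0, the equations force λ² = 0, a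
contradiction (`Residual.eq_zero_of_kills`).

Distributions supported on {P = 0} need not be annihilated by P, since they may involve transversal
derivatives. `eq_zero_of_supported` deals with this at each stage: by finiteness of the order a high
power of P annihilates the distribution, and the factors are removed one at a time inside a class
stable under multiplication by P. -/

/-! ### Families of functions that are stable under directional derivatives -/

section ClosedFamily

open scoped ContDiff

variable {E : Type*} [NormedAddCommGroup E] [NormedSpace ℝ E] [FiniteDimensional ℝ E]

/-- Induction on the order of differentiability, for all members of `S` at once: in finite dimension
the Fréchet derivative is as smooth as its values on fixed vectors, and these lie in `S` again. -/
theorem contDiff_of_mem_closedFamily {S : Set (E → ℂ)}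
    (hS : ∀ g ∈ S, Differentiable ℝ g ∧ ∀ m, ∃ g' ∈ S, ∀ x, fderiv ℝ g x m = g' x) :
    ∀ g ∈ S, ContDiff ℝ ∞ g := by
  have key : ∀ n : ℕ, ∀ g ∈ S, ContDiff ℝ n g := by
    intro n
    induction n with
    | zero => intro g hg; exact contDiff_zero.2 (hS g hg).1.continuous
    | succ n ih =>
      intro g hg
      rw [Nat.cast_succ, contDiff_succ_iff_fderiv]
      refine ⟨(hS g hg).1, by simp, ?_⟩
      refine contDiff_clm_apply_iff.2 fun m => ?_
      obtain ⟨g', hg', h⟩ := (hS g hg).2 m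
      rw [funext h]
      exact ih g' hg'
  intro g hg
  exact contDiff_infty.2 fun n => key n g hg

/-- Reduces Schwartz estimates to bounds on the functions themselves. The bounds are functions of a
parameter `p` taken from a cone `B`: constants give uniform estimates, and seminorms of `p` give
continuity of an operator on Schwartz functions. -/
theorem decay_of_mem_closedFamily {P : Type*} {S : Set (P → E → ℂ)} {B : Set (P → ℝ)}
    (hadd : ∀ b ∈ B, ∀ b' ∈ B, b + b' ∈ B) (hsmul : ∀ c : ℝ, 0 ≤ c → ∀ b ∈ B, c • b ∈ B)
    (hB : B.Nonempty)
    (hdiff : ∀ T ∈ S, ∀ p, Differentiable ℝ (T p))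
    (hderiv : ∀ T ∈ S, ∀ m, ∃ T' ∈ S, ∀ p x, fderiv ℝ (T p) x m = T' p x)
    (hbound : ∀ T ∈ S, ∀ k : ℕ, ∃ b ∈ B, ∀ p x, ‖x‖ ^ k * ‖T p x‖ ≤ b p) :
    ∀ T ∈ S, (∀ p, ContDiff ℝ ∞ (T p)) ∧
      ∀ k n : ℕ, ∃ b ∈ B, ∀ p x, ‖x‖ ^ k * ‖iteratedFDeriv ℝ n (T p) x‖ ≤ b p := by
  have hsm : ∀ T ∈ S, ∀ p, ContDiff ℝ ∞ (T p) := by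
    intro T hT p
    refine contDiff_of_mem_closedFamily (S := {g | ∃ T ∈ S, T p = g}) ?_ _ ⟨T, hT, rfl⟩
    rintro _ ⟨T, hT, rfl⟩
    refine ⟨hdiff T hT p, fun m => ?_⟩
    obtain ⟨T', hT', h⟩ := hderiv T hT m
    exact ⟨_, ⟨T', hT', rfl⟩, h p⟩
  intro T hT
  refine ⟨hsm T hT, fun k n => ?_⟩
  induction n generalizing T with
  | zero =>
    obtain ⟨b, hb, h⟩ := hbound T hT k
    exact ⟨b, hb, by simpa using h⟩
  | succ n ih =>
    let e := Module.finBasis ℝ E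
    choose T' hT' h using fun i => hderiv T hT (e i)
    choose b hb hbb using fun i => ih (T' i) (hT' i)
    let ℓ : Fin (Module.finrank ℝ E) → (E →L[ℝ] ℝ) := fun i => LinearMap.toContinuousLinearMap (e.coord i)
    let L : Fin (Module.finrank ℝ E) → (ℂ →L[ℝ] (E →L[ℝ] ℂ)) :=
      fun i => ContinuousLinearMap.smulRightL ℝ E ℂ (ℓ i)
    -- In a basis, the derivative is a sum of fixed linear maps applied to members of the family, so
    -- order n + 1 for `T` follows from order n for the `T' i`.
    have hf : ∀ p, fderiv ℝ (T p) = fun x => ∑ i, (L i) (T' i p x) := by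
      intro p
      funext x
      ext m
      conv_lhs => rw [← e.sum_repr m]
      rw [map_sum, _root_.sum_apply]
      refine Finset.sum_congr rfl fun i _ => ?_
      rw [map_smul, h i p x]
      rfl
    have hsumB : ∀ (s : Finset (Fin (Module.finrank ℝ E))) (c : Fin (Module.finrank ℝ E) → ℝ),
        (∀ i, 0 ≤ c i) → ∃ b' ∈ B, ∀ p, ∑ i ∈ s, c i * b i p ≤ b' p := by
      intro s c hc
      induction s using Finset.induction_on with
      | empty =>
        obtain ⟨b0, hb0⟩ := hB
        exact ⟨(0 : ℝ) • b0, hsmul 0 le_rfl b0 hb0, fun p => by simp⟩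
      | insert i s hi ih =>
        obtain ⟨b', hb', h'⟩ := ih
        refine ⟨c i • b i + b', hadd _ (hsmul _ (hc i) _ (hb i)) _ hb', fun p => ?_⟩
        rw [Finset.sum_insert hi]
        exact add_le_add le_rfl (h' p)
    obtain ⟨b', hb', h'⟩ := hsumB Finset.univ (fun i => ‖L i‖) (fun i => norm_nonneg (L i))
    refine ⟨b', hb', fun p x => le_trans ?_ (h' p)⟩
    rw [← norm_iteratedFDeriv_fderiv, hf p]
    have hc : ∀ i, ContDiff ℝ ∞ (fun x => L i (T' i p x)) := fun i =>
      (L i).contDiff.comp (hsm _ (hT' i) p)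
    have : iteratedFDeriv ℝ n (fun x => ∑ i, (L i) (T' i p x)) x =
        ∑ i, iteratedFDeriv ℝ n (fun x => L i (T' i p x)) x := by
      have := iteratedFDeriv_sum (𝕜 := ℝ) (i := n) (f := fun i x => L i (T' i p x)) (u := Finset.univ)
        (fun i _ => (hc i).of_le (mod_cast le_top))
      rw [this]
      simp
    rw [this]
    calc ‖x‖ ^ k * ‖∑ i, iteratedFDeriv ℝ n (fun x => L i (T' i p x)) x‖
        ≤ ‖x‖ ^ k * ∑ i, ‖L i‖ * ‖iteratedFDeriv ℝ n (T' i p) x‖ := by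
          gcongr
          refine (norm_sum_le _ _).trans (Finset.sum_le_sum fun i _ => ?_)
          exact (L i).norm_iteratedFDeriv_comp_left (hsm _ (hT' i) p).contDiffAt (mod_cast le_top)
      _ = ∑ i, ‖L i‖ * (‖x‖ ^ k * ‖iteratedFDeriv ℝ n (T' i p) x‖) := by
          rw [Finset.mul_sum]
          exact Finset.sum_congr rfl fun i _ => by ring
      _ ≤ ∑ i, ‖L i‖ * b i p := by
          gcongr with i _
          exact hbb i p x

/-- Uniform decay of all derivatives for the functions of a family whose directional derivatives
are finite sums of functions of the family. -/
theorem decay_of_closedFamily {P : Type*} {S : Set (P → E → ℂ)} {B : Set (P → ℝ)}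
    (hadd : ∀ b ∈ B, ∀ b' ∈ B, b + b' ∈ B) (hsmul : ∀ c : ℝ, 0 ≤ c → ∀ b ∈ B, c • b ∈ B)
    (hB : B.Nonempty)
    (hdiff : ∀ T ∈ S, ∀ p, Differentiable ℝ (T p))
    (hderiv : ∀ T ∈ S, ∀ m, (fun p x => fderiv ℝ (T p) x m) ∈ AddSubmonoid.closure S)
    (hbound : ∀ T ∈ S, ∀ k : ℕ, ∃ b ∈ B, ∀ p x, ‖x‖ ^ k * ‖T p x‖ ≤ b p) :
    ∀ T ∈ AddSubmonoid.closure S, (∀ p, ContDiff ℝ ∞ (T p)) ∧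
      ∀ k n : ℕ, ∃ b ∈ B, ∀ p x, ‖x‖ ^ k * ‖iteratedFDeriv ℝ n (T p) x‖ ≤ b p := by
  have hd : ∀ T ∈ AddSubmonoid.closure S, ∀ p, Differentiable ℝ (T p) := by
    intro T hT p
    induction hT using AddSubmonoid.closure_induction with
    | mem T hT => exact hdiff T hT p
    | zero => exact differentiable_const 0
    | add T T' _ _ h h' => exact h.add h'
  refine decay_of_mem_closedFamily (S := (AddSubmonoid.closure S : Set (P → E → ℂ)))
    hadd hsmul hB hd ?_ ?_
  · intro T hT m
    suffices h : (fun p x => fderiv ℝ (T p) x m) ∈ AddSubmonoid.closure S from ⟨_, h, fun _ _ => rfl⟩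
    induction hT using AddSubmonoid.closure_induction with
    | mem T hT => exact hderiv T hT m
    | zero =>
      convert AddSubmonoid.zero_mem _ using 1
      funext p x
      change fderiv ℝ (fun _ => (0 : ℂ)) x m = 0
      simp
    | add T T' hT hT' h h' =>
      convert AddSubmonoid.add_mem _ h h' using 1
      funext p x
      change fderiv ℝ (T p + T' p) x m = _
      rw [fderiv_add (hd T hT p x) (hd T' hT' p x)]
      rfl
  · intro T hT k
    induction hT using AddSubmonoid.closure_induction with
    | mem T hT => exact hbound T hT k
    | zero =>
      obtain ⟨b0, hb0⟩ := hB
      exact ⟨(0 : ℝ) • b0, hsmul 0 le_rfl b0 hb0, fun p x => by simp⟩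
    | add T T' _ _ h h' =>
      obtain ⟨b, hb, h⟩ := h
      obtain ⟨b', hb', h'⟩ := h'
      refine ⟨b + b', hadd b hb b' hb', fun p x => ?_⟩
      calc ‖x‖ ^ k * ‖T p x + T' p x‖ ≤ ‖x‖ ^ k * (‖T p x‖ + ‖T' p x‖) := by
            gcongr; exact norm_add_le _ _
        _ ≤ _ := by rw [mul_add]; exact add_le_add (h p x) (h' p x)

/-- A function in a family of rapidly decreasing functions whose directional derivatives are
finite sums of functions of the family is a Schwartz function. -/
theorem exists_schwartzMap_of_closedFamily {S : Set (E → ℂ)}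
    (hdiff : ∀ g ∈ S, Differentiable ℝ g)
    (hderiv : ∀ g ∈ S, ∀ m, (fun x => fderiv ℝ g x m) ∈ AddSubmonoid.closure S)
    (hbound : ∀ g ∈ S, ∀ k : ℕ, ∃ C : ℝ, ∀ x, ‖x‖ ^ k * ‖g x‖ ≤ C) :
    ∀ g ∈ S, ∃ φ : 𝓢(E, ℂ), ∀ x, φ x = g x := by
  intro g hg
  let c : (E → ℂ) →+ (Unit → E → ℂ) :=
    { toFun := fun g _ => g, map_zero' := rfl, map_add' := fun _ _ => rfl }
  have hS : ∀ g ∈ AddSubmonoid.closure S, c g ∈ AddSubmonoid.closure (c '' S) := by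
    intro g hg
    rw [← AddMonoidHom.map_mclosure]
    exact ⟨g, hg, rfl⟩
  obtain ⟨h1, h2⟩ := decay_of_closedFamily (P := Unit) (S := c '' S) (B := Set.univ)
    (by simp) (by simp) ⟨0, trivial⟩ (by rintro _ ⟨g, hg, rfl⟩ _; exact hdiff g hg)
    (by rintro _ ⟨g, hg, rfl⟩ m; exact hS _ (hderiv g hg m))
    (by
      rintro _ ⟨g, hg, rfl⟩ k
      obtain ⟨C, h⟩ := hbound g hg k
      exact ⟨fun _ => C, trivial, fun _ => h⟩)
    (c g) (AddSubmonoid.subset_closure ⟨g, hg, rfl⟩)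
  refine ⟨⟨g, h1 (), fun k n => ?_⟩, fun x => rfl⟩
  obtain ⟨b, -, h⟩ := h2 k n
  exact ⟨b (), h ()⟩

end ClosedFamily

/-! ### Tempered distributions and one-parameter families of linear changes of variables -/

section LinearFlow

open scoped ContDiff LineDeriv

variable {E : Type*} [NormedAddCommGroup E] [NormedSpace ℝ E]

theorem SchwartzMap.one_add_norm_pow_mul_norm_iteratedFDeriv_le (φ : 𝓢(E, ℂ)) (k n : ℕ) :
    ∃ C : ℝ, 0 ≤ C ∧ ∀ x, (1 + ‖x‖) ^ k * ‖iteratedFDeriv ℝ n φ x‖ ≤ C :=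
  ⟨2 ^ k * ((Finset.Iic (k, n)).sup fun m => SchwartzMap.seminorm ℝ m.1 m.2) φ,
    mul_nonneg (by positivity) (apply_nonneg _ _),
    fun x => SchwartzMap.one_add_le_sup_seminorm_apply (𝕜 := ℝ) (m := (k, n)) le_rfl le_rfl φ x⟩

theorem SchwartzMap.one_add_norm_pow_mul_norm_le (φ : 𝓢(E, ℂ)) (k : ℕ) :
    ∃ C : ℝ, 0 ≤ C ∧ ∀ x, (1 + ‖x‖) ^ k * ‖φ x‖ ≤ C := by
  simpa using φ.one_add_norm_pow_mul_norm_iteratedFDeriv_le k 0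

theorem SchwartzMap.one_add_norm_pow_mul_norm_fderiv_le (φ : 𝓢(E, ℂ)) (k : ℕ) :
    ∃ C : ℝ, 0 ≤ C ∧ ∀ x, (1 + ‖x‖) ^ k * ‖fderiv ℝ φ x‖ ≤ C := by
  simpa only [← norm_iteratedFDeriv_fderiv, norm_iteratedFDeriv_zero] using
    φ.one_add_norm_pow_mul_norm_iteratedFDeriv_le k 1

theorem SchwartzMap.one_add_norm_pow_mul_norm_fderiv_fderiv_le (φ : 𝓢(E, ℂ)) (k : ℕ) :
    ∃ C : ℝ, 0 ≤ C ∧ ∀ x, (1 + ‖x‖) ^ k * ‖fderiv ℝ (fderiv ℝ φ) x‖ ≤ C := by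
  simpa only [← norm_iteratedFDeriv_fderiv, norm_iteratedFDeriv_zero] using
    φ.one_add_norm_pow_mul_norm_iteratedFDeriv_le k 2

theorem SchwartzMap.differentiable_fderiv (φ : 𝓢(E, ℂ)) : Differentiable ℝ (fderiv ℝ φ) :=
  ((φ.smooth 2).fderiv_right (m := 1) (by norm_num)).differentiable (by norm_num)

theorem SchwartzMap.fderiv_fderiv_comm (φ : 𝓢(E, ℂ)) (x v w : E) :
    fderiv ℝ (fderiv ℝ φ) x v w = fderiv ℝ (fderiv ℝ φ) x w v :=
  second_derivative_symmetric (fun y => φ.hasFDerivAt y) (φ.differentiable_fderiv x).hasFDerivAt v w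

theorem SchwartzMap.fderiv_lineDerivOp (φ : 𝓢(E, ℂ)) (x v w : E) :
    fderiv ℝ (∂_{v} φ : 𝓢(E, ℂ)) x w = fderiv ℝ (fderiv ℝ φ) x w v := by
  have : (∂_{v} φ : 𝓢(E, ℂ)) = fun x => fderiv ℝ φ x v := rfl
  rw [funext_iff] at this
  change fderiv ℝ (fun x => fderiv ℝ φ x v) x w = _
  rw [fderiv_clm_apply (φ.differentiable_fderiv x) (differentiableAt_const v)]
  simp

/-- A tempered distribution is bounded on bounded sets of Schwartz functions. -/
theorem SchwartzMap.exists_norm_apply_le {P : Type*} (T : 𝓢(E, ℂ) →L[ℂ] ℂ) (g : P → 𝓢(E, ℂ))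
    (hg : ∀ k n : ℕ, ∃ C : ℝ, ∀ p x, ‖x‖ ^ k * ‖iteratedFDeriv ℝ n (g p) x‖ ≤ C) :
    ∃ C : ℝ, ∀ p, ‖T (g p)‖ ≤ C := by
  obtain ⟨s, C, -, h⟩ := Seminorm.bound_of_continuous (schwartz_withSeminorms ℂ E ℂ)
    ((normSeminorm ℂ ℂ).comp T.toLinearMap) (by exact T.continuous.norm)
  have hg' : ∀ m : ℕ × ℕ, ∃ C : ℝ, 0 ≤ C ∧ ∀ p, schwartzSeminormFamily ℂ E ℂ m (g p) ≤ C := by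
    intro m
    obtain ⟨C, hC⟩ := hg m.1 m.2
    refine ⟨max C 0, le_max_right _ _, fun p => ?_⟩
    exact SchwartzMap.seminorm_le_bound ℂ m.1 m.2 (g p) (le_max_right _ _)
      fun x => (hC p x).trans (le_max_left _ _)
  choose c hc0 hc using hg'
  refine ⟨C * ∑ m ∈ s, c m, fun p => (h (g p)).trans ?_⟩
  rw [_root_.smul_apply, NNReal.smul_def, smul_eq_mul]
  gcongr
  refine Seminorm.finset_sup_apply_le (Finset.sum_nonneg fun m _ => hc0 m) fun m hm => ?_
  exact (hc m p).trans (Finset.single_le_sum (fun m _ => hc0 m) hm)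

/-! ### Weighted Taylor estimates along x + t X x. -/

section Bounds

variable (X : E →L[ℝ] E)

/-- For small t the displacement t X x is at most half of x, so decay at the moved point is as good
as decay at x. -/
theorem one_add_norm_le_of_abs_mul_le {t : ℝ} (ht : |t| * ‖X‖ ≤ 1 / 2) (x : E) :
    1 + ‖x‖ ≤ 2 * (1 + ‖x + t • X x‖) := by
  have h1 : ‖x‖ ≤ ‖x + t • X x‖ + ‖t • X x‖ := by
    simpa using norm_sub_le (x + t • X x) (t • X x)
  have h2 : ‖t • X x‖ ≤ 1 / 2 * ‖x‖ := by
    rw [norm_smul, Real.norm_eq_abs]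
    calc |t| * ‖X x‖ ≤ |t| * (‖X‖ * ‖x‖) := by gcongr; exact X.le_opNorm x
      _ = |t| * ‖X‖ * ‖x‖ := by ring
      _ ≤ _ := by gcongr
  linarith

theorem one_add_norm_pow_mul_norm_comp_le {F : Type*} [NormedAddCommGroup F] {G : E → F}
    {k : ℕ} {C : ℝ} (hC : ∀ y, (1 + ‖y‖) ^ k * ‖G y‖ ≤ C) {t : ℝ} (ht : |t| * ‖X‖ ≤ 1 / 2) (x : E) :
    (1 + ‖x‖) ^ k * ‖G (x + t • X x)‖ ≤ 2 ^ k * C := by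
  calc (1 + ‖x‖) ^ k * ‖G (x + t • X x)‖
      ≤ (2 * (1 + ‖x + t • X x‖)) ^ k * ‖G (x + t • X x)‖ := by
        gcongr; exact one_add_norm_le_of_abs_mul_le X ht x
    _ = 2 ^ k * ((1 + ‖x + t • X x‖) ^ k * ‖G (x + t • X x)‖) := by rw [mul_pow]; ring
    _ ≤ _ := by gcongr; exact hC _

theorem hasDerivAt_add_smul {F : Type*} [NormedAddCommGroup F] [NormedSpace ℝ F] {G : E → F}
    (hG : Differentiable ℝ G) (x v : E) (s : ℝ) :
    HasDerivAt (fun s : ℝ => G (x + s • v)) (fderiv ℝ G (x + s • v) v) s := by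
  have h : HasDerivAt (fun s : ℝ => x + s • v) v s := by
    simpa using ((hasDerivAt_id s).smul_const v).const_add x
  exact (hG _).hasFDerivAt.comp_hasDerivAt s h

/-- Mean value inequality in t. The velocity X x grows linearly in x, which costs one power of the
weight; the second order version below costs two. -/
theorem one_add_norm_pow_mul_norm_sub_le {F : Type*} [NormedAddCommGroup F] [NormedSpace ℝ F]
    {G : E → F} (hG : Differentiable ℝ G) {k : ℕ} {C : ℝ}
    (hC : ∀ y, (1 + ‖y‖) ^ (k + 1) * ‖fderiv ℝ G y‖ ≤ C) {t : ℝ} (ht : |t| * ‖X‖ ≤ 1 / 2) (x : E) :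
    (1 + ‖x‖) ^ k * ‖G (x + t • X x) - G x‖ ≤ 2 ^ (k + 1) * C * ‖X‖ * |t| := by
  have hpos : 0 < (1 + ‖x‖) ^ k := by positivity
  have key := Convex.norm_image_sub_le_of_norm_hasDerivWithin_le
    (f := fun s : ℝ => G (x + s • X x)) (f' := fun s => fderiv ℝ G (x + s • X x) (X x))
    (s := Set.Icc (-|t|) |t|) (x := 0) (y := t) (C := 2 ^ (k + 1) * C * ‖X‖ / (1 + ‖x‖) ^ k)
    (fun s _ => (hasDerivAt_add_smul hG x (X x) s).hasDerivWithinAt)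
    (fun s hs => ?_) (convex_Icc _ _) (by simp) ⟨neg_abs_le t, le_abs_self t⟩
  · simp only [zero_smul, add_zero, sub_zero, Real.norm_eq_abs] at key
    rw [mul_comm]
    rwa [div_mul_eq_mul_div, le_div_iff₀ hpos] at key
  · have hs' : |s| * ‖X‖ ≤ 1 / 2 :=
      (mul_le_mul_of_nonneg_right (abs_le.2 hs) (norm_nonneg _)).trans ht
    have h1 := one_add_norm_pow_mul_norm_comp_le X hC hs' x
    rw [le_div_iff₀ hpos]
    calc ‖fderiv ℝ G (x + s • X x) (X x)‖ * (1 + ‖x‖) ^ k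
        ≤ ‖fderiv ℝ G (x + s • X x)‖ * (‖X‖ * (1 + ‖x‖)) * (1 + ‖x‖) ^ k := by
          gcongr
          refine (ContinuousLinearMap.le_opNorm _ _).trans ?_
          gcongr
          refine (X.le_opNorm x).trans ?_
          gcongr
          linarith
      _ = (1 + ‖x‖) ^ (k + 1) * ‖fderiv ℝ G (x + s • X x)‖ * ‖X‖ := by ring
      _ ≤ _ := by gcongr

theorem one_add_norm_pow_mul_norm_sub_sub_le {φ : E → ℂ} (hφ : Differentiable ℝ φ)
    (hφ' : Differentiable ℝ (fderiv ℝ φ)) {k : ℕ} {C : ℝ}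
    (hC : ∀ y, (1 + ‖y‖) ^ (k + 2) * ‖fderiv ℝ (fderiv ℝ φ) y‖ ≤ C) {t : ℝ}
    (ht : |t| * ‖X‖ ≤ 1 / 2) (x : E) :
    (1 + ‖x‖) ^ k * ‖φ (x + t • X x) - φ x - t • fderiv ℝ φ x (X x)‖ ≤
      2 ^ (k + 2) * C * ‖X‖ ^ 2 * |t| ^ 2 := by
  have hpos : 0 < (1 + ‖x‖) ^ k := by positivity
  have hC0 : 0 ≤ C := le_trans (by positivity) (hC 0)
  have key := Convex.norm_image_sub_le_of_norm_hasDerivWithin_le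
    (f := fun s : ℝ => φ (x + s • X x) - s • fderiv ℝ φ x (X x))
    (f' := fun s => fderiv ℝ φ (x + s • X x) (X x) - fderiv ℝ φ x (X x))
    (s := Set.Icc (-|t|) |t|) (x := 0) (y := t)
    (C := 2 ^ (k + 2) * C * ‖X‖ ^ 2 * |t| / (1 + ‖x‖) ^ k)
    (fun s _ => ((hasDerivAt_add_smul hφ x (X x) s).sub
      (by simpa using (hasDerivAt_id s).smul_const (fderiv ℝ φ x (X x)))).hasDerivWithinAt)
    (fun s hs => ?_) (convex_Icc _ _) (by simp) ⟨neg_abs_le t, le_abs_self t⟩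
  · simp only [zero_smul, add_zero, sub_zero, Real.norm_eq_abs] at key
    rw [mul_comm]
    rw [div_mul_eq_mul_div, le_div_iff₀ hpos] at key
    rw [sub_right_comm]
    refine key.trans_eq (by ring)
  · have hs0 : |s| ≤ |t| := abs_le.2 hs
    have hs' : |s| * ‖X‖ ≤ 1 / 2 := by
      refine le_trans ?_ ht
      gcongr
    have h1 := one_add_norm_pow_mul_norm_sub_le X hφ' hC hs' x
    rw [le_div_iff₀ hpos, ← _root_.sub_apply]
    calc ‖(fderiv ℝ φ (x + s • X x) - fderiv ℝ φ x) (X x)‖ * (1 + ‖x‖) ^ k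
        ≤ ‖fderiv ℝ φ (x + s • X x) - fderiv ℝ φ x‖ * (‖X‖ * (1 + ‖x‖)) * (1 + ‖x‖) ^ k := by
          gcongr
          refine (ContinuousLinearMap.le_opNorm _ _).trans ?_
          gcongr
          refine (X.le_opNorm x).trans ?_
          gcongr
          linarith
      _ = (1 + ‖x‖) ^ (k + 1) * ‖fderiv ℝ φ (x + s • X x) - fderiv ℝ φ x‖ * ‖X‖ := by ring
      _ ≤ 2 ^ (k + 1 + 1) * C * ‖X‖ * |s| * ‖X‖ := by gcongr
      _ ≤ 2 ^ (k + 1 + 1) * C * ‖X‖ * |t| * ‖X‖ := by gcongr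
      _ = _ := by ring

end Bounds

variable [FiniteDimensional ℝ E]

/-- Differentiation of a tempered distribution along a one-parameter family of linear changes of
variables. -/
theorem SchwartzMap.hasDerivAt_apply_comp_linear (T : 𝓢(E, ℂ) →L[ℂ] ℂ) (X : E →L[ℝ] E)
    {φ ψ : 𝓢(E, ℂ)} {Φ : ℝ → 𝓢(E, ℂ)} (hΦ : ∀ᶠ t in nhds 0, ∀ x, Φ t x = φ (x + t • X x))
    (hψ : ∀ x, ψ x = fderiv ℝ φ x (X x)) :
    HasDerivAt (fun t => T (Φ t)) (T ψ) 0 := by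
  let P := {t : ℝ // t ≠ 0 ∧ |t| * ‖X‖ ≤ 1 / 2 ∧ |t| ≤ 1}
  -- Moved functions with a power of t, difference quotients, and second order remainders divided by
  -- t². Together they are stable under differentiation: ∂_m takes `aR χ` to `aR (∂_m χ) + aD (∂_{X
  -- m} χ)`, `aD χ` to `aD (∂_m χ) + aA 0 (∂_{X m} χ)`, and `aA i χ` to `aA i (∂_m χ) + aA (i + 1)
  -- (∂_{X m} χ)`. So the remainders form a bounded set of Schwartz functions, on which `T` is
  -- bounded.
  let aA : ℕ → 𝓢(E, ℂ) → P → E → ℂ := fun i χ p x => ((p.1 ^ i : ℝ)) • χ (x + p.1 • X x)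
  let aD : 𝓢(E, ℂ) → P → E → ℂ := fun χ p x => (p.1⁻¹ : ℝ) • (χ (x + p.1 • X x) - χ x)
  let aR : 𝓢(E, ℂ) → P → E → ℂ := fun χ p x =>
    (p.1⁻¹ ^ 2 : ℝ) • (χ (x + p.1 • X x) - χ x - p.1 • fderiv ℝ χ x (X x))
  let S : Set (P → E → ℂ) := {g | (∃ i χ, g = aA i χ) ∨ (∃ χ, g = aD χ) ∨ ∃ χ, g = aR χ}
  have hA : ∀ i χ, aA i χ ∈ AddSubmonoid.closure S := fun i χ =>
    AddSubmonoid.subset_closure (Or.inl ⟨i, χ, rfl⟩)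
  have hD : ∀ χ, aD χ ∈ AddSubmonoid.closure S := fun χ =>
    AddSubmonoid.subset_closure (Or.inr (Or.inl ⟨χ, rfl⟩))
  have hR : ∀ χ, aR χ ∈ AddSubmonoid.closure S := fun χ =>
    AddSubmonoid.subset_closure (Or.inr (Or.inr ⟨χ, rfl⟩))
  have hcomp : ∀ (χ : 𝓢(E, ℂ)) (t : ℝ) (x : E), HasFDerivAt (fun x => χ (x + t • X x))
      ((fderiv ℝ χ (x + t • X x)).comp (ContinuousLinearMap.id ℝ E + t • X)) x := by
    intro χ t x
    exact (χ.hasFDerivAt (x + t • X x)).comp x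
      ((hasFDerivAt_id x).add ((X.hasFDerivAt).const_smul t))
  have hX : ∀ (χ : 𝓢(E, ℂ)) (x : E), HasFDerivAt (fun x => fderiv ℝ χ x (X x))
      ((fderiv ℝ χ x).comp X + (fderiv ℝ (fderiv ℝ χ) x).flip (X x)) x := by
    intro χ x
    exact (χ.differentiable_fderiv x).hasFDerivAt.clm_apply X.hasFDerivAt
  have hfA : ∀ i χ p x, HasFDerivAt (aA i χ p) ((p.1 ^ i : ℝ) •
      (fderiv ℝ χ (x + p.1 • X x)).comp (ContinuousLinearMap.id ℝ E + p.1 • X)) x :=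
    fun i χ p x => (hcomp χ p.1 x).const_smul (p.1 ^ i : ℝ)
  have hfD : ∀ χ p x, HasFDerivAt (aD χ p) ((p.1⁻¹ : ℝ) •
      ((fderiv ℝ χ (x + p.1 • X x)).comp (ContinuousLinearMap.id ℝ E + p.1 • X) -
        fderiv ℝ χ x)) x :=
    fun χ p x => ((hcomp χ p.1 x).sub (χ.hasFDerivAt x)).const_smul (p.1⁻¹ : ℝ)
  have hfR : ∀ χ p x, HasFDerivAt (aR χ p) ((p.1⁻¹ ^ 2 : ℝ) •
      ((fderiv ℝ χ (x + p.1 • X x)).comp (ContinuousLinearMap.id ℝ E + p.1 • X) -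
        fderiv ℝ χ x - p.1 • ((fderiv ℝ χ x).comp X + (fderiv ℝ (fderiv ℝ χ) x).flip (X x)))) x :=
    fun χ p x => (((hcomp χ p.1 x).sub (χ.hasFDerivAt x)).sub
      ((hX χ x).const_smul p.1)).const_smul (p.1⁻¹ ^ 2 : ℝ)
  obtain ⟨-, hmain⟩ := decay_of_closedFamily (S := S) (B := {b | ∃ C : ℝ, b = fun _ => C})
    (by rintro _ ⟨C, rfl⟩ _ ⟨C', rfl⟩; exact ⟨C + C', rfl⟩)
    (by rintro c _ _ ⟨C, rfl⟩; exact ⟨c * C, rfl⟩) ⟨_, 0, rfl⟩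
    (by
      rintro T (⟨i, χ, rfl⟩ | ⟨χ, rfl⟩ | ⟨χ, rfl⟩) p x
      · exact (hfA i χ p x).differentiableAt
      · exact (hfD χ p x).differentiableAt
      · exact (hfR χ p x).differentiableAt)
    (by
      rintro T (⟨i, χ, rfl⟩ | ⟨χ, rfl⟩ | ⟨χ, rfl⟩) m
      · convert add_mem (hA i (∂_{m} χ)) (hA (i + 1) (∂_{X m} χ)) using 1
        funext p x
        rw [(hfA i χ p x).fderiv]
        simp [aA, SchwartzMap.lineDerivOp_apply_eq_fderiv]
        ring
      · convert add_mem (hD (∂_{m} χ)) (hA 0 (∂_{X m} χ)) using 1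
        funext p x
        rw [(hfD χ p x).fderiv]
        have hp : (p.1 : ℂ) ≠ 0 := by exact_mod_cast p.2.1
        simp [aA, aD, SchwartzMap.lineDerivOp_apply_eq_fderiv]
        field_simp
        ring
      · convert add_mem (hR (∂_{m} χ)) (hD (∂_{X m} χ)) using 1
        funext p x
        rw [(hfR χ p x).fderiv]
        have hp : (p.1 : ℂ) ≠ 0 := by exact_mod_cast p.2.1
        simp only [aR, aD, Pi.add_apply, SchwartzMap.fderiv_lineDerivOp,
          χ.fderiv_fderiv_comm x (X x) m]
        simp [SchwartzMap.lineDerivOp_apply_eq_fderiv]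
        field_simp
        ring)
    (by
      rintro T (⟨i, χ, rfl⟩ | ⟨χ, rfl⟩ | ⟨χ, rfl⟩) k
      · obtain ⟨C, hC0, hC⟩ := χ.one_add_norm_pow_mul_norm_le k
        refine ⟨_, ⟨2 ^ k * C, rfl⟩, fun p x => ?_⟩
        refine le_trans ?_ (one_add_norm_pow_mul_norm_comp_le X hC p.2.2.1 x)
        simp only [aA, norm_smul, norm_pow, Real.norm_eq_abs]
        have h1 : |p.1| ^ i ≤ 1 := pow_le_one₀ (abs_nonneg _) p.2.2.2
        calc ‖x‖ ^ k * (|p.1| ^ i * ‖χ (x + p.1 • X x)‖)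
            ≤ (1 + ‖x‖) ^ k * (1 * ‖χ (x + p.1 • X x)‖) := by
              gcongr; linarith
          _ = _ := by ring
      · obtain ⟨C, hC0, hC⟩ := χ.one_add_norm_pow_mul_norm_fderiv_le (k + 1)
        refine ⟨_, ⟨2 ^ (k + 1) * C * ‖X‖, rfl⟩, fun p x => ?_⟩
        have := one_add_norm_pow_mul_norm_sub_le X χ.differentiable hC p.2.2.1 x
        have hp : 0 < |p.1| := abs_pos.2 p.2.1
        simp only [aD, norm_smul, norm_inv, Real.norm_eq_abs]
        rw [← div_le_iff₀ hp] at this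
        refine le_trans ?_ this
        rw [le_div_iff₀ hp]
        calc ‖x‖ ^ k * (|p.1|⁻¹ * ‖χ (x + p.1 • X x) - χ x‖) * |p.1|
            = ‖x‖ ^ k * ‖χ (x + p.1 • X x) - χ x‖ := by field_simp
          _ ≤ _ := by gcongr; linarith
      · obtain ⟨C, hC0, hC⟩ := χ.one_add_norm_pow_mul_norm_fderiv_fderiv_le (k + 2)
        refine ⟨_, ⟨2 ^ (k + 2) * C * ‖X‖ ^ 2, rfl⟩, fun p x => ?_⟩
        have := one_add_norm_pow_mul_norm_sub_sub_le X χ.differentiable χ.differentiable_fderiv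
          hC p.2.2.1 x
        have hp : 0 < |p.1| := abs_pos.2 p.2.1
        simp only [aR, norm_smul, norm_inv, norm_pow, Real.norm_eq_abs]
        rw [← div_le_iff₀ (by positivity)] at this
        refine le_trans ?_ this
        rw [le_div_iff₀ (by positivity)]
        calc ‖x‖ ^ k * (|p.1|⁻¹ ^ 2 * ‖χ (x + p.1 • X x) - χ x - p.1 • fderiv ℝ χ x (X x)‖) *
              |p.1| ^ 2
            = ‖x‖ ^ k * ‖χ (x + p.1 • X x) - χ x - p.1 • fderiv ℝ χ x (X x)‖ := by field_simp
          _ ≤ _ := by gcongr; linarith)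
    (aR φ) (hR φ)
  have hev : ∀ᶠ t in nhds (0 : ℝ), |t| * ‖X‖ ≤ 1 / 2 ∧ |t| ≤ 1 := by
    have h1 : Filter.Tendsto (fun t : ℝ => |t| * ‖X‖) (nhds 0) (nhds 0) := by
      have : Continuous (fun t : ℝ => |t| * ‖X‖) := by fun_prop
      simpa using this.tendsto 0
    have h2 : Filter.Tendsto (fun t : ℝ => |t|) (nhds 0) (nhds 0) := by
      simpa using continuous_abs.tendsto (0 : ℝ)
    exact (h1.eventually_le_const (by norm_num)).and (h2.eventually_le_const (by norm_num))
  let Q := {t : ℝ // t ≠ 0 ∧ (|t| * ‖X‖ ≤ 1 / 2 ∧ |t| ≤ 1) ∧ ∀ x, Φ t x = φ (x + t • X x)}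
  obtain ⟨C, hC⟩ := SchwartzMap.exists_norm_apply_le (P := Q) T
    (fun q => (((q.1⁻¹ ^ 2 : ℝ)) : ℂ) • (Φ q.1 - φ - (q.1 : ℂ) • ψ)) (by
      intro k n
      obtain ⟨_, ⟨C, rfl⟩, h⟩ := hmain k n
      refine ⟨C, fun q x => ?_⟩
      convert h ⟨q.1, q.2.1, q.2.2.1.1, q.2.2.1.2⟩ x using 4
      funext y
      simp [aR, q.2.2.2 y, hψ y])
  have h0 : Φ 0 = φ := by
    ext x
    simpa using hΦ.self_of_nhds x
  -- Boundedness of `T` on the remainders divided by t² says that the error of the linear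
  -- approximation is O(t²).
  rw [hasDerivAt_iff_isLittleO_nhds_zero]
  have hO : (fun t : ℝ => T (Φ (0 + t)) - T (Φ 0) - t • T ψ) =O[nhds 0] fun t : ℝ => t ^ 2 := by
    refine Asymptotics.IsBigO.of_bound C ?_
    filter_upwards [hev, hΦ] with t ht ht'
    rcases eq_or_ne t 0 with rfl | h
    · simp
    · have := hC ⟨t, h, ht, ht'⟩
      rw [map_smul, map_sub, map_sub, map_smul, norm_smul, Complex.norm_real, norm_pow, norm_inv,
        inv_pow, ← div_eq_inv_mul, div_le_iff₀ (by positivity)] at this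
      rw [zero_add, h0, norm_pow, Complex.real_smul]
      exact this
  exact hO.trans_isLittleO (by simpa using Asymptotics.isLittleO_pow_id (𝕜 := ℝ) one_lt_two)

end LinearFlow

/-! ### Scaling of some of the coordinates -/

noncomputable section Scaling

open scoped ContDiff LineDeriv
open MeasureTheory Set

variable {ι K : Type*} [Fintype ι] [DecidableEq ι] [RCLike K]

/-- The map that multiplies the coordinates in `J` by `c` and kills the others. -/
def partOn (J : Finset ι) (c : K) : (ι → K) →L[ℝ] (ι → K) :=
  LinearMap.toContinuousLinearMap
    { toFun := fun x k => if k ∈ J then c * x k else 0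
      map_add' := fun x y => by ext k; by_cases h : k ∈ J <;> simp [h, mul_add]
      map_smul' := fun r x => by ext k; by_cases h : k ∈ J <;> simp [h] }

theorem partOn_apply (J : Finset ι) (c : K) (x : ι → K) (k : ι) :
    partOn J c x k = if k ∈ J then c * x k else 0 := rfl

/-- The map that multiplies the coordinates in `J` by `c` and fixes the others. -/
def scaleOn (J : Finset ι) (c : K) : (ι → K) →L[ℝ] (ι → K) :=
  partOn Jᶜ 1 + (RCLike.re c • partOn J 1 + RCLike.im c • partOn J RCLike.I)

theorem scaleOn_apply (J : Finset ι) (c : K) (x : ι → K) (k : ι) :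
    scaleOn J c x k = if k ∈ J then c * x k else x k := by
  by_cases h : k ∈ J
  · simp only [scaleOn, _root_.add_apply, _root_.smul_apply, Pi.add_apply, Pi.smul_apply,
      partOn_apply, h, if_true, Finset.mem_compl, not_true, if_false, zero_add, one_mul]
    conv_rhs => rw [← RCLike.re_add_im c]
    rw [add_mul, RCLike.real_smul_eq_coe_mul, RCLike.real_smul_eq_coe_mul, mul_assoc]
  · simp [scaleOn, partOn_apply, h]

theorem continuous_scaleOn (J : Finset ι) : Continuous (scaleOn (K := K) J) := by
  unfold scaleOn
  fun_prop

theorem norm_scaleOn_le (J : Finset ι) (c : K) : ‖scaleOn J c‖ ≤ 1 + ‖c‖ := by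
  refine ContinuousLinearMap.opNorm_le_bound _ (by positivity) fun x => ?_
  refine (pi_norm_le_iff_of_nonneg (by positivity)).2 fun k => ?_
  rw [scaleOn_apply]
  have hx := norm_le_pi_norm x k
  split_ifs
  · rw [norm_mul]
    nlinarith [norm_nonneg c, norm_nonneg (x k)]
  · nlinarith [norm_nonneg c, norm_nonneg x]

theorem scaleOn_one (J : Finset ι) (x : ι → K) : scaleOn J 1 x = x := by
  ext k; simp [scaleOn_apply]

theorem scaleOn_scaleOn (J : Finset ι) (c d : K) (x : ι → K) :
    scaleOn J c (scaleOn J d x) = scaleOn J (c * d) x := by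
  ext k
  simp only [scaleOn_apply]
  split_ifs <;> ring

theorem norm_scaleOn_of_norm_eq_one (J : Finset ι) {c : K} (hc : ‖c‖ = 1) (x : ι → K) :
    ‖scaleOn J c x‖ = ‖x‖ := by
  have : ∀ k, ‖scaleOn J c x k‖ = ‖x k‖ := fun k => by
    rw [scaleOn_apply]; split_ifs <;> simp [hc]
  simp only [Pi.norm_def]
  congr 1
  refine Finset.sup_congr rfl fun k _ => ?_
  exact NNReal.eq (this k)

theorem norm_partOn_one_le (J : Finset ι) (x : ι → K) : ‖partOn J (1 : K) x‖ ≤ ‖x‖ := by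
  refine (pi_norm_le_iff_of_nonneg (norm_nonneg _)).2 fun k => ?_
  rw [partOn_apply]
  split_ifs
  · simpa using norm_le_pi_norm x k
  · simp

theorem norm_mul_norm_partOn_le (J : Finset ι) (c : K) (x : ι → K) :
    ‖c‖ * ‖partOn J (1 : K) x‖ ≤ ‖scaleOn J c x‖ := by
  rw [← norm_smul]
  refine (pi_norm_le_iff_of_nonneg (norm_nonneg _)).2 fun k => ?_
  have := norm_le_pi_norm (scaleOn J c x) k
  rw [scaleOn_apply] at this
  simp only [Pi.smul_apply, partOn_apply]
  split_ifs with h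
  · simpa [h] using this
  · simp

/-- Contracting the coordinates in `J` loses at most `R` of the norm on the slab where these
coordinates are bounded by `R`, so decay survives there. -/
theorem norm_le_of_norm_partOn_le (J : Finset ι) (c : K) {R : ℝ} (hR : 0 ≤ R) {x : ι → K}
    (hx : ∀ k ∈ J, ‖x k‖ ≤ R) : ‖x‖ ≤ R + ‖scaleOn J c x‖ := by
  refine (pi_norm_le_iff_of_nonneg (by positivity)).2 fun k => ?_
  by_cases h : k ∈ J
  · exact (hx k h).trans (le_add_of_nonneg_right (norm_nonneg _))
  · have := norm_le_pi_norm (scaleOn J c x) k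
    rw [scaleOn_apply, if_neg h] at this
    linarith

/-- Differentiation under the integral sign, for the integral of a Schwartz function along a
path of scalings. -/
theorem hasFDerivAt_integral_scaleOn (J : Finset ι) {μ : Measure ℝ} {k : ℝ → ℝ} {c : ℝ → K}
    (hk : Continuous k) (hc : Continuous c) (φ : 𝓢(ι → K, ℂ)) (x₀ : ι → K) {bound : ℝ → ℝ}
    (hb : Integrable bound μ) (hint : Integrable (fun s => k s • φ (scaleOn J (c s) x₀)) μ)
    {U : Set (ι → K)} (hU : U ∈ nhds x₀)
    (h : ∀ᵐ s ∂μ, ∀ y ∈ U, |k s| * (1 + ‖c s‖) * ‖fderiv ℝ φ (scaleOn J (c s) y)‖ ≤ bound s) :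
    (Integrable (fun s => k s • (fderiv ℝ φ (scaleOn J (c s) x₀)).comp (scaleOn J (c s))) μ) ∧
    HasFDerivAt (fun x => ∫ s, k s • φ (scaleOn J (c s) x) ∂μ)
      (∫ s, k s • (fderiv ℝ φ (scaleOn J (c s) x₀)).comp (scaleOn J (c s)) ∂μ) x₀ := by
  have hsc : Continuous fun s => scaleOn J (c s) := (continuous_scaleOn J).comp hc
  have hsx : ∀ x, Continuous fun s => scaleOn J (c s) x := fun x => hsc.clm_apply continuous_const
  have hF' : Continuous fun s => k s • (fderiv ℝ φ (scaleOn J (c s) x₀)).comp (scaleOn J (c s)) :=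
    hk.smul ((φ.differentiable_fderiv.continuous.comp (hsx x₀)).clm_comp hsc)
  have hle : ∀ᵐ s ∂μ, ∀ y ∈ U,
      ‖k s • (fderiv ℝ φ (scaleOn J (c s) y)).comp (scaleOn J (c s))‖ ≤ bound s := by
    filter_upwards [h] with s hs y hy
    refine le_trans ?_ (hs y hy)
    rw [norm_smul, Real.norm_eq_abs]
    calc |k s| * ‖(fderiv ℝ φ (scaleOn J (c s) y)).comp (scaleOn J (c s))‖
        ≤ |k s| * (‖fderiv ℝ φ (scaleOn J (c s) y)‖ * (1 + ‖c s‖)) := by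
          gcongr
          refine (ContinuousLinearMap.opNorm_comp_le _ _).trans ?_
          gcongr
          exact norm_scaleOn_le J (c s)
      _ = _ := by ring
  constructor
  · have := Integrable.mono' (f := fun s => k s • (fderiv ℝ φ (scaleOn J (c s) x₀)).comp
      (scaleOn J (c s))) hb hF'.aestronglyMeasurable ?_
    · exact this
    filter_upwards [hle] with s hs using hs x₀ (mem_of_mem_nhds hU)
  · refine hasFDerivAt_integral_of_dominated_of_fderiv_le (bound := bound)
      (F := fun x s => k s • φ (scaleOn J (c s) x))
      (F' := fun x s => k s • (fderiv ℝ φ (scaleOn J (c s) x)).comp (scaleOn J (c s))) hU ?_ hint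
      hF'.aestronglyMeasurable hle hb ?_
    · exact Filter.Eventually.of_forall fun x =>
        (hk.smul (φ.continuous.comp (hsx x))).aestronglyMeasurable
    · refine Filter.Eventually.of_forall fun s x _ => ?_
      exact ((φ.hasFDerivAt _).comp x (scaleOn J (c s)).hasFDerivAt).const_smul (k s)

/-- The integral of a Schwartz function along a compact path of scalings. -/
def integralScale (J : Finset ι) (b : ℝ) (k : ℝ → ℝ) (c : ℝ → K) (φ : 𝓢(ι → K, ℂ)) (x : ι → K) : ℂ :=
  ∫ s in Ioc 0 b, k s • φ (scaleOn J (c s) x)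

theorem hasFDerivAt_integralScale (J : Finset ι) (b : ℝ) {k : ℝ → ℝ} {c : ℝ → K}
    (hk : Continuous k) (hc : Continuous c) (φ : 𝓢(ι → K, ℂ)) (x : ι → K) :
    (Integrable (fun s => k s • (fderiv ℝ φ (scaleOn J (c s) x)).comp (scaleOn J (c s)))
      (volume.restrict (Ioc 0 b))) ∧
    HasFDerivAt (integralScale J b k c φ)
      (∫ s in Ioc 0 b, k s • (fderiv ℝ φ (scaleOn J (c s) x)).comp (scaleOn J (c s))) x := by
  have hsx : Continuous fun s => scaleOn J (c s) x :=
    ((continuous_scaleOn J).comp hc).clm_apply continuous_const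
  obtain ⟨C, hC0, hC⟩ := φ.one_add_norm_pow_mul_norm_fderiv_le 0
  simp only [pow_zero, one_mul] at hC
  have hint : ∀ {F : Type _} [NormedAddCommGroup F] {g : ℝ → F}, Continuous g →
      Integrable g (volume.restrict (Ioc 0 b)) := fun hg =>
    (hg.continuousOn.integrableOn_Icc).mono_set Ioc_subset_Icc_self
  refine hasFDerivAt_integral_scaleOn J hk hc φ x (U := univ)
    (bound := fun s => |k s| * (1 + ‖c s‖) * C) (hint (by fun_prop))
    (hint (hk.smul (φ.continuous.comp hsx))) Filter.univ_mem ?_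
  exact Filter.Eventually.of_forall fun s y _ => by gcongr; exact hC _

/-- The scaling is affine in the real numbers re c and im c, so only three fixed line derivatives
occur, with scalar coefficients depending on c. -/
theorem fderiv_comp_scaleOn_apply (J : Finset ι) (φ : 𝓢(ι → K, ℂ)) (c : K) (x m : ι → K) :
    fderiv ℝ φ x (scaleOn J c m) = (∂_{partOn Jᶜ 1 m} φ) x +
      (RCLike.re c • (∂_{partOn J 1 m} φ) x + RCLike.im c • (∂_{partOn J RCLike.I m} φ) x) := by
  simp [scaleOn, SchwartzMap.lineDerivOp_apply_eq_fderiv]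

/-- Differentiation replaces φ by line derivatives of φ and multiplies the weight by 1, re c or im
c: integrals along a fixed path form a family to which the closed family criterion applies. -/
theorem fderiv_integralScale_apply (J : Finset ι) (b : ℝ) {k : ℝ → ℝ} {c : ℝ → K}
    (hk : Continuous k) (hc : Continuous c) (φ : 𝓢(ι → K, ℂ)) (x m : ι → K) :
    fderiv ℝ (integralScale J b k c φ) x m =
      integralScale J b k c (∂_{partOn Jᶜ 1 m} φ) x +
      (integralScale J b (fun s => k s * RCLike.re (c s)) c (∂_{partOn J 1 m} φ) x +
        integralScale J b (fun s => k s * RCLike.im (c s)) c (∂_{partOn J RCLike.I m} φ) x) := by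
  obtain ⟨h1, h2⟩ := hasFDerivAt_integralScale J b hk hc φ x
  rw [h2.fderiv, ContinuousLinearMap.integral_apply h1]
  have hsx : Continuous fun s => scaleOn J (c s) x :=
    ((continuous_scaleOn J).comp hc).clm_apply continuous_const
  have hint : ∀ {g : ℝ → ℂ}, Continuous g →
      Integrable g (volume.restrict (Ioc 0 b)) := fun hg =>
    (hg.continuousOn.integrableOn_Icc).mono_set Ioc_subset_Icc_self
  have hcont : ∀ (χ : 𝓢(ι → K, ℂ)) {k : ℝ → ℝ}, Continuous k →
      Continuous fun s => k s • χ (scaleOn J (c s) x) :=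
    fun χ k hk => hk.smul (χ.continuous.comp hsx)
  have hre : Continuous fun s => k s * RCLike.re (c s) := hk.mul (RCLike.continuous_re.comp hc)
  have him : Continuous fun s => k s * RCLike.im (c s) := hk.mul (RCLike.continuous_im.comp hc)
  unfold integralScale
  rw [← integral_add (hint (hcont _ hre)) (hint (hcont _ him)),
    ← integral_add (hint (hcont _ hk)) (hint (g := fun s => _ + _) ((hcont _ hre).add (hcont _ him)))]
  refine integral_congr_ae (Filter.Eventually.of_forall fun s => ?_)
  simp only [_root_.smul_apply, ContinuousLinearMap.comp_apply, fderiv_comp_scaleOn_apply,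
    smul_add, smul_smul]

theorem differentiable_integralScale (J : Finset ι) (b : ℝ) {k : ℝ → ℝ} {c : ℝ → K}
    (hk : Continuous k) (hc : Continuous c) (φ : 𝓢(ι → K, ℂ)) :
    Differentiable ℝ (integralScale J b k c φ) := fun x =>
  (hasFDerivAt_integralScale J b hk hc φ x).2.differentiableAt

theorem norm_integralScale_le (J : Finset ι) {b : ℝ} (k : ℝ → ℝ) (c : ℝ → K) (φ : 𝓢(ι → K, ℂ))
    (hb : 0 ≤ b) (x : ι → K) {C : ℝ} (hC : ∀ s ∈ Ioc 0 b, ‖k s • φ (scaleOn J (c s) x)‖ ≤ C) :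
    ‖integralScale J b k c φ x‖ ≤ C * b := by
  have := norm_setIntegral_le_of_norm_le_const (μ := volume) (s := Ioc 0 b)
    (by simp) hC
  simpa [integralScale, hb] using this

end Scaling

/-! ### Primitives of Schwartz functions along scalings -/

noncomputable section Primitives

open scoped ContDiff LineDeriv
open MeasureTheory Set

variable {ι K : Type*} [Fintype ι] [DecidableEq ι] [RCLike K]

/-- The integral of a Schwartz function along a compact path of isometric scalings is a Schwartz
function. -/
theorem exists_schwartzMap_integralScale_of_norm_eq_one (J : Finset ι) {b : ℝ} (hb : 0 ≤ b)
    {k : ℝ → ℝ} {c : ℝ → K} (hk : Continuous k) (hc : Continuous c) (hc1 : ∀ s, ‖c s‖ = 1)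
    (φ : 𝓢(ι → K, ℂ)) : ∃ ψ : 𝓢(ι → K, ℂ), ∀ x, ψ x = integralScale J b k c φ x := by
  refine exists_schwartzMap_of_closedFamily
    (S := {g | ∃ (k : ℝ → ℝ) (φ : 𝓢(ι → K, ℂ)), Continuous k ∧ g = integralScale J b k c φ})
    ?_ ?_ ?_ _ ⟨k, φ, hk, rfl⟩
  · rintro _ ⟨k, φ, hk, rfl⟩
    exact differentiable_integralScale J b hk hc φ
  · rintro _ ⟨k, φ, hk, rfl⟩ m
    rw [funext fun x => fderiv_integralScale_apply J b hk hc φ x m]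
    refine add_mem (AddSubmonoid.subset_closure ⟨_, _, hk, rfl⟩)
      (add_mem (AddSubmonoid.subset_closure ⟨_, _, ?_, rfl⟩)
        (AddSubmonoid.subset_closure ⟨_, _, ?_, rfl⟩))
    · exact hk.mul (RCLike.continuous_re.comp hc)
    · exact hk.mul (RCLike.continuous_im.comp hc)
  · rintro _ ⟨k, φ, hk, rfl⟩ n
    obtain ⟨C, hC0, hC⟩ := φ.one_add_norm_pow_mul_norm_le n
    obtain ⟨D, hD⟩ := isCompact_Icc.exists_bound_of_continuousOn (s := Icc 0 b) hk.continuousOn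
    refine ⟨D * C * b, fun x => ?_⟩
    have hpos : 0 < (1 + ‖x‖) ^ n := by positivity
    have hD0 : 0 ≤ D := (norm_nonneg _).trans (hD 0 ⟨le_rfl, hb⟩)
    have key := norm_integralScale_le J k c φ hb x (C := D * C / (1 + ‖x‖) ^ n) (fun s hs => by
      rw [norm_smul, le_div_iff₀ hpos]
      have h1 := hC (scaleOn J (c s) x)
      rw [norm_scaleOn_of_norm_eq_one J (hc1 s)] at h1
      calc ‖k s‖ * ‖φ (scaleOn J (c s) x)‖ * (1 + ‖x‖) ^ n
          = ‖k s‖ * ((1 + ‖x‖) ^ n * ‖φ (scaleOn J (c s) x)‖) := by ring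
        _ ≤ D * C := by
          gcongr
          exact hD s (Ioc_subset_Icc_self hs))
    rw [div_mul_eq_mul_div, le_div_iff₀ hpos, mul_comm] at key
    refine le_trans ?_ key
    gcongr
    linarith

theorem fderiv_integralScale_eq_integral (J : Finset ι) (b : ℝ) {k : ℝ → ℝ} {c : ℝ → K}
    (hk : Continuous k) (hc : Continuous c) (φ : 𝓢(ι → K, ℂ)) (x m : ι → K) :
    fderiv ℝ (integralScale J b k c φ) x m =
      ∫ s in Ioc 0 b, k s • fderiv ℝ φ (scaleOn J (c s) x) (scaleOn J (c s) m) := by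
  obtain ⟨h1, h2⟩ := hasFDerivAt_integralScale J b hk hc φ x
  rw [h2.fderiv, ContinuousLinearMap.integral_apply h1]
  rfl

theorem hasDerivAt_scaleOn (J : Finset ι) {c : ℝ → K} {c' : K} {s : ℝ} (hc : HasDerivAt c c' s)
    (x : ι → K) : HasDerivAt (fun s => scaleOn J (c s) x) (partOn J c' x) s := by
  rw [hasDerivAt_pi]
  intro k
  simp only [scaleOn_apply, partOn_apply]
  split_ifs
  · exact hc.mul_const _
  · exact hasDerivAt_const _ _

theorem SchwartzMap.hasDerivAt_comp_scaleOn (φ : 𝓢(ι → K, ℂ)) (J : Finset ι) {c : ℝ → K} {c' : K}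
    {s : ℝ} (hc : HasDerivAt c c' s) (x : ι → K) :
    HasDerivAt (fun s => φ (scaleOn J (c s) x)) (fderiv ℝ φ (scaleOn J (c s) x) (partOn J c' x)) s :=
  (φ.hasFDerivAt _).comp_hasDerivAt s (hasDerivAt_scaleOn J hc x)

theorem scaleOn_partOn (J : Finset ι) (c d : K) (x : ι → K) :
    scaleOn J c (partOn J d x) = partOn J (c * d) x := by
  ext k
  simp only [scaleOn_apply, partOn_apply]
  split_ifs <;> ring

theorem continuous_fderiv_scaleOn_partOn (J : Finset ι) (φ : 𝓢(ι → K, ℂ)) {c d : ℝ → K}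
    (hc : Continuous c) (hd : Continuous d) (x : ι → K) :
    Continuous fun s => fderiv ℝ φ (scaleOn J (c s) x) (partOn J (d s) x) := by
  have hsx : Continuous fun s => scaleOn J (c s) x :=
    ((continuous_scaleOn J).comp hc).clm_apply continuous_const
  refine (φ.differentiable_fderiv.continuous.comp hsx).clm_apply ?_
  refine continuous_pi fun k => ?_
  simp only [partOn_apply]
  split_ifs <;> fun_prop

/-- Integration by parts for the infinitesimal rotation of a primitive along a loop. -/
theorem fderiv_integralScale_loop (J : Finset ι) {b : ℝ} (hb : 0 ≤ b) {c : ℝ → K} {w : K}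
    (hc : ∀ s, HasDerivAt c (c s * w) s) (hcb : c b = 1) (φ : 𝓢(ι → K, ℂ)) (x : ι → K) :
    fderiv ℝ (integralScale J b id c φ) x (partOn J w x) =
      b • φ x - ∫ s in Ioc 0 b, φ (scaleOn J (c s) x) := by
  have hcc : Continuous c := continuous_iff_continuousAt.2 fun s => (hc s).continuousAt
  have hsx : Continuous fun s => scaleOn J (c s) x :=
    ((continuous_scaleOn J).comp hcc).clm_apply continuous_const
  have hφ : Continuous fun s => φ (scaleOn J (c s) x) := φ.continuous.comp hsx
  have h1 : Continuous fun s : ℝ => s • fderiv ℝ φ (scaleOn J (c s) x) (partOn J (c s * w) x) :=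
    continuous_id.smul (continuous_fderiv_scaleOn_partOn J φ hcc (hcc.mul continuous_const) x)
  rw [fderiv_integralScale_eq_integral J b continuous_id hcc]
  simp only [scaleOn_partOn, id]
  rw [← intervalIntegral.integral_of_le hb, ← intervalIntegral.integral_of_le hb]
  -- The derivative of s φ(c(s) x) is integrated. The weight s removes the boundary term at 0, and
  -- c(b) = 1 makes the one at b equal to b φ(x).
  have := intervalIntegral.integral_eq_sub_of_hasDerivAt (a := 0) (b := b)
    (f := fun s : ℝ => s • φ (scaleOn J (c s) x))
    (f' := fun s : ℝ => s • fderiv ℝ φ (scaleOn J (c s) x) (partOn J (c s * w) x) +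
      (1 : ℝ) • φ (scaleOn J (c s) x))
    (fun s _ => (hasDerivAt_id s).smul (φ.hasDerivAt_comp_scaleOn J (hc s) x))
    ((h1.add (hφ.const_smul (1 : ℝ))).intervalIntegrable _ _)
  simp only [one_smul, zero_smul, sub_zero, hcb, scaleOn_one] at this
  rw [intervalIntegral.integral_add (h1.intervalIntegrable _ _) (hφ.intervalIntegrable _ _)] at this
  rw [← this, add_sub_cancel_right]

/-- Euler's identity for the radial primitive. -/
theorem fderiv_integralScale_radial (J : Finset ι) (j : ℕ) (φ : 𝓢(ι → K, ℂ)) (x : ι → K) :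
    fderiv ℝ (integralScale J 1 (fun s => s ^ j) (fun s => (s : K)) φ) x (partOn J 1 x) +
      ((j + 1 : ℕ) : ℝ) • integralScale J 1 (fun s => s ^ j) (fun s => (s : K)) φ x = φ x := by
  have hcc : Continuous fun s : ℝ => (s : K) := RCLike.continuous_ofReal
  have hc : ∀ s : ℝ, HasDerivAt (fun s : ℝ => (s : K)) 1 s := fun s => by
    simpa using (RCLike.ofRealCLM (K := K)).hasDerivAt (x := s)
  have hsx : Continuous fun s : ℝ => scaleOn J (s : K) x :=
    ((continuous_scaleOn J).comp hcc).clm_apply continuous_const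
  have hφ : Continuous fun s : ℝ => φ (scaleOn J (s : K) x) := φ.continuous.comp hsx
  have hp : Continuous fun s : ℝ => s ^ j := by fun_prop
  have h1 : Continuous fun s : ℝ => s ^ (j + 1) • fderiv ℝ φ (scaleOn J (s : K) x) (partOn J 1 x) :=
    (continuous_pow (j + 1)).smul
      (continuous_fderiv_scaleOn_partOn J φ hcc (continuous_const (y := (1 : K))) x)
  have h2 : Continuous fun s : ℝ => (((j + 1 : ℕ) : ℝ) * s ^ j) • φ (scaleOn J (s : K) x) :=
    (continuous_const.mul hp).smul hφ
  have hpart : ∀ s : ℝ, partOn J ((s : K) * 1) x = s • partOn J 1 x := by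
    intro s
    ext k
    simp only [partOn_apply, Pi.smul_apply]
    split_ifs <;> simp [RCLike.real_smul_eq_coe_mul]
  rw [fderiv_integralScale_eq_integral J 1 hp hcc]
  simp only [scaleOn_partOn, hpart, map_smul, smul_smul, ← pow_succ]
  unfold integralScale
  rw [← intervalIntegral.integral_of_le zero_le_one, ← intervalIntegral.integral_of_le zero_le_one,
    ← intervalIntegral.integral_smul]
  simp only [smul_smul]
  rw [← intervalIntegral.integral_add (h1.intervalIntegrable _ _) (h2.intervalIntegrable _ _)]
  -- Fundamental theorem of calculus for s^(j+1) φ(s x), where s scales only the coordinates in `J`.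
  have := intervalIntegral.integral_eq_sub_of_hasDerivAt (a := 0) (b := 1)
    (f := fun s : ℝ => s ^ (j + 1) • φ (scaleOn J (s : K) x))
    (f' := fun s : ℝ => s ^ (j + 1) • fderiv ℝ φ (scaleOn J (s : K) x) (partOn J 1 x) +
      (((j + 1 : ℕ) : ℝ) * s ^ j) • φ (scaleOn J (s : K) x))
    (fun s _ => by
      simpa using (hasDerivAt_pow (j + 1) s).fun_smul (φ.hasDerivAt_comp_scaleOn J (hc s) x))
    ((h1.add h2).intervalIntegrable _ _)
  rw [this]
  simp [scaleOn_one]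

/-- The radial moment of order `j` of a function along the half-lines in the coordinates of `J`. -/
def radialMoment (J : Finset ι) (j : ℕ) (φ : 𝓢(ι → K, ℂ)) (x : ι → K) : ℂ :=
  ∫ s in Ioi 0, s ^ j • φ (scaleOn J ((s : ℝ) : K) x)

theorem one_add_le_one_add_norm_scaleOn (J : Finset ι) {s η : ℝ} (hs : 0 ≤ s) (x : ι → K)
    (hx : η ≤ ‖partOn J (1 : K) x‖) : min 1 η * (1 + s) ≤ 1 + ‖scaleOn J (s : K) x‖ := by
  have h := norm_mul_norm_partOn_le J (s : K) x
  rw [RCLike.norm_ofReal, abs_of_nonneg hs] at h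
  have h1 : min 1 η ≤ 1 := min_le_left _ _
  have h2 : min 1 η ≤ η := min_le_right _ _
  nlinarith [mul_le_mul_of_nonneg_left (h2.trans hx) hs]

/-- Two spare powers of decay buy the integrable majorant (1 + s²)⁻¹ along a ray. -/
theorem pow_mul_le_of_decay {j : ℕ} {C D m s t : ℝ} (hm : 0 < m) (hs : 0 ≤ s) (hD : 0 ≤ D)
    (ht : m * (1 + s) ≤ 1 + t) (h : (1 + t) ^ (j + 2) * D ≤ C) :
    (1 + s) ^ j * D ≤ C / m ^ (j + 2) * (1 + s ^ 2)⁻¹ := by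
  have h1 : (m * (1 + s)) ^ (j + 2) * D ≤ C := le_trans (by gcongr) h
  rw [div_mul_eq_mul_div, le_div_iff₀ (by positivity), ← div_eq_mul_inv, le_div_iff₀ (by positivity)]
  calc (1 + s) ^ j * D * m ^ (j + 2) * (1 + s ^ 2)
      ≤ (1 + s) ^ j * D * m ^ (j + 2) * (1 + s) ^ 2 := by gcongr; nlinarith
    _ = (m * (1 + s)) ^ (j + 2) * D := by rw [mul_pow]; ring
    _ ≤ C := h1

theorem integrableOn_radialMoment (J : Finset ι) (j : ℕ) (φ : 𝓢(ι → K, ℂ)) {x : ι → K}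
    (hx : partOn J (1 : K) x ≠ 0) :
    IntegrableOn (fun s : ℝ => s ^ j • φ (scaleOn J (s : K) x)) (Ioi 0) := by
  have hcc : Continuous fun s : ℝ => (s : K) := RCLike.continuous_ofReal
  have hsx : Continuous fun s : ℝ => scaleOn J (s : K) x :=
    ((continuous_scaleOn J).comp hcc).clm_apply continuous_const
  obtain ⟨C, hC0, hC⟩ := φ.one_add_norm_pow_mul_norm_le (j + 2)
  have hm : 0 < min 1 ‖partOn J (1 : K) x‖ := lt_min one_pos (norm_pos_iff.2 hx)
  refine Integrable.mono' ((integrable_inv_one_add_sq.const_mul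
    (C / min 1 ‖partOn J (1 : K) x‖ ^ (j + 2))).restrict) 
    ((continuous_pow j).smul (φ.continuous.comp hsx)).aestronglyMeasurable ?_
  filter_upwards [ae_restrict_mem measurableSet_Ioi] with s hs
  have hs0 : 0 ≤ s := le_of_lt hs
  refine le_trans ?_ (pow_mul_le_of_decay hm hs0 (norm_nonneg (φ (scaleOn J (s : K) x)))
    (one_add_le_one_add_norm_scaleOn J hs0 x le_rfl) (hC _))
  rw [norm_smul, norm_pow, Real.norm_eq_abs, abs_of_nonneg hs0]
  gcongr
  linarith

/-- The identity "moment = 0" holds on an open set and may be differentiated under the integral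
there. Directions in `J` meet the factor s and raise the order of the moment by one. -/
theorem radialMoment_lineDeriv (J : Finset ι) (j : ℕ) (φ : 𝓢(ι → K, ℂ))
    (h : ∀ x, partOn J (1 : K) x ≠ 0 → radialMoment J j φ x = 0) {x : ι → K}
    (hx : partOn J (1 : K) x ≠ 0) (m : ι → K) :
    radialMoment J j (∂_{partOn Jᶜ 1 m} φ) x + radialMoment J (j + 1) (∂_{partOn J 1 m} φ) x = 0 := by
  have hcc : Continuous fun s : ℝ => (s : K) := RCLike.continuous_ofReal
  obtain ⟨C, hC0, hC⟩ := φ.one_add_norm_pow_mul_norm_fderiv_le (j + 1 + 2)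
  set η := ‖partOn J (1 : K) x‖ / 2 with hη
  have hη0 : 0 < η := half_pos (norm_pos_iff.2 hx)
  have hm : 0 < min 1 η := lt_min one_pos hη0
  have hopen : IsOpen {y : ι → K | η < ‖partOn J (1 : K) y‖} :=
    isOpen_lt continuous_const (partOn J (1 : K)).continuous.norm
  have hU : {y : ι → K | η < ‖partOn J (1 : K) y‖} ∈ nhds x :=
    hopen.mem_nhds (by simpa [hη] using hx)
  obtain ⟨h1, h2⟩ := hasFDerivAt_integral_scaleOn J (μ := volume.restrict (Ioi 0)) (k := fun s => s ^ j)
    (c := fun s => (s : K)) (by fun_prop) hcc φ x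
    (bound := fun s => C / min 1 η ^ (j + 1 + 2) * (1 + s ^ 2)⁻¹)
    (integrable_inv_one_add_sq.const_mul _).restrict (integrableOn_radialMoment J j φ hx) hU (by
      filter_upwards [ae_restrict_mem measurableSet_Ioi] with s hs y hy
      have hs0 : 0 ≤ s := le_of_lt hs
      refine le_trans ?_ (pow_mul_le_of_decay hm hs0 (norm_nonneg (fderiv ℝ φ (scaleOn J (s : K) y)))
        (one_add_le_one_add_norm_scaleOn J hs0 y (le_of_lt hy)) (hC _))
      rw [RCLike.norm_ofReal, abs_of_nonneg hs0, abs_of_nonneg (pow_nonneg hs0 j), pow_succ]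
      gcongr
      linarith)
  have h3 : HasFDerivAt (fun x => ∫ s in Ioi (0 : ℝ), s ^ j • φ (scaleOn J (s : K) x))
      (0 : (ι → K) →L[ℝ] ℂ) x := by
    refine (hasFDerivAt_const (0 : ℂ) x).congr_of_eventuallyEq ?_
    filter_upwards [hU] with y hy
    exact h y (norm_pos_iff.1 (hη0.trans hy))
  have h4 := congrArg (fun L => L m) (h2.unique h3)
  simp only [ContinuousLinearMap.integral_apply h1] at h4
  unfold radialMoment
  rw [← integral_add (integrableOn_radialMoment J j _ hx) (integrableOn_radialMoment J (j + 1) _ hx)]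
  refine Eq.trans (integral_congr_ae (Filter.Eventually.of_forall fun s => ?_)) h4
  simp only [_root_.smul_apply, ContinuousLinearMap.comp_apply, fderiv_comp_scaleOn_apply,
    RCLike.ofReal_re, RCLike.ofReal_im, zero_smul, add_zero, smul_add, smul_smul, pow_succ]

theorem partOn_partOn (J J' : Finset ι) (c d : K) (x : ι → K) :
    partOn J c (partOn J' d x) = partOn (J ∩ J') (c * d) x := by
  ext k
  simp only [partOn_apply, Finset.mem_inter]
  by_cases h : k ∈ J <;> by_cases h' : k ∈ J' <;> simp [h, h', mul_assoc]

theorem partOn_empty (c : K) (x : ι → K) : partOn ∅ c x = 0 := by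
  ext k; simp [partOn_apply]

theorem radialMoment_zero (J : Finset ι) (j : ℕ) (x : ι → K) : radialMoment J j 0 x = 0 := by
  simp [radialMoment]

theorem norm_le_norm_scaleOn (J : Finset ι) {s : ℝ} (hs : 1 ≤ s) (x : ι → K) :
    ‖x‖ ≤ ‖scaleOn J (s : K) x‖ := by
  refine (pi_norm_le_iff_of_nonneg (norm_nonneg _)).2 fun k => ?_
  refine le_trans ?_ (norm_le_pi_norm _ k)
  rw [scaleOn_apply]
  split_ifs
  · rw [norm_mul, RCLike.norm_ofReal, abs_of_nonneg (by linarith)]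
    exact le_mul_of_one_le_left (norm_nonneg _) hs
  · exact le_rfl

/-- If the radial moments of order `j` of a Schwartz function vanish, then its radial primitive is
a Schwartz function. -/
theorem exists_schwartzMap_radial (J : Finset ι) (j : ℕ) (φ : 𝓢(ι → K, ℂ))
    (h : ∀ x, partOn J (1 : K) x ≠ 0 → radialMoment J j φ x = 0) :
    ∃ ψ : 𝓢(ι → K, ℂ),
      ∀ x, ψ x = integralScale J 1 (fun s => s ^ j) (fun s => ((s : ℝ) : K)) φ x := by
  have hcc : Continuous fun s : ℝ => (s : K) := RCLike.continuous_ofReal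
  -- The vanishing of the moment is part of the family. All orders j occur together because
  -- differentiation along `J` raises j by one.
  refine exists_schwartzMap_of_closedFamily
    (S := {g | ∃ (j : ℕ) (φ : 𝓢(ι → K, ℂ)),
      (∀ x, partOn J (1 : K) x ≠ 0 → radialMoment J j φ x = 0) ∧
      g = integralScale J 1 (fun s => s ^ j) (fun s => ((s : ℝ) : K)) φ})
    ?_ ?_ ?_ _ ⟨j, φ, h, rfl⟩
  · rintro _ ⟨j, φ, h, rfl⟩
    exact differentiable_integralScale J 1 (by fun_prop) hcc φ
  · rintro _ ⟨j, φ, h, rfl⟩ m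
    rw [funext fun x => fderiv_integralScale_apply J 1 (k := fun s => s ^ j) (by fun_prop) hcc φ x m]
    have e1 : (fun s : ℝ => s ^ j * RCLike.re (s : K)) = fun s => s ^ (j + 1) := by
      funext s; simp [pow_succ]
    have e2 : ∀ (χ : 𝓢(ι → K, ℂ)) (x : ι → K), integralScale J 1
        (fun s : ℝ => s ^ j * RCLike.im (s : K)) (fun s => ((s : ℝ) : K)) χ x = 0 := by
      intro χ x
      simp [integralScale]
    rw [e1]
    simp only [e2, add_zero]
    refine add_mem (AddSubmonoid.subset_closure ⟨_, _, ?_, rfl⟩)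
      (AddSubmonoid.subset_closure ⟨_, _, ?_, rfl⟩)
    -- Applying the moment identity to one component of `m` leaves only one of its two terms.
    · intro x hx
      have := radialMoment_lineDeriv J j φ h hx (partOn Jᶜ 1 m)
      simpa [partOn_partOn, partOn_empty, radialMoment_zero] using this
    · intro x hx
      have := radialMoment_lineDeriv J j φ h hx (partOn J 1 m)
      have hJ : Jᶜ ∩ J = ∅ := by ext; simp
      simpa [hJ, partOn_partOn, partOn_empty, radialMoment_zero] using this
  · rintro _ ⟨j, φ, h, rfl⟩ n
    obtain ⟨C, hC0, hC⟩ := φ.one_add_norm_pow_mul_norm_le n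
    obtain ⟨D, hD0, hD⟩ := φ.one_add_norm_pow_mul_norm_le (n + j + 2)
    refine ⟨max C (D * ∫ s : ℝ, (1 + s ^ 2)⁻¹), fun x => ?_⟩
    rcases le_or_gt ‖partOn J (1 : K) x‖ 1 with hx | hx
    · refine le_trans ?_ (le_max_left _ _)
      rcases eq_or_ne (‖x‖ ^ n) 0 with h0 | h0
      · rw [h0, zero_mul]; exact hC0
      have hpos : 0 < ‖x‖ ^ n := lt_of_le_of_ne (by positivity) h0.symm
      have hxk : ∀ k ∈ J, ‖x k‖ ≤ 1 := fun k hk => by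
        have := (norm_le_pi_norm (partOn J (1 : K) x) k).trans hx
        simpa [partOn_apply, hk] using this
      have key := norm_integralScale_le J (fun s => s ^ j) (fun s : ℝ => (s : K)) φ zero_le_one x
        (C := C / ‖x‖ ^ n) (fun s hs => by
        rw [norm_smul, le_div_iff₀ hpos, norm_pow, Real.norm_eq_abs, abs_of_pos hs.1]
        have h1 := norm_le_of_norm_partOn_le J (s : K) zero_le_one hxk
        calc s ^ j * ‖φ (scaleOn J (s : K) x)‖ * ‖x‖ ^ n
            ≤ 1 * ‖φ (scaleOn J (s : K) x)‖ * (1 + ‖scaleOn J (s : K) x‖) ^ n := by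
              gcongr
              exact pow_le_one₀ hs.1.le hs.2
          _ ≤ C := by rw [one_mul, mul_comm]; exact hC _)
      rwa [mul_one, le_div_iff₀ hpos, mul_comm] at key
    -- Away from the slab the integral over (0, 1] may pass close to the region where φ is large.
    -- The vanishing moment replaces it by minus the integral over (1, ∞), along which the norm does
    -- not drop below that of x.
    · refine le_trans ?_ (le_max_right _ _)
      have hx0 : partOn J (1 : K) x ≠ 0 := by
        intro h0; rw [h0, norm_zero] at hx; linarith
      have hI := integrableOn_radialMoment J j φ hx0
      have h0 := h x hx0
      unfold radialMoment at h0
      rw [← Ioc_union_Ioi_eq_Ioi (zero_le_one : (0 : ℝ) ≤ 1), setIntegral_union Ioc_disjoint_Ioi_same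
        measurableSet_Ioi (hI.mono_set Ioc_subset_Ioi_self)
        (hI.mono_set (Ioi_subset_Ioi zero_le_one))] at h0
      have h1 : integralScale J 1 (fun s => s ^ j) (fun s => ((s : ℝ) : K)) φ x =
          -∫ s in Ioi (1 : ℝ), s ^ j • φ (scaleOn J (s : K) x) := eq_neg_of_add_eq_zero_left h0
      have hint : Integrable (fun s : ℝ => D * (1 + s ^ 2)⁻¹) := integrable_inv_one_add_sq.const_mul D
      rw [h1, norm_neg]
      calc ‖x‖ ^ n * ‖∫ s in Ioi (1 : ℝ), s ^ j • φ (scaleOn J (s : K) x)‖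
          = ‖∫ s in Ioi (1 : ℝ), ‖x‖ ^ n • (s ^ j • φ (scaleOn J (s : K) x))‖ := by
            rw [integral_smul, norm_smul, norm_pow, norm_norm]
        _ ≤ ∫ s in Ioi (1 : ℝ), D * (1 + s ^ 2)⁻¹ := by
            refine norm_integral_le_of_norm_le hint.restrict ?_
            filter_upwards [ae_restrict_mem measurableSet_Ioi] with s hs
            have hs1 : 1 ≤ s := le_of_lt hs
            have hs0 : 0 ≤ s := by linarith
            have h2 := pow_mul_le_of_decay (j := j) (m := 1) (C := D)
              (D := (1 + ‖scaleOn J (s : K) x‖) ^ n * ‖φ (scaleOn J (s : K) x)‖) one_pos hs0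
              (by positivity) (by simpa using one_add_le_one_add_norm_scaleOn J hs0 x hx.le)
              (by rw [← mul_assoc, ← pow_add, show j + 2 + n = n + j + 2 by ring]; exact hD _)
            rw [one_pow, div_one] at h2
            refine le_trans ?_ h2
            rw [norm_smul, norm_smul, norm_pow, norm_norm, norm_pow, Real.norm_eq_abs,
              abs_of_nonneg hs0]
            calc ‖x‖ ^ n * (s ^ j * ‖φ (scaleOn J (s : K) x)‖)
                ≤ (1 + ‖scaleOn J (s : K) x‖) ^ n * ((1 + s) ^ j * ‖φ (scaleOn J (s : K) x)‖) := by
                  have := norm_le_norm_scaleOn J hs1 x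
                  gcongr <;> linarith
              _ = _ := by ring
        _ ≤ ∫ s : ℝ, D * (1 + s ^ 2)⁻¹ :=
            setIntegral_le_integral hint (Filter.Eventually.of_forall fun s => by positivity)
        _ = D * ∫ s : ℝ, (1 + s ^ 2)⁻¹ := integral_const_mul _ _

/-! ### Schwartz functions that vanish on a coordinate subspace -/

theorem _root_.Function.HasTemperateGrowth.fderiv_apply {E F : Type*} [NormedAddCommGroup E]
    [NormedSpace ℝ E] [NormedAddCommGroup F] [NormedSpace ℝ F] {f : E → F}
    (hf : f.HasTemperateGrowth) (m : E) : (fun x => fderiv ℝ f x m).HasTemperateGrowth := by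
  have h : (fderiv ℝ f).HasTemperateGrowth := by
    refine ⟨hf.1.fderiv_right (m := ∞) (by simp), fun n => ?_⟩
    simpa only [norm_iteratedFDeriv_fderiv] using hf.2 (n + 1)
  exact (ContinuousLinearMap.apply ℝ F m).hasTemperateGrowth.comp h

/-- Without a cut-off the integral over contractions need not decay in the directions of `J`. The
family consists of all products of an integral with a multiplier supported in the same closed slab,
so that derivatives of χ are allowed too. -/
theorem exists_schwartzMap_mul_integralScale (J : Finset ι) {χ : (ι → K) → ℂ}
    (hχ : χ.HasTemperateGrowth) {R : ℝ} (hR : 0 ≤ R) (hsupp : ∀ x, χ x ≠ 0 → ∀ k ∈ J, ‖x k‖ ≤ R)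
    (φ : 𝓢(ι → K, ℂ)) : ∃ ψ : 𝓢(ι → K, ℂ),
      ∀ x, ψ x = χ x * integralScale J 1 1 (fun s => ((s : ℝ) : K)) φ x := by
  have hcc : Continuous fun s : ℝ => (s : K) := RCLike.continuous_ofReal
  let Z : Set (ι → K) := {x | ∀ k ∈ J, ‖x k‖ ≤ R}
  have hZ : IsClosed Z := by
    have : Z = ⋂ k ∈ J, {x | ‖x k‖ ≤ R} := by ext; simp [Z]
    rw [this]
    exact isClosed_biInter fun k _ => isClosed_le (by fun_prop) continuous_const
  refine exists_schwartzMap_of_closedFamily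
    (S := {g | ∃ (χ : (ι → K) → ℂ) (k : ℝ → ℝ) (φ : 𝓢(ι → K, ℂ)), χ.HasTemperateGrowth ∧
      (∀ x ∉ Z, χ x = 0) ∧ Continuous k ∧
      g = fun x => χ x * integralScale J 1 k (fun s => ((s : ℝ) : K)) φ x})
    ?_ ?_ ?_ _ ⟨χ, 1, φ, hχ, fun x hx => by_contra fun h => hx (hsupp x h), continuous_one, rfl⟩
  · rintro _ ⟨χ, k, φ, hχ, -, hk, rfl⟩
    exact (hχ.1.differentiable (by simp)).mul (differentiable_integralScale J 1 hk hcc φ)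
  · rintro _ ⟨χ, k, φ, hχ, hs, hk, rfl⟩ m
    have hχd : Differentiable ℝ χ := hχ.1.differentiable (by simp)
    have hs' : ∀ x ∉ Z, fderiv ℝ χ x m = 0 := by
      intro x hx
      have : χ =ᶠ[nhds x] fun _ => 0 := by
        filter_upwards [hZ.isOpen_compl.mem_nhds hx] with y hy using hs y hy
      rw [this.fderiv_eq]
      simp
    rw [show (fun x => fderiv ℝ (fun x => χ x * integralScale J 1 k (fun s => ((s : ℝ) : K)) φ x) x m) =
      (fun x => fderiv ℝ χ x m * integralScale J 1 k (fun s => ((s : ℝ) : K)) φ x) +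
      ((fun x => χ x * integralScale J 1 k (fun s => ((s : ℝ) : K)) (∂_{partOn Jᶜ 1 m} φ) x) +
      ((fun x => χ x * integralScale J 1 (fun s => k s * RCLike.re (s : K))
        (fun s => ((s : ℝ) : K)) (∂_{partOn J 1 m} φ) x) +
      (fun x => χ x * integralScale J 1 (fun s => k s * RCLike.im (s : K))
        (fun s => ((s : ℝ) : K)) (∂_{partOn J RCLike.I m} φ) x))) from ?_]
    · refine add_mem (AddSubmonoid.subset_closure ⟨_, _, _, hχ.fderiv_apply m, hs', hk, rfl⟩)
        (add_mem (AddSubmonoid.subset_closure ⟨_, _, _, hχ, hs, hk, rfl⟩)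
        (add_mem (AddSubmonoid.subset_closure ⟨_, _, _, hχ, hs, ?_, rfl⟩)
        (AddSubmonoid.subset_closure ⟨_, _, _, hχ, hs, ?_, rfl⟩)))
      · exact hk.mul (RCLike.continuous_re.comp hcc)
      · exact hk.mul (RCLike.continuous_im.comp hcc)
    · funext x
      rw [fderiv_fun_mul (hχd x) (differentiable_integralScale J 1 hk hcc φ x)]
      simp only [_root_.add_apply, _root_.smul_apply, Pi.add_apply, smul_eq_mul,
        fderiv_integralScale_apply J 1 hk hcc φ x m]
      ring
  · rintro _ ⟨χ, k, φ, hχ, hs, hk, rfl⟩ n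
    obtain ⟨l, C, hC⟩ := hχ.2 0
    simp only [norm_iteratedFDeriv_zero] at hC
    obtain ⟨D, hD⟩ := isCompact_Icc.exists_bound_of_continuousOn (s := Icc (0 : ℝ) 1) hk.continuousOn
    obtain ⟨M, hM0, hM⟩ := φ.one_add_norm_pow_mul_norm_le (n + l)
    have hC0 : 0 ≤ C := by simpa using (norm_nonneg _).trans (hC 0)
    have hD0 : 0 ≤ D := (norm_nonneg _).trans (hD 0 ⟨le_rfl, zero_le_one⟩)
    refine ⟨C * (D * ((1 + R) ^ (n + l) * M)), fun x => ?_⟩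
    by_cases hx : x ∈ Z
    · have hpos : 0 < (1 + ‖x‖) ^ (n + l) := by positivity
      have key := norm_integralScale_le J k (fun s : ℝ => (s : K)) φ zero_le_one x
        (C := D * ((1 + R) ^ (n + l) * M) / (1 + ‖x‖) ^ (n + l)) (fun s hs => by
        rw [norm_smul, le_div_iff₀ hpos]
        have h1 := norm_le_of_norm_partOn_le J (s : K) hR hx
        have h2 : 1 + ‖x‖ ≤ (1 + R) * (1 + ‖scaleOn J (s : K) x‖) := by
          nlinarith [norm_nonneg (scaleOn J (s : K) x)]
        calc ‖k s‖ * ‖φ (scaleOn J (s : K) x)‖ * (1 + ‖x‖) ^ (n + l)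
            ≤ D * ‖φ (scaleOn J (s : K) x)‖ * ((1 + R) * (1 + ‖scaleOn J (s : K) x‖)) ^ (n + l) := by
              gcongr
              exact hD s (Ioc_subset_Icc_self hs)
          _ = D * ((1 + R) ^ (n + l) *
                ((1 + ‖scaleOn J (s : K) x‖) ^ (n + l) * ‖φ (scaleOn J (s : K) x)‖)) := by
              rw [mul_pow]; ring
          _ ≤ _ := by gcongr; exact hM _)
      rw [mul_one, le_div_iff₀ hpos] at key
      rw [norm_mul]
      calc ‖x‖ ^ n * (‖χ x‖ * ‖integralScale J 1 k (fun s => ((s : ℝ) : K)) φ x‖)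
          ≤ (1 + ‖x‖) ^ n * (C * (1 + ‖x‖) ^ l * ‖integralScale J 1 k (fun s => ((s : ℝ) : K)) φ x‖) := by
            gcongr
            · linarith
            · exact hC x
        _ = C * (‖integralScale J 1 k (fun s => ((s : ℝ) : K)) φ x‖ * (1 + ‖x‖) ^ (n + l)) := by
            rw [pow_add]; ring
        _ ≤ _ := by gcongr
    · simp only [hs x hx, zero_mul, norm_zero, mul_zero]
      positivity

/-- Hadamard's lemma: a Schwartz function that vanishes where the coordinates in `J` vanish is,
after a cut-off, a combination of these coordinates. -/
theorem exists_eq_sum_coord_mul (J : Finset ι) {χ : (ι → K) → ℂ}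
    (hχ : χ.HasTemperateGrowth) {R : ℝ} (hR : 0 ≤ R) (hsupp : ∀ x, χ x ≠ 0 → ∀ k ∈ J, ‖x k‖ ≤ R)
    (φ : 𝓢(ι → K, ℂ)) (hφ : ∀ x, (∀ k ∈ J, x k = 0) → φ x = 0) :
    ∃ a b : ι → 𝓢(ι → K, ℂ), ∀ x, χ x * φ x =
      ∑ k ∈ J, ((RCLike.re (x k) : ℂ) * a k x + (RCLike.im (x k) : ℂ) * b k x) := by
  have hcc : Continuous fun s : ℝ => (s : K) := RCLike.continuous_ofReal
  have hc : ∀ s : ℝ, HasDerivAt (fun s : ℝ => (s : K)) 1 s := fun s => by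
    simpa using (RCLike.ofRealCLM (K := K)).hasDerivAt (x := s)
  choose a ha using fun k => exists_schwartzMap_mul_integralScale J hχ hR hsupp
    (∂_{(Pi.single k 1 : ι → K)} φ)
  choose b hb using fun k => exists_schwartzMap_mul_integralScale J hχ hR hsupp
    (∂_{(Pi.single k RCLike.I : ι → K)} φ)
  refine ⟨a, b, fun x => ?_⟩
  have hsx : Continuous fun s : ℝ => scaleOn J (s : K) x :=
    ((continuous_scaleOn J).comp hcc).clm_apply continuous_const
  have hpart : partOn J 1 x = ∑ k ∈ J,
      (RCLike.re (x k) • (Pi.single k 1 : ι → K) + RCLike.im (x k) • (Pi.single k RCLike.I : ι → K)) := by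
    ext l
    simp only [partOn_apply, Finset.sum_apply, Pi.add_apply, Pi.smul_apply, one_mul]
    rw [← Finset.sum_ite_eq J l (fun k => x k)]
    refine Finset.sum_congr rfl fun k _ => ?_
    by_cases h : l = k
    · subst h
      simp only [if_true, Pi.single_eq_same, RCLike.real_smul_eq_coe_mul, mul_one]
      exact (RCLike.re_add_im _).symm
    · simp [h]
  -- Fundamental theorem of calculus along the contraction of the coordinates in `J`, which starts
  -- at a point where φ vanishes.
  have h1 : φ x = ∫ s in Ioc (0 : ℝ) 1, fderiv ℝ φ (scaleOn J (s : K) x) (partOn J 1 x) := by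
    have hcont := continuous_fderiv_scaleOn_partOn J φ hcc (continuous_const (y := (1 : K))) x
    rw [← intervalIntegral.integral_of_le zero_le_one]
    rw [intervalIntegral.integral_eq_sub_of_hasDerivAt
      (f := fun s : ℝ => φ (scaleOn J (s : K) x))
      (fun s _ => φ.hasDerivAt_comp_scaleOn J (hc s) x) (hcont.intervalIntegrable _ _)]
    rw [RCLike.ofReal_one, scaleOn_one, hφ (scaleOn J _ x) (fun k hk => by simp [scaleOn_apply, hk]),
      sub_zero]
  have hint : ∀ χ : 𝓢(ι → K, ℂ), Integrable (fun s : ℝ => χ (scaleOn J (s : K) x))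
      (volume.restrict (Ioc 0 1)) := fun χ =>
    ((χ.continuous.comp hsx).continuousOn.integrableOn_Icc).mono_set Ioc_subset_Icc_self
  simp only [ha, hb]
  have h2 : φ x = ∑ k ∈ J, ((RCLike.re (x k) : ℂ) *
        integralScale J 1 1 (fun s => ((s : ℝ) : K)) (∂_{(Pi.single k 1 : ι → K)} φ) x +
      (RCLike.im (x k) : ℂ) *
        integralScale J 1 1 (fun s => ((s : ℝ) : K)) (∂_{(Pi.single k RCLike.I : ι → K)} φ) x) := by
    rw [h1]
    unfold integralScale
    simp only [Pi.one_apply, one_smul, ← integral_const_mul]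
    have e : ∀ k ∈ J, ∀ χ : 𝓢(ι → K, ℂ), ∀ r : ℂ, Integrable (fun s : ℝ => r * χ (scaleOn J (s : K) x))
      (volume.restrict (Ioc 0 1)) := fun k _ χ r => (hint χ).const_mul r
    rw [Finset.sum_congr rfl fun k hk => (integral_add (e k hk _ _) (e k hk _ _)).symm,
      ← integral_finsetSum J fun k hk => (e k hk _ _).fun_add (e k hk _ _)]
    refine integral_congr_ae (Filter.Eventually.of_forall fun s => ?_)
    simp only [hpart, map_sum, map_add, map_smul, SchwartzMap.lineDerivOp_apply_eq_fderiv,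
      Complex.real_smul]
  rw [h2, Finset.mul_sum]
  refine Finset.sum_congr rfl fun k _ => ?_
  ring

end Primitives

/-! ### The Fourier transform in one coordinate -/

noncomputable section PartialFourier

set_option linter.unusedSectionVars false

open scoped ContDiff LineDeriv FourierTransform
open MeasureTheory Set

variable {ι K : Type*} [Fintype ι] [DecidableEq ι] [RCLike K]

/-- The function `r ↦ exp (2 π i r)`. -/
def phase (r : ℝ) : ℂ := Complex.exp (↑(2 * Real.pi * r) * Complex.I)

theorem norm_phase (r : ℝ) : ‖phase r‖ = 1 := Complex.norm_exp_ofReal_mul_I _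

theorem phase_zero : phase 0 = 1 := by simp [phase]

theorem phase_add (r s : ℝ) : phase (r + s) = phase r * phase s := by
  rw [phase, phase, phase, ← Complex.exp_add]
  congr 1
  push_cast
  ring

theorem hasDerivAt_phase (r : ℝ) :
    HasDerivAt phase ((2 * Real.pi * Complex.I) * phase r) r := by
  have h1 : HasDerivAt (fun r : ℝ => ((2 * Real.pi * r : ℝ) : ℂ) * Complex.I)
      (((2 * Real.pi : ℝ) : ℂ) * Complex.I) r := by
    refine HasDerivAt.mul_const (HasDerivAt.ofReal_comp ?_) _
    simpa using (hasDerivAt_id r).const_mul (2 * Real.pi)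
  refine h1.cexp.congr_deriv ?_
  rw [phase]
  push_cast
  ring

theorem continuous_phase : Continuous phase :=
  continuous_iff_continuousAt.2 fun r => (hasDerivAt_phase r).continuousAt

theorem update_eq_add_single (k : ι) (x : ι → K) (y : K) :
    Function.update x k y = Function.update x k 0 + ContinuousLinearMap.single ℝ (fun _ => K) k y := by
  ext l
  by_cases h : l = k
  · subst h; simp
  · simp [h]

theorem norm_le_norm_update (k : ι) (x : ι → K) (y : K) : ‖y‖ ≤ ‖Function.update x k y‖ := by
  simpa using norm_le_pi_norm (Function.update x k y) k

theorem norm_update_zero_le (k : ι) (x : ι → K) (y : K) :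
    ‖Function.update x k 0‖ ≤ ‖Function.update x k y‖ := by
  refine (pi_norm_le_iff_of_nonneg (norm_nonneg _)).2 fun l => ?_
  by_cases h : l = k
  · subst h; simp
  · simpa [h] using norm_le_pi_norm (Function.update x k y) l

theorem norm_le_max_update (k : ι) (x : ι → K) : ‖x‖ ≤ max ‖x k‖ ‖Function.update x k 0‖ := by
  refine (pi_norm_le_iff_of_nonneg (by positivity)).2 fun l => ?_
  by_cases h : l = k
  · subst h; simp
  · refine le_max_of_le_right ?_
    simpa [h] using norm_le_pi_norm (Function.update x k 0) l

theorem hasTemperateGrowth_update (k : ι) (x : ι → K) :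
    (fun y : K => Function.update x k y).HasTemperateGrowth := by
  rw [funext (update_eq_add_single k x)]
  exact (Function.HasTemperateGrowth.const _).add
    (ContinuousLinearMap.single ℝ (fun _ => K) k).hasTemperateGrowth

theorem continuous_update_right (k : ι) (x : ι → K) :
    Continuous fun y : K => Function.update x k y :=
  continuous_const.update k continuous_id

/-- The restriction of a Schwartz function to a line parallel to a coordinate axis. -/
def SchwartzMap.slice (k : ι) (φ : 𝓢(ι → K, ℂ)) (x : ι → K) : 𝓢(K, ℂ) :=
  SchwartzMap.compCLMOfAntilipschitz ℂ (K := 1) (hasTemperateGrowth_update k x)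
    (AntilipschitzWith.of_le_mul_dist fun y y' => by
      have := dist_le_pi_dist (Function.update x k y) (Function.update x k y') k
      simpa using this) φ

theorem SchwartzMap.slice_apply (k : ι) (φ : 𝓢(ι → K, ℂ)) (x : ι → K) (y : K) :
    φ.slice k x y = φ (Function.update x k y) := rfl

theorem SchwartzMap.slice_update (k : ι) (φ : 𝓢(ι → K, ℂ)) (x : ι → K) (y : K) :
    φ.slice k (Function.update x k y) = φ.slice k x := by
  ext z; simp [SchwartzMap.slice_apply]

/-- The Fourier transform in the coordinate `k`, as a function. -/
def pftFun (k : ι) (φ : (ι → K) → ℂ) (x : ι → K) : ℂ :=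
  ∫ y : K, phase (-RCLike.re (y * x k)) * φ (Function.update x k y)

/-- The phase uses the bilinear pairing Re(y x_k), which is the real inner product of y with the
conjugate of x_k; this accounts for the conjugation. -/
theorem pftFun_eq_fourier (k : ι) (φ : 𝓢(ι → K, ℂ)) (x : ι → K) :
    pftFun k φ x = 𝓕 (φ.slice k x) (starRingEnd K (x k)) := by
  rw [SchwartzMap.fourier_coe, Real.fourier_eq', pftFun]
  refine integral_congr_ae (.of_forall fun y => ?_)
  have : inner ℝ y ((starRingEnd K) (x k)) = RCLike.re (y * x k) := by
    change RCLike.re (inner K y ((starRingEnd K) (x k))) = _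
    rw [RCLike.inner_apply, ← map_mul, RCLike.conj_re, mul_comm]
  simp only [phase, this, SchwartzMap.slice_apply, smul_eq_mul]
  congr 3
  push_cast
  ring

theorem pftFun_congr {k : ι} {φ ψ : (ι → K) → ℂ} {x : ι → K}
    (h : ∀ y, φ (Function.update x k y) = ψ (Function.update x k y)) :
    pftFun k φ x = pftFun k ψ x := by
  simp only [pftFun, h]

theorem pftFun_mul {k : ι} {g φ : (ι → K) → ℂ} {x : ι → K}
    (h : ∀ y, g (Function.update x k y) = g x) :
    pftFun k (fun x => g x * φ x) x = g x * pftFun k φ x := by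
  simp only [pftFun, h, ← integral_const_mul]
  congr 1
  ext y
  ring

theorem integrable_one_add_norm_pow_neg :
    Integrable fun y : K => (1 + ‖y‖) ^ (-((Module.finrank ℝ K + 1 : ℕ) : ℝ)) :=
  integrable_one_add_norm (by exact_mod_cast Nat.lt_succ_self _)

/-- The decay of φ is shared out: m powers control the remaining coordinates, and one power more
than the real dimension of `K` makes the integral over y converge. -/
theorem one_add_norm_rpow_mul_le {C D : ℝ} {m : ℕ} {k : ι} {x : ι → K} {y : K} (hD : 0 ≤ D)
    (h : (1 + ‖Function.update x k y‖) ^ (m + (Module.finrank ℝ K + 1)) * D ≤ C) :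
    ‖Function.update x k 0‖ ^ m * D ≤ C * (1 + ‖y‖) ^ (-((Module.finrank ℝ K + 1 : ℕ) : ℝ)) := by
  have hpos : 0 < (1 + ‖y‖) ^ (Module.finrank ℝ K + 1) := by positivity
  rw [Real.rpow_neg (by positivity), Real.rpow_natCast, ← div_eq_mul_inv, le_div_iff₀ hpos]
  refine le_trans ?_ h
  rw [pow_add _ m]
  have h1 := norm_le_norm_update k x y
  have h2 := norm_update_zero_le k x y
  calc ‖Function.update x k 0‖ ^ m * D * (1 + ‖y‖) ^ (Module.finrank ℝ K + 1)
      = ‖Function.update x k 0‖ ^ m * (1 + ‖y‖) ^ (Module.finrank ℝ K + 1) * D := by ring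
    _ ≤ _ := by gcongr; linarith

theorem integrable_pftFun (k : ι) (φ : 𝓢(ι → K, ℂ)) (x : ι → K) :
    Integrable fun y : K => phase (-RCLike.re (y * x k)) * φ (Function.update x k y) := by
  refine ((φ.slice k x).integrable (μ := volume)).bdd_mul (c := 1) ?_ (.of_forall fun y => ?_)
  · refine (continuous_phase.comp ?_).aestronglyMeasurable
    exact (RCLike.continuous_re.comp (continuous_id.mul continuous_const)).neg
  · exact (norm_phase _).le

theorem pftFun_add (k : ι) (φ ψ : 𝓢(ι → K, ℂ)) (x : ι → K) :
    pftFun k (φ + ψ : 𝓢(ι → K, ℂ)) x = pftFun k φ x + pftFun k ψ x := by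
  simp only [pftFun]
  rw [← integral_add (integrable_pftFun k φ x) (integrable_pftFun k ψ x)]
  simp [mul_add]

theorem pftFun_smul (k : ι) (a : ℂ) (φ : 𝓢(ι → K, ℂ)) (x : ι → K) :
    pftFun k (a • φ : 𝓢(ι → K, ℂ)) x = a • pftFun k φ x := by
  simp only [pftFun]
  rw [← integral_smul]
  refine integral_congr_ae (.of_forall fun y => ?_)
  simp [mul_left_comm]

/-- The functional `m ↦ re (y m_k)`. -/
def reMulCoord (k : ι) (y : K) : (ι → K) →L[ℝ] ℝ :=
  RCLike.reCLM.comp ((ContinuousLinearMap.mul ℝ K y).comp (ContinuousLinearMap.proj k))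

theorem reMulCoord_apply (k : ι) (y : K) (m : ι → K) : reMulCoord k y m = RCLike.re (y * m k) := rfl

theorem norm_reMulCoord_le (k : ι) (y : K) : ‖reMulCoord k y‖ ≤ ‖y‖ := by
  refine ContinuousLinearMap.opNorm_le_bound _ (norm_nonneg _) fun m => ?_
  rw [reMulCoord_apply]
  refine (RCLike.norm_re_le_norm _).trans ?_
  rw [norm_mul]
  gcongr
  exact norm_le_pi_norm m k

theorem continuous_reMulCoord (k : ι) : Continuous (reMulCoord (K := K) k) := by
  unfold reMulCoord
  fun_prop

theorem hasTemperateGrowth_reMulCoord (k : ι) (c : K) :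
    (fun x : ι → K => ((RCLike.re (c * x k) : ℝ) : ℂ)).HasTemperateGrowth :=
  (Complex.ofRealCLM.comp (reMulCoord k c)).hasTemperateGrowth

theorem pftFun_lineDeriv_single (k : ι) (φ : 𝓢(ι → K, ℂ)) (c : K) (x : ι → K) :
    pftFun k (∂_{(Pi.single k c : ι → K)} φ : 𝓢(ι → K, ℂ)) x =
      (2 * Real.pi * Complex.I) * RCLike.re (c * x k) * pftFun k φ x := by
  have hs : (∂_{(Pi.single k c : ι → K)} φ : 𝓢(ι → K, ℂ)).slice k x = ∂_{c} (φ.slice k x) := by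
    ext y
    rw [SchwartzMap.slice_apply, SchwartzMap.lineDerivOp_apply_eq_fderiv,
      SchwartzMap.lineDerivOp_apply_eq_fderiv]
    have h1 : HasFDerivAt (fun y : K => Function.update x k y)
        (ContinuousLinearMap.single ℝ (fun _ => K) k) y := by
      rw [funext (update_eq_add_single k x)]
      exact (ContinuousLinearMap.hasFDerivAt _).const_add _
    have h2 : HasFDerivAt (φ.slice k x) _ y :=
      (φ.hasFDerivAt (Function.update x k y)).comp y h1
    rw [h2.fderiv]
    rfl
  have hin : inner ℝ ((starRingEnd K) (x k)) c = RCLike.re (c * x k) := by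
    change RCLike.re (inner K ((starRingEnd K) (x k)) c) = _
    rw [RCLike.inner_apply]; simp
  rw [pftFun_eq_fourier, pftFun_eq_fourier, hs, SchwartzMap.fourier_lineDerivOp_eq,
    _root_.smul_apply, SchwartzMap.smulLeftCLM_apply_apply (Function.hasTemperateGrowth_inner_left c), hin]
  simp [mul_assoc]

/-- Differentiation under the integral: varying x_k moves only the phase, and varying the other
coordinates moves only φ, hence `Function.update m k 0`. One further power of decay absorbs the
factor y coming from the phase. -/
theorem hasFDerivAt_pftFun (k : ι) (φ : 𝓢(ι → K, ℂ)) (x₀ : ι → K) :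
    ∃ φ' : K → (ι → K) →L[ℝ] ℂ, Integrable φ' ∧
      HasFDerivAt (pftFun k φ) (∫ y, φ' y) x₀ ∧
      ∀ y m, φ' y m = phase (-RCLike.re (y * x₀ k)) *
        (fderiv ℝ φ (Function.update x₀ k y) (Function.update m k 0) -
          2 * Real.pi * Complex.I * RCLike.re (y * m k) * φ (Function.update x₀ k y)) := by
  obtain ⟨C, hC0, hC⟩ := φ.one_add_norm_pow_mul_norm_fderiv_le (Module.finrank ℝ K + 1)
  obtain ⟨D, hD0, hD⟩ := φ.one_add_norm_pow_mul_norm_le (1 + (Module.finrank ℝ K + 1))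
  set P : (ι → K) →L[ℝ] (ι → K) := partOn {k}ᶜ 1 with hP
  have hPm : ∀ m : ι → K, P m = Function.update m k 0 := fun m => by
    ext l
    by_cases h : l = k
    · subst h; simp [hP, partOn_apply]
    · simp [hP, partOn_apply, h]
  have hu : ∀ x y, Function.update x k y = P x + ContinuousLinearMap.single ℝ (fun _ => K) k y :=
    fun x y => by rw [hPm, ← update_eq_add_single]
  set F' : (ι → K) → K → (ι → K) →L[ℝ] ℂ := fun x y =>
    phase (-RCLike.re (y * x k)) • (fderiv ℝ φ (Function.update x k y)).comp P -
      (φ (Function.update x k y) * (2 * Real.pi * Complex.I * phase (-RCLike.re (y * x k)))) •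
        Complex.ofRealCLM.comp (reMulCoord k y) with hF'
  have hre : ∀ x : ι → K, Continuous fun y : K => phase (-RCLike.re (y * x k)) := fun x =>
    continuous_phase.comp (RCLike.continuous_re.comp (continuous_id.mul continuous_const)).neg
  have hcont : Continuous (F' x₀) := by
    refine ((hre x₀).smul ((φ.differentiable_fderiv.continuous.comp
      (continuous_update_right k x₀)).clm_comp continuous_const)).sub
      (((φ.continuous.comp (continuous_update_right k x₀)).mul
        (continuous_const.mul (hre x₀))).smul
        (continuous_const.clm_comp (continuous_reMulCoord k)))
  have hbd : ∀ y x, ‖F' x y‖ ≤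
      (C + 2 * Real.pi * D) * (1 + ‖y‖) ^ (-((Module.finrank ℝ K + 1 : ℕ) : ℝ)) := by
    intro y x
    have h1 : ‖fderiv ℝ φ (Function.update x k y)‖ ≤
        C * (1 + ‖y‖) ^ (-((Module.finrank ℝ K + 1 : ℕ) : ℝ)) := by
      simpa using one_add_norm_rpow_mul_le (m := 0) (k := k) (x := x) (y := y) (norm_nonneg _)
        (by simpa using hC _)
    have h2 : ‖y‖ * ‖φ (Function.update x k y)‖ ≤
        D * (1 + ‖y‖) ^ (-((Module.finrank ℝ K + 1 : ℕ) : ℝ)) := by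
      have := one_add_norm_rpow_mul_le (m := 0) (k := k) (x := x) (y := y)
        (D := ‖y‖ * ‖φ (Function.update x k y)‖) (C := D) (by positivity) ?_
      · simpa using this
      · refine le_trans ?_ (hD (Function.update x k y))
        rw [zero_add, pow_add _ 1, pow_one]
        have := norm_le_norm_update k x y
        calc _ = ‖y‖ * (1 + ‖Function.update x k y‖) ^ (Module.finrank ℝ K + 1) *
              ‖φ (Function.update x k y)‖ := by ring
          _ ≤ _ := by gcongr; linarith
    calc ‖F' x y‖ ≤ ‖fderiv ℝ φ (Function.update x k y)‖ * ‖P‖ +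
          2 * Real.pi * (‖φ (Function.update x k y)‖ * ‖Complex.ofRealCLM.comp (reMulCoord k y)‖) := by
          refine (norm_sub_le _ _).trans (add_le_add ?_ ?_)
          · rw [norm_smul, norm_phase, one_mul]
            exact ContinuousLinearMap.opNorm_comp_le _ _
          · rw [norm_smul, norm_mul, norm_mul, norm_phase]
            simp only [norm_mul, Complex.norm_I, Complex.norm_real, Real.norm_eq_abs,
              abs_of_pos Real.pi_pos, Complex.norm_ofNat]
            apply le_of_eq; ring
      _ ≤ ‖fderiv ℝ φ (Function.update x k y)‖ * 1 +
          2 * Real.pi * (‖φ (Function.update x k y)‖ * (1 * ‖y‖)) := by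
          gcongr
          · refine ContinuousLinearMap.opNorm_le_bound _ zero_le_one fun m => ?_
            rw [one_mul]
            exact norm_partOn_one_le _ _
          · refine (ContinuousLinearMap.opNorm_comp_le _ _).trans ?_
            gcongr
            · exact Complex.ofRealCLM_norm.le
            · exact norm_reMulCoord_le k y
      _ ≤ C * (1 + ‖y‖) ^ (-((Module.finrank ℝ K + 1 : ℕ) : ℝ)) +
          2 * Real.pi * (D * (1 + ‖y‖) ^ (-((Module.finrank ℝ K + 1 : ℕ) : ℝ))) := by
          rw [mul_one, one_mul, mul_comm ‖φ _‖]
          gcongr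
      _ = _ := by ring
  have hint : Integrable (F' x₀) := by
    have := Integrable.mono' (f := F' x₀)
      (integrable_one_add_norm_pow_neg.const_mul (C + 2 * Real.pi * D))
      hcont.aestronglyMeasurable (.of_forall fun y => hbd y x₀)
    exact this
  refine ⟨F' x₀, hint, ?_, fun y m => ?_⟩
  · refine hasFDerivAt_integral_of_dominated_of_fderiv_le (s := univ)
      (bound := fun y => (C + 2 * Real.pi * D) * (1 + ‖y‖) ^ (-((Module.finrank ℝ K + 1 : ℕ) : ℝ)))
      Filter.univ_mem (.of_forall fun x => (integrable_pftFun k φ x).aestronglyMeasurable)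
      (integrable_pftFun k φ x₀) hcont.aestronglyMeasurable
      (.of_forall fun y x _ => hbd y x) (integrable_one_add_norm_pow_neg.const_mul _)
      (.of_forall fun y x _ => ?_)
    have h1 : HasFDerivAt (fun x => phase (-RCLike.re (y * x k)))
        ((2 * Real.pi * Complex.I * phase (-RCLike.re (y * x k))) •
          Complex.ofRealCLM.comp (-reMulCoord k y)) x := by
      have h := (hasDerivAt_phase (-RCLike.re (y * x k))).hasFDerivAt.comp x
        ((reMulCoord k y).hasFDerivAt (x := x)).neg
      refine h.congr_fderiv ?_
      ext m
      simp [reMulCoord_apply, mul_comm, mul_left_comm, mul_assoc]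
    have h2 : HasFDerivAt (fun x => φ (Function.update x k y))
        ((fderiv ℝ φ (Function.update x k y)).comp P) x := by
      refine (φ.hasFDerivAt _).comp x ?_
      rw [funext fun x => hu x y]
      exact (P.hasFDerivAt).add_const _
    refine (h1.mul h2).congr_fderiv ?_
    ext m
    simp [hF', sub_eq_add_neg, mul_assoc, mul_comm, mul_left_comm]
  · simp only [hF', _root_.sub_apply, _root_.smul_apply, ContinuousLinearMap.comp_apply, hPm,
      reMulCoord_apply, smul_eq_mul, Complex.ofRealCLM_apply]
    ring

/-- Multiplication by `-2πi re (c x_k)`. -/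
def mulReCoord (k : ι) (c : K) : 𝓢(ι → K, ℂ) →L[ℂ] 𝓢(ι → K, ℂ) :=
  -(2 * Real.pi * Complex.I) • SchwartzMap.smulLeftCLM ℂ (fun x : ι → K => ((RCLike.re (c * x k) : ℝ) : ℂ))

theorem mulReCoord_apply (k : ι) (c : K) (φ : 𝓢(ι → K, ℂ)) (x : ι → K) :
    mulReCoord k c φ x = -(2 * Real.pi * Complex.I * RCLike.re (c * x k) * φ x) := by
  rw [mulReCoord, _root_.smul_apply, _root_.smul_apply,
    SchwartzMap.smulLeftCLM_apply_apply (hasTemperateGrowth_reMulCoord k c)]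
  simp only [smul_eq_mul]
  ring

theorem differentiable_pftFun (k : ι) (φ : 𝓢(ι → K, ℂ)) : Differentiable ℝ (pftFun k φ) :=
  fun x => by
    obtain ⟨φ', _, h, _⟩ := hasFDerivAt_pftFun k φ x
    exact h.differentiableAt

theorem fderiv_pftFun (k : ι) (φ : 𝓢(ι → K, ℂ)) (x m : ι → K) :
    fderiv ℝ (pftFun k φ) x m =
      pftFun k (∂_{Function.update m k 0} φ : 𝓢(ι → K, ℂ)) x +
        pftFun k (mulReCoord k (m k) φ) x := by
  obtain ⟨φ', h1, h2, h3⟩ := hasFDerivAt_pftFun k φ x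
  rw [h2.fderiv, ContinuousLinearMap.integral_apply h1]
  simp only [pftFun]
  rw [← integral_add (integrable_pftFun k _ x) (integrable_pftFun k _ x)]
  refine integral_congr_ae (.of_forall fun y => ?_)
  simp only [h3, SchwartzMap.lineDerivOp_apply_eq_fderiv, mulReCoord_apply, Function.update_self,
    mul_comm y (m k)]
  ring

theorem norm_pow_mul_norm_pftFun_le (k : ι) (φ : 𝓢(ι → K, ℂ)) {m : ℕ} {C : ℝ}
    (hC : ∀ x, (1 + ‖x‖) ^ (m + (Module.finrank ℝ K + 1)) * ‖φ x‖ ≤ C) (x : ι → K) :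
    ‖Function.update x k 0‖ ^ m * ‖pftFun k φ x‖ ≤
      C * ∫ y : K, (1 + ‖y‖) ^ (-((Module.finrank ℝ K + 1 : ℕ) : ℝ)) := by
  calc ‖Function.update x k 0‖ ^ m * ‖pftFun k φ x‖
      = ‖∫ y : K, (‖Function.update x k 0‖ ^ m : ℝ) •
          (phase (-RCLike.re (y * x k)) * φ (Function.update x k y))‖ := by
        rw [integral_smul, norm_smul, Real.norm_of_nonneg (by positivity)]; rfl
    _ ≤ ∫ y : K, C * (1 + ‖y‖) ^ (-((Module.finrank ℝ K + 1 : ℕ) : ℝ)) := by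
        refine norm_integral_le_of_norm_le (integrable_one_add_norm_pow_neg.const_mul _)
          (.of_forall fun y => ?_)
        rw [norm_smul, norm_mul, norm_phase, one_mul, Real.norm_of_nonneg (by positivity)]
        exact one_add_norm_rpow_mul_le (norm_nonneg _) (hC _)
    _ = _ := integral_const_mul _ _

/-- The functions of `φ` that are dominated by a continuous seminorm. -/
def seminormBounds (E : Type*) [NormedAddCommGroup E] [NormedSpace ℝ E] : Set (𝓢(E, ℂ) → ℝ) :=
  {b | ∃ (s : Finset (ℕ × ℕ)) (C : ℝ), 0 ≤ C ∧
    ∀ φ, b φ ≤ C * s.sup (schwartzSeminormFamily ℂ E ℂ) φ}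

/-! ### The cone of functions dominated by continuous Schwartz seminorms. -/

section seminormBounds

variable {E : Type*} [NormedAddCommGroup E] [NormedSpace ℝ E]

theorem add_mem_seminormBounds {b b' : 𝓢(E, ℂ) → ℝ} (hb : b ∈ seminormBounds E)
    (hb' : b' ∈ seminormBounds E) : b + b' ∈ seminormBounds E := by
  obtain ⟨s, C, hC, h⟩ := hb
  obtain ⟨s', C', hC', h'⟩ := hb'
  refine ⟨s ∪ s', C + C', by positivity, fun φ => ?_⟩
  rw [Pi.add_apply, add_mul]
  refine add_le_add ((h φ).trans ?_) ((h' φ).trans ?_)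
  · gcongr
    exact (Finset.sup_mono Finset.subset_union_left : s.sup (schwartzSeminormFamily ℂ E ℂ) ≤ _) φ
  · gcongr
    exact (Finset.sup_mono Finset.subset_union_right : s'.sup (schwartzSeminormFamily ℂ E ℂ) ≤ _) φ

theorem smul_mem_seminormBounds {c : ℝ} (hc : 0 ≤ c) {b : 𝓢(E, ℂ) → ℝ}
    (hb : b ∈ seminormBounds E) : c • b ∈ seminormBounds E := by
  obtain ⟨s, C, hC, h⟩ := hb
  refine ⟨s, c * C, by positivity, fun φ => ?_⟩
  rw [Pi.smul_apply, smul_eq_mul, mul_assoc]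
  gcongr
  exact h φ

theorem exists_mem_seminormBounds (A : 𝓢(E, ℂ) →L[ℂ] 𝓢(E, ℂ)) (n : ℕ) :
    ∃ b ∈ seminormBounds E, ∀ φ x, (1 + ‖x‖) ^ n * ‖A φ x‖ ≤ b φ := by
  obtain ⟨s, C, -, hC⟩ := Seminorm.bound_of_continuous (schwartz_withSeminorms ℂ E ℂ)
    (((Finset.Iic (n, 0)).sup fun m => SchwartzMap.seminorm ℂ m.1 m.2).comp A.toLinearMap) (by
      have h : Continuous ((Finset.Iic (n, 0)).sup fun m =>
          SchwartzMap.seminorm ℂ (E := E) (F := ℂ) m.1 m.2 : Seminorm ℂ 𝓢(E, ℂ)) := by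
        exact Seminorm.continuous_finsetSup fun i _ =>
          (schwartz_withSeminorms ℂ E ℂ).continuous_seminorm i
      exact h.comp A.continuous)
  refine ⟨fun φ => 2 ^ n * (C * s.sup (schwartzSeminormFamily ℂ E ℂ) φ),
    ⟨s, 2 ^ n * C, by positivity, fun φ => by rw [mul_assoc]⟩, fun φ x => ?_⟩
  have h1 := SchwartzMap.one_add_le_sup_seminorm_apply (𝕜 := ℂ) (m := (n, 0)) le_rfl le_rfl (A φ) x
  rw [norm_iteratedFDeriv_zero] at h1
  refine h1.trans ?_
  exact mul_le_mul_of_nonneg_left (hC φ) (by positivity)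

end seminormBounds

/-- Powers of x_k are gained by differentiating in the k-th variable before the transform, in the
directions 1 and I. The operator `A` is arbitrary so that these derivatives can be absorbed into it
in the induction. -/
theorem exists_bound_pftFun (k : ι) (n m : ℕ) (A : 𝓢(ι → K, ℂ) →L[ℂ] 𝓢(ι → K, ℂ)) :
    ∃ b ∈ seminormBounds (ι → K), ∀ φ x,
      ‖x k‖ ^ n * ‖Function.update x k 0‖ ^ m * ‖pftFun k (A φ) x‖ ≤ b φ := by
  induction n generalizing A with
  | zero =>
    obtain ⟨b, hb, h⟩ := exists_mem_seminormBounds A (m + (Module.finrank ℝ K + 1))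
    refine ⟨_, smul_mem_seminormBounds
      (c := ∫ y : K, (1 + ‖y‖) ^ (-((Module.finrank ℝ K + 1 : ℕ) : ℝ)))
      (integral_nonneg fun y => by positivity) hb, fun φ x => ?_⟩
    rw [pow_zero, one_mul, Pi.smul_apply, smul_eq_mul, mul_comm _ (b φ)]
    exact norm_pow_mul_norm_pftFun_le k (A φ) (h φ) x
  | succ n ih =>
    obtain ⟨b, hb, h⟩ := ih ((LineDeriv.lineDerivOpCLM ℂ 𝓢(ι → K, ℂ) (Pi.single k 1 : ι → K)).comp A)
    obtain ⟨b', hb', h'⟩ := ih ((LineDeriv.lineDerivOpCLM ℂ 𝓢(ι → K, ℂ) (Pi.single k RCLike.I : ι → K)).comp A)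
    refine ⟨_, add_mem_seminormBounds hb hb', fun φ x => ?_⟩
    refine le_trans ?_ (add_le_add (h φ x) (h' φ x))
    simp only [ContinuousLinearMap.comp_apply, LineDeriv.lineDerivOpCLM_apply,
      pftFun_lineDeriv_single, one_mul, RCLike.mul_re, RCLike.I_re, norm_mul,
      Complex.norm_I, Complex.norm_real, Complex.norm_ofNat, Real.norm_eq_abs,
      abs_of_pos Real.pi_pos]
    have hx : ‖x k‖ ≤ 2 * Real.pi * (|RCLike.re (x k)| + |0 * RCLike.re (x k) -
        RCLike.im (RCLike.I : K) * RCLike.im (x k)|) := by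
      have h1 : ‖x k‖ ≤ |RCLike.re (x k)| + |RCLike.im (RCLike.I : K) * RCLike.im (x k)| := by
        conv_lhs => rw [← RCLike.re_add_im (x k)]
        refine (norm_add_le _ _).trans (add_le_add ?_ ?_)
        · rw [RCLike.norm_ofReal]
        · rcases RCLike.I_mul_I_ax (K := K) with h | h
          · simp [h]
          · have h2 : RCLike.im (RCLike.I : K) = 1 := by
              have := congrArg RCLike.re h
              simp at this
              exact this
            rw [h2, one_mul, norm_mul, RCLike.norm_ofReal]
            have : ‖(RCLike.I : K)‖ ≤ 1 := by
              have := congrArg norm h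
              rw [norm_mul, norm_neg, norm_one] at this
              nlinarith [norm_nonneg (RCLike.I : K)]
            nlinarith [abs_nonneg (RCLike.im (x k))]
      have hpi : 1 ≤ 2 * Real.pi := by have := Real.pi_gt_three; linarith
      rw [zero_mul, zero_sub, abs_neg]
      refine h1.trans (le_mul_of_one_le_left (by positivity) hpi)
    calc ‖x k‖ ^ (n + 1) * ‖Function.update x k 0‖ ^ m * ‖pftFun k (A φ) x‖
        = ‖x k‖ ^ n * ‖Function.update x k 0‖ ^ m * (‖x k‖ * ‖pftFun k (A φ) x‖) := by ring
      _ ≤ ‖x k‖ ^ n * ‖Function.update x k 0‖ ^ m * ((2 * Real.pi * (|RCLike.re (x k)| +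
          |0 * RCLike.re (x k) - RCLike.im (RCLike.I : K) * RCLike.im (x k)|)) *
            ‖pftFun k (A φ) x‖) := by gcongr
      _ = _ := by ring

/-- The closed family criterion with φ itself as the parameter and seminorms of φ as the bounds. It
yields both the Schwartz property and the continuity of the transform. -/
theorem contDiff_pftFun_and_bound (k : ι) :
    (∀ φ : 𝓢(ι → K, ℂ), ContDiff ℝ ∞ (pftFun k φ)) ∧ ∀ i n : ℕ, ∃ b ∈ seminormBounds (ι → K),
      ∀ (φ : 𝓢(ι → K, ℂ)) x, ‖x‖ ^ i * ‖iteratedFDeriv ℝ n (pftFun k φ) x‖ ≤ b φ := by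
  refine decay_of_closedFamily (P := 𝓢(ι → K, ℂ))
    (S := {T | ∃ A : 𝓢(ι → K, ℂ) →L[ℂ] 𝓢(ι → K, ℂ), T = fun φ => pftFun k (A φ)})
    (fun b hb b' hb' => add_mem_seminormBounds hb hb')
    (fun c hc b hb => smul_mem_seminormBounds hc hb)
    ⟨0, ∅, 0, le_rfl, fun φ => by simp⟩ ?_ ?_ ?_ (fun φ => pftFun k φ)
    (AddSubmonoid.subset_closure ⟨ContinuousLinearMap.id ℂ _, rfl⟩)
  · rintro _ ⟨A, rfl⟩ φ
    exact differentiable_pftFun k (A φ)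
  · rintro _ ⟨A, rfl⟩ m
    have : (fun (φ : 𝓢(ι → K, ℂ)) x => fderiv ℝ (pftFun k (A φ)) x m) =
        (fun φ => pftFun k (((LineDeriv.lineDerivOpCLM ℂ 𝓢(ι → K, ℂ)
          (Function.update m k 0)).comp A) φ)) +
        fun φ => pftFun k (((mulReCoord k (m k)).comp A) φ) := by
      ext φ x
      exact fderiv_pftFun k (A φ) x m
    rw [this]
    exact add_mem (AddSubmonoid.subset_closure ⟨_, rfl⟩) (AddSubmonoid.subset_closure ⟨_, rfl⟩)
  · rintro _ ⟨A, rfl⟩ n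
    obtain ⟨b, hb, h⟩ := exists_bound_pftFun k n 0 A
    obtain ⟨b', hb', h'⟩ := exists_bound_pftFun k 0 n A
    refine ⟨_, add_mem_seminormBounds hb hb', fun φ x => ?_⟩
    refine le_trans ?_ (add_le_add (h φ x) (h' φ x))
    rw [pow_zero, pow_zero, mul_one, one_mul, ← add_mul]
    gcongr
    rcases max_cases ‖x k‖ ‖Function.update x k 0‖ with ⟨h1, -⟩ | ⟨h1, -⟩
    · have := norm_le_max_update k x
      rw [h1] at this
      exact (pow_le_pow_left₀ (norm_nonneg _) this n).trans (le_add_of_nonneg_right (by positivity))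
    · have := norm_le_max_update k x
      rw [h1] at this
      exact (pow_le_pow_left₀ (norm_nonneg _) this n).trans (le_add_of_nonneg_left (by positivity))

/-- The Fourier transform in the coordinate `k`. -/
def pft (k : ι) : 𝓢(ι → K, ℂ) →L[ℂ] 𝓢(ι → K, ℂ) :=
  SchwartzMap.mkCLM (fun φ => pftFun k φ) (pftFun_add k) (pftFun_smul k)
    (contDiff_pftFun_and_bound k).1 (by
      rintro ⟨i, n⟩
      obtain ⟨b, ⟨s, C, hC, h⟩, h'⟩ := (contDiff_pftFun_and_bound (K := K) k).2 i n
      exact ⟨s, C, hC, fun φ x => (h' φ x).trans (h φ)⟩)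

theorem pft_apply (k : ι) (φ : 𝓢(ι → K, ℂ)) (x : ι → K) : pft k φ x = pftFun k φ x := rfl

end PartialFourier

/-! ### Properties of the partial Fourier transform -/

noncomputable section PartialFourierProperties

set_option linter.unusedSectionVars false

open scoped ContDiff LineDeriv FourierTransform
open MeasureTheory Set

variable {ι K : Type*} [Fintype ι] [DecidableEq ι] [RCLike K]

theorem integral_comp_conj (g : K → ℂ) : ∫ y : K, g (starRingEnd K y) = ∫ y : K, g y :=
  (RCLike.conjLIE (K := K)).measurePreserving.integral_comp
    (RCLike.conjLIE (K := K)).toHomeomorph.measurableEmbedding g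

theorem integral_comp_unit_mul {u : K} (hu : ‖u‖ = 1) (g : K → ℂ) :
    ∫ y : K, g (u * y) = ∫ y : K, g y := by
  let li : K →ₗᵢ[ℝ] K :=
    { toLinearMap := (ContinuousLinearMap.mul ℝ K u : K →ₗ[ℝ] K)
      norm_map' := fun y => by simp [hu] }
  let e : K ≃ₗᵢ[ℝ] K := li.toLinearIsometryEquiv rfl
  exact e.measurePreserving.integral_comp e.toHomeomorph.measurableEmbedding g

theorem integral_comp_mul (s : K) (g : K → ℂ) (hs : s ≠ 0) :
    ∫ y : K, g (s * y) = ((‖s‖ ^ Module.finrank ℝ K)⁻¹ : ℝ) * ∫ y : K, g y := by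
  have hs' : ‖s‖ ≠ 0 := norm_ne_zero_iff.2 hs
  have hu : ‖s / (‖s‖ : K)‖ = 1 := by simp [hs']
  rw [← integral_comp_unit_mul hu g]
  have := Measure.integral_comp_smul (volume : Measure K)
    (fun y => g (s / (‖s‖ : K) * y)) ‖s‖
  rw [abs_of_pos (by positivity)] at this
  rw [← smul_eq_mul (_ : ℂ), Complex.coe_smul, ← this]
  congr 1
  ext y
  congr 1
  rw [RCLike.real_smul_eq_coe_mul]
  have : (‖s‖ : K) ≠ 0 := by simpa using hs
  field_simp

theorem SchwartzMap.fourier_fourier (φ : 𝓢(K, ℂ)) (x : K) : 𝓕 (𝓕 φ) x = φ (-x) := by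
  have h : (𝓕⁻ (𝓕 φ) : 𝓢(K, ℂ)) = φ := FourierTransform.fourierInv_fourier_eq φ
  conv_rhs => rw [← h]
  rw [SchwartzMap.fourierInv_coe, Real.fourierInv_eq_fourier_neg, neg_neg, SchwartzMap.fourier_coe]

theorem SchwartzMap.fourier_apply_eq_integral (φ : 𝓢(K, ℂ)) (x : K) :
    𝓕 φ x = ∫ y : K, phase (-inner ℝ y x) * φ y := by
  rw [SchwartzMap.fourier_coe, Real.fourier_eq']
  refine integral_congr_ae (.of_forall fun y => ?_)
  simp only [phase, smul_eq_mul]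
  congr 3
  push_cast
  ring

theorem pft_pft (k : ι) (φ : 𝓢(ι → K, ℂ)) (x : ι → K) :
    pft k (pft k φ) x = φ (Function.update x k (-x k)) := by
  rw [pft_apply, pftFun, ← SchwartzMap.slice_apply, ← SchwartzMap.fourier_fourier,
    SchwartzMap.fourier_apply_eq_integral, ← integral_comp_conj]
  refine integral_congr_ae (.of_forall fun y => ?_)
  have : inner ℝ y (x k) = RCLike.re (starRingEnd K y * x k) := by
    change RCLike.re (inner K y (x k)) = _
    rw [RCLike.inner_apply, mul_comm]
  simp only [pft_apply, pftFun_eq_fourier, SchwartzMap.slice_update, Function.update_self, this,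
    RingHomCompTriple.comp_apply, RingHom.id_apply]

/-- The square of the transform is a reflection, so its inverse is its cube. -/
theorem pft_pft_pft_pft (k : ι) (φ : 𝓢(ι → K, ℂ)) : pft k (pft k (pft k (pft k φ))) = φ := by
  ext x
  simp [pft_pft]

theorem norm_update_mul_le (x : ι → K) (i j : ι) (h : i ≠ j) (s y : K) :
    max ‖s‖ ‖y‖ ≤ ‖Function.update (Function.update x i s) j y‖ := by
  refine max_le ?_ (norm_le_norm_update j _ y)
  simpa [h] using norm_le_pi_norm (Function.update (Function.update x i s) j y) i

theorem integrable_update_update (φ : 𝓢(ι → K, ℂ)) (x : ι → K) {i j : ι} (h : i ≠ j)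
    {g : K × K → ℂ} (hg : Continuous g) (hg1 : ∀ p, ‖g p‖ ≤ 1) :
    Integrable (fun p : K × K => g p * φ (Function.update (Function.update x i p.1) j p.2)) := by
  obtain ⟨C, hC0, hC⟩ := φ.one_add_norm_pow_mul_norm_le
    ((Module.finrank ℝ K + 1) + (Module.finrank ℝ K + 1))
  have hint := (integrable_one_add_norm_pow_neg (K := K)).mul_prod
    (integrable_one_add_norm_pow_neg (K := K))
  refine (hint.const_mul C).mono' ?_ (.of_forall fun p => ?_)
  · have h1 : Continuous fun p : K × K => Function.update (Function.update x i p.1) j p.2 :=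
      Continuous.update (A := fun _ : ι => K)
        (Continuous.update (A := fun _ : ι => K) continuous_const i continuous_fst) j continuous_snd
    exact (hg.mul (φ.continuous.comp h1)).aestronglyMeasurable
  · rw [norm_mul]
    set u := Function.update (Function.update x i p.1) j p.2
    have h1 : ‖p.1‖ ≤ ‖u‖ := (le_max_left _ _).trans (norm_update_mul_le x i j h p.1 p.2)
    have h2 : ‖p.2‖ ≤ ‖u‖ := (le_max_right _ _).trans (norm_update_mul_le x i j h p.1 p.2)
    have h3 := hC u
    have hp1 : 0 < (1 + ‖p.1‖) ^ (Module.finrank ℝ K + 1) := by positivity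
    have hp2 : 0 < (1 + ‖p.2‖) ^ (Module.finrank ℝ K + 1) := by positivity
    rw [Real.rpow_neg (by positivity), Real.rpow_natCast, Real.rpow_neg (by positivity),
      Real.rpow_natCast, ← mul_inv, ← div_eq_mul_inv, le_div_iff₀ (mul_pos hp1 hp2)]
    refine le_trans ?_ h3
    rw [pow_add (1 + ‖u‖)]
    calc ‖g p‖ * ‖φ u‖ * ((1 + ‖p.1‖) ^ (Module.finrank ℝ K + 1) *
          (1 + ‖p.2‖) ^ (Module.finrank ℝ K + 1))
        ≤ 1 * ‖φ u‖ * ((1 + ‖u‖) ^ (Module.finrank ℝ K + 1) *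
          (1 + ‖u‖) ^ (Module.finrank ℝ K + 1)) := by
          gcongr
          exact hg1 p
      _ = _ := by ring

theorem pft_comm (i j : ι) (φ : 𝓢(ι → K, ℂ)) : pft i (pft j φ) = pft j (pft i φ) := by
  rcases eq_or_ne i j with rfl | h
  · rfl
  ext x
  simp only [pft_apply, pftFun, ← integral_const_mul]
  rw [integral_integral_swap]
  · refine integral_congr_ae (.of_forall fun y => integral_congr_ae (.of_forall fun z => ?_))
    simp only [Function.update_of_ne h, Function.update_of_ne h.symm]
    rw [Function.update_comm h]
    ring
  · have := integrable_update_update φ x h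
      (g := fun p => phase (-RCLike.re (p.1 * x i)) * phase (-RCLike.re (p.2 * x j))) ?_ ?_
    · refine this.congr (.of_forall fun p => ?_)
      simp only [Function.uncurry, Function.update_of_ne h.symm, mul_assoc]
    · refine (continuous_phase.comp ?_).mul (continuous_phase.comp ?_)
      · exact (RCLike.continuous_re.comp (continuous_fst.mul continuous_const)).neg
      · exact (RCLike.continuous_re.comp (continuous_snd.mul continuous_const)).neg
    · intro p
      simp [norm_phase]

/-- Covariance of the partial Fourier transform under monomial changes of variables. -/
theorem pftFun_comp {k k' : ι} {s : K} (hs : s ≠ 0) {A : (ι → K) → ι → K} {x x' : ι → K}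
    (hA : ∀ y, A (Function.update x k y) = Function.update x' k' (s * y)) (hx : s * x' k' = x k)
    (φ : (ι → K) → ℂ) :
    pftFun k (fun x => φ (A x)) x =
      ((‖s‖ ^ Module.finrank ℝ K)⁻¹ : ℝ) * pftFun k' φ x' := by
  rw [pftFun, pftFun, ← integral_comp_mul s _ hs]
  refine integral_congr_ae (.of_forall fun y => ?_)
  simp only [hA, ← hx]
  congr 4
  ring

theorem fderiv_apply_single_of_update {φ : 𝓢(ι → K, ℂ)} {k j : ι} {h : (ι → K) → K} {x : ι → K}
    (hh : ∀ y, h (Function.update x k y) = h x) :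
    pftFun k (fun x => fderiv ℝ φ x (Pi.single j (h x))) x =
      pftFun k (∂_{(Pi.single j (h x) : ι → K)} φ : 𝓢(ι → K, ℂ)) x :=
  pftFun_congr fun y => by rw [hh, SchwartzMap.lineDerivOp_apply_eq_fderiv]

theorem pftFun_fderiv_single_self {φ : 𝓢(ι → K, ℂ)} {k : ι} {h : (ι → K) → K} {x : ι → K}
    (hh : ∀ y, h (Function.update x k y) = h x) :
    pftFun k (fun x => fderiv ℝ φ x (Pi.single k (h x))) x =
      (2 * Real.pi * Complex.I) * RCLike.re (h x * x k) * pftFun k φ x := by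
  rw [fderiv_apply_single_of_update hh, pftFun_lineDeriv_single]

theorem pftFun_fderiv_single_of_ne {φ : 𝓢(ι → K, ℂ)} {k j : ι} (hkj : j ≠ k) {h : (ι → K) → K}
    {x : ι → K} (hh : ∀ y, h (Function.update x k y) = h x) :
    pftFun k (fun x => fderiv ℝ φ x (Pi.single j (h x))) x =
      fderiv ℝ (pft k φ) x (Pi.single j (h x)) := by
  rw [fderiv_apply_single_of_update hh]
  change _ = fderiv ℝ (pftFun k φ) x _
  rw [fderiv_pftFun, Pi.single_eq_of_ne hkj.symm]
  have h0 : mulReCoord k (0 : K) φ = 0 := by ext x; simp [mulReCoord_apply]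
  have h1 : Function.update (Pi.single j (h x) : ι → K) k 0 = Pi.single j (h x) := by
    rw [Function.update_eq_self_iff, Pi.single_eq_of_ne hkj.symm]
  rw [h0, h1]
  simp [pftFun]

/-- The Fourier transform in the coordinates of a list. -/
def pftList : List ι → 𝓢(ι → K, ℂ) →L[ℂ] 𝓢(ι → K, ℂ)
  | [] => ContinuousLinearMap.id ℂ _
  | k :: l => (pft k).comp (pftList l)

theorem pftList_cons (k : ι) (l : List ι) (φ : 𝓢(ι → K, ℂ)) (x : ι → K) :
    pftList (k :: l) φ x = pftFun k (pftList l φ) x := rfl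

theorem exists_pftList_inverse (l : List ι) : ∃ V : 𝓢(ι → K, ℂ) →L[ℂ] 𝓢(ι → K, ℂ),
    (∀ φ, pftList l (V φ) = φ) ∧ ∀ φ, V (pftList l φ) = φ := by
  induction l with
  | nil => exact ⟨ContinuousLinearMap.id ℂ _, fun φ => rfl, fun φ => rfl⟩
  | cons k l ih =>
    obtain ⟨V, h1, h2⟩ := ih
    refine ⟨V.comp ((pft k).comp ((pft k).comp (pft k))), fun φ => ?_, fun φ => ?_⟩
    · simp only [pftList, ContinuousLinearMap.comp_apply, h1, pft_pft_pft_pft]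
    · simp only [pftList, ContinuousLinearMap.comp_apply, pft_pft_pft_pft, h2]

theorem pftList_perm {l l' : List ι} (h : l.Perm l') (φ : 𝓢(ι → K, ℂ)) :
    pftList l φ = pftList l' φ := by
  induction h with
  | nil => rfl
  | cons k _ ih => simp only [pftList, ContinuousLinearMap.comp_apply, ih]
  | swap k k' l => simp only [pftList, ContinuousLinearMap.comp_apply, pft_comm k k']
  | trans _ _ h1 h2 => exact h1.trans h2

/-- The coefficient h does not involve the transformed variables and passes through the integrals:
the vector field h ∂_j becomes a multiplication when x_j is transformed, and stays a vector field
otherwise. -/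
theorem pftList_fderiv_single {l : List ι} (hl : l.Nodup) {j : ι} {h : (ι → K) → K}
    (hh : ∀ k ∈ l, ∀ x y, h (Function.update x k y) = h x) {φ ψ : 𝓢(ι → K, ℂ)}
    (hψ : ∀ x, ψ x = fderiv ℝ φ x (Pi.single j (h x))) (x : ι → K) :
    pftList l ψ x = if j ∈ l then (2 * Real.pi * Complex.I) * RCLike.re (h x * x j) * pftList l φ x
      else fderiv ℝ (pftList l φ) x (Pi.single j (h x)) := by
  induction l generalizing x with
  | nil => exact hψ x
  | cons k l ih =>
    have ih' := fun x => ih (List.nodup_cons.1 hl).2 (fun k hk => hh k (List.mem_cons_of_mem _ hk)) x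
    have hk := hh k List.mem_cons_self
    rw [pftList_cons, pftList_cons, show ⇑(pftList l ψ) = _ from funext ih']
    have hkl := (List.nodup_cons.1 hl).1
    by_cases hj : j ∈ l
    · have hjk : j ≠ k := fun h => hkl (h ▸ hj)
      simp only [hj, if_true, List.mem_cons, or_true]
      exact pftFun_mul (g := fun x => (2 * Real.pi * Complex.I) * RCLike.re (h x * x j))
        fun y => by simp only [hk, Function.update_of_ne hjk]
    · rcases eq_or_ne j k with rfl | hjk
      · simp only [hj, if_false, List.mem_cons, or_false, if_true]
        exact pftFun_fderiv_single_self (hk x)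
      · simp only [hj, if_false, List.mem_cons, hjk, or_false]
        exact pftFun_fderiv_single_of_ne hjk (hk x)

/-- The pairing Re(y x_k) forces the dual variable to scale inversely, and the substitution in each
integral contributes a Jacobian. -/
theorem pftList_comp_diag {l : List ι} (hl : l.Nodup) {s : ι → K} (hs : ∀ k, s k ≠ 0)
    {φ ψ : 𝓢(ι → K, ℂ)} (hψ : ∀ x, ψ x = φ (s * x)) (x : ι → K) :
    pftList l ψ x = (((l.map fun k => ‖s k‖).prod ^ Module.finrank ℝ K)⁻¹ : ℝ) *
      pftList l φ ((fun k => if k ∈ l then (s k)⁻¹ else s k) * x) := by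
  induction l generalizing x with
  | nil => simpa [pftList] using hψ x
  | cons k l ih =>
    have hkl := (List.nodup_cons.1 hl).1
    have ih' := fun x => ih (List.nodup_cons.1 hl).2 x
    rw [pftList_cons, show ⇑(pftList l ψ) = _ from funext ih', pftFun_mul fun y => rfl,
      pftFun_comp (k' := k) (x' := (fun j => if j ∈ k :: l then (s j)⁻¹ else s j) * x) (hs k)
      (A := fun x => (fun k => if k ∈ l then (s k)⁻¹ else s k) * x), pftList_cons, ← mul_assoc]
    · simp only [List.map_cons, List.prod_cons, mul_pow, mul_inv]
      push_cast
      ring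
    · intro y
      ext j
      by_cases hj : j = k
      · subst hj
        simp [hkl]
      · simp [hj]
    · simp [hs k]

theorem pftList_comp_perm (σ : Equiv.Perm ι) {l : List ι}
    {φ ψ : 𝓢(ι → K, ℂ)} (hψ : ∀ x, ψ x = φ (x ∘ σ)) (x : ι → K) :
    pftList l ψ x = pftList (l.map σ.symm) φ (x ∘ σ) := by
  induction l generalizing x with
  | nil => exact hψ x
  | cons k l ih =>
    rw [pftList_cons, show ⇑(pftList l ψ) = _ from funext ih, List.map_cons, pftList_cons,
      pftFun_comp (k' := σ.symm k) (s := 1) (x' := x ∘ σ) one_ne_zero (A := fun x => x ∘ σ)]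
    · simp
    · intro y
      rw [one_mul, Function.update_comp_equiv]
    · simp

end PartialFourierProperties

/-! ### Invariance under a hyperbolic torus implies invariance under the Weyl element -/

noncomputable section HyperbolicTorus

set_option linter.unusedSectionVars false

open scoped ContDiff LineDeriv FourierTransform
open MeasureTheory Set

variable {ι K : Type*} [Fintype ι] [DecidableEq ι] [RCLike K]

/-- A Schwartz function composed with an invertible scaling of the coordinates in `J`. -/
theorem SchwartzMap.exists_comp_scaleOn (φ : 𝓢(ι → K, ℂ)) (J : Finset ι) {a : K} (ha : a ≠ 0) :
    ∃ ψ : 𝓢(ι → K, ℂ), ∀ x, ψ x = φ (scaleOn J a x) := by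
  let e : (ι → K) ≃L[ℝ] (ι → K) := ContinuousLinearEquiv.equivOfInverse (scaleOn J a) (scaleOn J a⁻¹)
    (fun x => by rw [scaleOn_scaleOn, inv_mul_cancel₀ ha, scaleOn_one])
    (fun x => by rw [scaleOn_scaleOn, mul_inv_cancel₀ ha, scaleOn_one])
  exact ⟨SchwartzMap.compCLMOfContinuousLinearEquiv ℂ e φ, fun x => rfl⟩

/-- The functional `T` is homogeneous under the scalings of the coordinates in `J`, of the same
degree as the integration over a line. -/
def IsHomogeneousOn (J : Finset ι) (T : 𝓢(ι → K, ℂ) →L[ℂ] ℂ) : Prop :=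
  ∀ a : K, a ≠ 0 → ∀ φ ψ : 𝓢(ι → K, ℂ), (∀ x, ψ x = φ (scaleOn J a x)) →
    T ψ = ((‖a‖ ^ Module.finrank ℝ K)⁻¹ : ℝ) * T φ

theorem hasDerivAt_inv_norm_pow (w : K) (d : ℕ) :
    HasDerivAt (fun t : ℝ => (‖1 + (t : K) * w‖ ^ d)⁻¹) (-(d * RCLike.re w)) 0 := by
  have h0 : HasDerivAt (fun t : ℝ => 1 + (t : K) * w) w 0 := by
    have : HasDerivAt (fun t : ℝ => (t : K)) 1 0 := by
      simpa using (RCLike.ofRealCLM (K := K)).hasDerivAt (x := 0)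
    simpa using (this.mul_const w).const_add 1
  have h1 := h0.norm_sq
  have h2 : HasDerivAt (fun t : ℝ => ‖1 + (t : K) * w‖) (RCLike.re w) 0 := by
    have h3 := h1.sqrt (by simp)
    have hin : inner ℝ (1 : K) w = RCLike.re w := by
      change RCLike.re (inner K (1 : K) w) = _
      rw [RCLike.inner_apply]; simp
    simp only [Real.sqrt_sq (norm_nonneg _)] at h3
    refine h3.congr_deriv ?_
    simp [hin]
  refine ((h2.fun_pow d).fun_inv (by simp)).congr_deriv ?_
  simp

/-- Homogeneity differentiated at a = 1 along a = 1 + t w. As only |a| enters, only Re w survives: w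
= 1 gives Euler's equation, and w = I gives invariance under infinitesimal rotations. -/
theorem IsHomogeneousOn.apply_fderiv_partOn {J : Finset ι} {T : 𝓢(ι → K, ℂ) →L[ℂ] ℂ}
    (hT : IsHomogeneousOn J T) (w : K) {φ ψ : 𝓢(ι → K, ℂ)}
    (hψ : ∀ x, ψ x = fderiv ℝ φ x (partOn J w x)) :
    T ψ = -(Module.finrank ℝ K * RCLike.re w : ℝ) * T φ := by
  -- The scaling may be singular for some t; there the choice is irrelevant, because only t near 0
  -- matters.
  have hex : ∀ t : ℝ, ∃ χ : 𝓢(ι → K, ℂ), 1 + (t : K) * w ≠ 0 →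
      ∀ x, χ x = φ (scaleOn J (1 + (t : K) * w) x) := fun t => by
    by_cases h : 1 + (t : K) * w = 0
    · exact ⟨0, fun h' => absurd h h'⟩
    · obtain ⟨χ, hχ⟩ := φ.exists_comp_scaleOn J h
      exact ⟨χ, fun _ => hχ⟩
  choose Φ hΦ using hex
  have hne : ∀ᶠ t : ℝ in nhds 0, 1 + (t : K) * w ≠ 0 := by
    have : ContinuousAt (fun t : ℝ => 1 + (t : K) * w) 0 := by
      have h : Continuous fun t : ℝ => (t : K) := RCLike.continuous_ofReal
      fun_prop
    exact this.eventually_ne (by simp)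
  have h1 := SchwartzMap.hasDerivAt_apply_comp_linear T (partOn J w) (φ := φ) (ψ := ψ) (Φ := Φ)
    (by
      filter_upwards [hne] with t ht x
      rw [hΦ t ht]
      congr 1
      ext k
      simp only [scaleOn_apply, partOn_apply, Pi.add_apply, Pi.smul_apply]
      split_ifs
      · rw [RCLike.real_smul_eq_coe_mul]; ring
      · simp) hψ
  have h2 : HasDerivAt (fun t => T (Φ t)) (-(Module.finrank ℝ K * RCLike.re w : ℝ) * T φ) 0 := by
    have h3 := ((hasDerivAt_inv_norm_pow w (Module.finrank ℝ K)).ofReal_comp).mul_const (T φ)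
    rw [Complex.ofReal_neg] at h3
    refine h3.congr_of_eventuallyEq ?_
    filter_upwards [hne] with t ht
    exact hT _ ht _ _ (hΦ t ht)
  exact h1.unique h2

theorem exists_norm_comp_scaleOn_le (φ : 𝓢(ι → K, ℂ)) (J : Finset ι) {x : ι → K}
    (hx : partOn J (1 : K) x ≠ 0) : ∃ D : ℝ, 0 ≤ D ∧
      ∀ a : K, ‖φ (scaleOn J a x)‖ ≤ D * (1 + ‖a‖) ^ (-((Module.finrank ℝ K + 1 : ℕ) : ℝ)) := by
  obtain ⟨C, hC0, hC⟩ := φ.one_add_norm_pow_mul_norm_le (Module.finrank ℝ K + 1)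
  set m := min 1 ‖partOn J (1 : K) x‖ with hm'
  have hm : 0 < m := lt_min one_pos (norm_pos_iff.2 hx)
  refine ⟨C / m ^ (Module.finrank ℝ K + 1), by positivity, fun a => ?_⟩
  rw [Real.rpow_neg (by positivity), Real.rpow_natCast, ← div_eq_mul_inv, div_div,
    le_div_iff₀ (by positivity), mul_comm, ← mul_pow]
  refine le_trans ?_ (hC (scaleOn J a x))
  gcongr
  have h := norm_mul_norm_partOn_le J a x
  have h1 : m ≤ 1 := min_le_left _ _
  have h2 : m ≤ ‖partOn J (1 : K) x‖ := min_le_right _ _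
  nlinarith [mul_le_mul_of_nonneg_left h2 (norm_nonneg a)]

theorem continuous_comp_scaleOn (φ : 𝓢(ι → K, ℂ)) (J : Finset ι) (x : ι → K) :
    Continuous fun a : K => φ (scaleOn J a x) :=
  φ.continuous.comp ((continuous_scaleOn J).clm_apply continuous_const)

theorem integrable_comp_scaleOn (φ : 𝓢(ι → K, ℂ)) (J : Finset ι) {x : ι → K}
    (hx : partOn J (1 : K) x ≠ 0) : Integrable fun a : K => φ (scaleOn J a x) := by
  obtain ⟨D, -, hD⟩ := exists_norm_comp_scaleOn_le φ J hx
  exact (integrable_one_add_norm_pow_neg.const_mul D).mono'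
    (continuous_comp_scaleOn φ J x).aestronglyMeasurable (.of_forall hD)

theorem integral_integral_comp_scaleOn (φ : 𝓢(ι → K, ℂ)) (J : Finset ι) {x : ι → K}
    (hx : partOn J (1 : K) x ≠ 0) (b : ℝ) {c : ℝ → K} (hc : Continuous c) (hc1 : ∀ s, ‖c s‖ = 1) :
    ∫ a : K, ∫ s in Ioc 0 b, φ (scaleOn J (c s) (scaleOn J a x)) =
      ∫ _ in Ioc 0 b, ∫ a : K, φ (scaleOn J a x) := by
  obtain ⟨D, -, hD⟩ := exists_norm_comp_scaleOn_le φ J hx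
  rw [integral_integral_swap]
  · refine integral_congr_ae (.of_forall fun s => ?_)
    simp only [scaleOn_scaleOn]
    exact integral_comp_unit_mul (hc1 s) fun a => φ (scaleOn J a x)
  · have h1 : Integrable (fun _ : ℝ => (1 : ℝ)) (volume.restrict (Ioc 0 b)) := by simp
    refine ((integrable_one_add_norm_pow_neg.const_mul D).mul_prod h1).mono' ?_
      (.of_forall fun p => ?_)
    · refine Continuous.aestronglyMeasurable ?_
      simp only [Function.uncurry_def, scaleOn_scaleOn]
      exact (continuous_comp_scaleOn φ J x).comp ((hc.comp continuous_snd).mul continuous_fst)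
    · simp only [Function.uncurry, scaleOn_scaleOn, mul_one]
      refine (hD _).trans ?_
      rw [norm_mul, hc1, one_mul]

/-- Integration along the rays of a rotation invariant function. -/
theorem radialMoment_eq_zero (φ : 𝓢(ι → K, ℂ)) (J : Finset ι) {x : ι → K}
    (hφ : ∀ u : K, ‖u‖ = 1 → ∀ x, φ (scaleOn J u x) = φ x)
    (h : ∫ a : K, φ (scaleOn J a x) = 0) :
    radialMoment J (Module.finrank ℝ K - 1) φ x = 0 := by
  have h1 : ∀ a : K, φ (scaleOn J a x) = φ (scaleOn J ((‖a‖ : ℝ) : K) x) := fun a => by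
    rcases eq_or_ne a 0 with rfl | ha
    · simp
    · have hn : (‖a‖ : K) ≠ 0 := by simpa using ha
      rw [← hφ (a / (‖a‖ : K)) (by simp [ha]) (scaleOn J (‖a‖ : K) x), scaleOn_scaleOn, div_mul_cancel₀ _ hn]
  rw [show (fun a => φ (scaleOn J a x)) = _ from funext h1] at h
  -- Polar coordinates in `K` produce the radial weight of exponent dim - 1.
  have h2 := integral_fun_norm_addHaar (volume : Measure K) fun r : ℝ => φ (scaleOn J (r : K) x)
  rw [h2] at h
  have hd : Module.finrank ℝ K ≠ 0 := Module.finrank_pos.ne'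
  have hb : (volume : Measure K).real (Metric.ball 0 1) ≠ 0 := by
    rw [Measure.real, ENNReal.toReal_ne_zero]
    exact ⟨(Metric.measure_ball_pos _ _ one_pos).ne', measure_ball_lt_top.ne⟩
  simpa [hd, hb, radialMoment] using h

/-- In the real case the unit scalars are ±1, and the average is φ(x) + φ(-x) in the coordinates of
`J`. -/
theorem exists_rotation_average_of_I_eq_zero (hI : (RCLike.I : K) = 0) {J : Finset ι}
    {T : 𝓢(ι → K, ℂ) →L[ℂ] ℂ} (hT : IsHomogeneousOn J T) (φ : 𝓢(ι → K, ℂ)) :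
    ∃ (φ' : 𝓢(ι → K, ℂ)) (r : ℂ), r ≠ 0 ∧ T φ' = r * T φ ∧
      (∀ u : K, ‖u‖ = 1 → ∀ x, φ' (scaleOn J u x) = φ' x) ∧
      ∀ x, partOn J (1 : K) x ≠ 0 → ∫ a : K, φ (scaleOn J a x) = 0 →
        ∫ a : K, φ' (scaleOn J a x) = 0 := by
  obtain ⟨χ, hχ⟩ := φ.exists_comp_scaleOn J (a := (-1 : K)) (by simp)
  refine ⟨φ + χ, 2, two_ne_zero, ?_, fun u hu x => ?_, fun x hx h => ?_⟩
  · rw [map_add, hT _ (by simp) _ _ hχ]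
    simp [two_mul]
  · have hu' : u = 1 ∨ u = -1 := by
      have h1 : u = ((RCLike.re u : ℝ) : K) := by
        conv_lhs => rw [← RCLike.re_add_im u, hI, mul_zero, add_zero]
      rw [h1, RCLike.norm_ofReal] at hu
      rcases eq_or_eq_neg_of_abs_eq hu with h2 | h2
      · left; rw [h1, h2]; simp
      · right; rw [h1, h2]; simp
    rcases hu' with rfl | rfl
    · rw [scaleOn_one]
    · simp only [_root_.add_apply, hχ, scaleOn_scaleOn]
      rw [neg_mul_neg, one_mul, scaleOn_one, add_comm]
  · simp only [_root_.add_apply, hχ, scaleOn_scaleOn]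
    rw [integral_add (integrable_comp_scaleOn φ J hx), h, integral_comp_unit_mul (by simp)
      fun a => φ (scaleOn J a x), h, add_zero]
    simpa only [hχ, scaleOn_scaleOn] using integrable_comp_scaleOn χ J hx

/-- The point of the unit circle of `K` at a given angle. -/
def circlePoint (K : Type*) [RCLike K] (θ : ℝ) : K := ((Real.cos θ : ℝ) : K) + ((Real.sin θ : ℝ) : K) * RCLike.I

/-! ### The unit circle when `K` is complex, and averages over it. -/

section circlePoint

variable (hI : RCLike.im (RCLike.I : K) = 1)

include hI

theorem I_mul_I_of_im_I : (RCLike.I : K) * RCLike.I = -1 := by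
  refine (RCLike.I_mul_I (K := K)).resolve_left fun h => ?_
  rw [h] at hI
  simp at hI

theorem norm_circlePoint (θ : ℝ) : ‖circlePoint K θ‖ = 1 := by
  have h : ‖circlePoint K θ‖ ^ 2 = 1 := by
    rw [← RCLike.normSq_eq_def', RCLike.normSq_apply]
    simp [circlePoint, hI, ← pow_two]
  exact (pow_eq_one_iff_of_nonneg (norm_nonneg _) two_ne_zero).1 h

theorem circlePoint_add (θ α : ℝ) :
    circlePoint K (θ + α) = circlePoint K θ * circlePoint K α := by
  simp only [circlePoint, Real.cos_add, Real.sin_add]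
  push_cast
  linear_combination (-(Real.sin θ : K) * (Real.sin α : K)) * I_mul_I_of_im_I hI

theorem hasDerivAt_circlePoint (θ : ℝ) :
    HasDerivAt (circlePoint K) (circlePoint K θ * RCLike.I) θ := by
  have h1 := ((RCLike.ofRealCLM (K := K)).hasFDerivAt.comp_hasDerivAt θ (Real.hasDerivAt_cos θ)).add
    (((RCLike.ofRealCLM (K := K)).hasFDerivAt.comp_hasDerivAt θ (Real.hasDerivAt_sin θ)).mul_const
      (RCLike.I : K))
  refine h1.congr_deriv ?_
  simp only [circlePoint, RCLike.ofRealCLM_apply, RCLike.ofReal_neg]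
  linear_combination (-(Real.sin θ : K)) * I_mul_I_of_im_I hI

theorem exists_circlePoint_eq {u : K} (hu : ‖u‖ = 1) : ∃ α, circlePoint K α = u := by
  set w : ℂ := ⟨RCLike.re u, RCLike.im u⟩ with hw
  have hw1 : ‖w‖ = 1 := by
    rw [← hu, ← sq_eq_sq₀ (norm_nonneg _) (norm_nonneg _), ← RCLike.normSq_eq_def' u,
      ← Complex.normSq_eq_norm_sq, RCLike.normSq_apply, Complex.normSq_apply]
  have h1 := Complex.norm_mul_cos_arg w
  have h2 := Complex.norm_mul_sin_arg w
  rw [hw1, one_mul] at h1 h2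
  refine ⟨w.arg, ?_⟩
  rw [circlePoint, h1, h2]
  exact RCLike.re_add_im u

/-- The average of φ over the circle differs from 2πφ by the rotational derivative of a Schwartz
function, namely the integral of φ over the circle with weight s. Homogeneity annihilates such
derivatives because re I = 0, so `T` never has to be moved under an integral. -/
theorem exists_rotation_average_of_im_I_eq_one {J : Finset ι} {T : 𝓢(ι → K, ℂ) →L[ℂ] ℂ}
    (hT : IsHomogeneousOn J T) (φ : 𝓢(ι → K, ℂ)) :
    ∃ (φ' : 𝓢(ι → K, ℂ)) (r : ℂ), r ≠ 0 ∧ T φ' = r * T φ ∧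
      (∀ u : K, ‖u‖ = 1 → ∀ x, φ' (scaleOn J u x) = φ' x) ∧
      ∀ x, partOn J (1 : K) x ≠ 0 → ∫ a : K, φ (scaleOn J a x) = 0 →
        ∫ a : K, φ' (scaleOn J a x) = 0 := by
  have hcc : Continuous (circlePoint K) :=
    continuous_iff_continuousAt.2 fun s => (hasDerivAt_circlePoint hI s).continuousAt
  have hpi : (0 : ℝ) ≤ 2 * Real.pi := by positivity
  obtain ⟨φ', hφ'⟩ := exists_schwartzMap_integralScale_of_norm_eq_one J hpi
    (k := fun _ => 1) continuous_const hcc (norm_circlePoint hI) φ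
  obtain ⟨ψ, hψ⟩ := exists_schwartzMap_integralScale_of_norm_eq_one J hpi
    (k := id) continuous_id hcc (norm_circlePoint hI) φ
  have hφ'' : ∀ x, φ' x = ∫ s in Ioc 0 (2 * Real.pi), φ (scaleOn J (circlePoint K s) x) :=
    fun x => by simp only [hφ', integralScale, one_smul]
  have hper : Function.Periodic (circlePoint K) (2 * Real.pi) := fun θ => by
    simp [circlePoint]
  refine ⟨φ', 2 * Real.pi, by simp [Real.pi_ne_zero], ?_, fun u hu x => ?_, fun x hx h => ?_⟩
  · have h1 := hT.apply_fderiv_partOn RCLike.I (φ := ψ) (ψ := (2 * Real.pi : ℂ) • φ - φ')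
      (fun x => by
        rw [show ⇑ψ = _ from funext hψ, fderiv_integralScale_loop J hpi (hasDerivAt_circlePoint hI)
          (by simp [circlePoint]), ← hφ'']
        simp)
    rw [map_sub, map_smul] at h1
    simp only [RCLike.I_re, mul_zero, Complex.ofReal_zero, neg_zero, zero_mul, sub_eq_zero] at h1
    exact h1.symm
  · obtain ⟨α, rfl⟩ := exists_circlePoint_eq hI hu
    rw [hφ'', hφ'']
    simp only [scaleOn_scaleOn, ← circlePoint_add hI]
    have hg : Function.Periodic (fun s => φ (scaleOn J (circlePoint K s) x)) (2 * Real.pi) :=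
      fun θ => by simp only [hper θ]
    have := hg.intervalIntegral_add_eq α 0
    rw [← intervalIntegral.integral_of_le hpi, ← intervalIntegral.integral_of_le hpi,
      intervalIntegral.integral_comp_add_right (fun s => φ (scaleOn J (circlePoint K s) x)) α]
    simpa [add_comm] using this
  · simp only [hφ'']
    rw [integral_integral_comp_scaleOn φ J hx _ hcc (norm_circlePoint hI), h]
    simp

end circlePoint

theorem exists_rotation_average {J : Finset ι} {T : 𝓢(ι → K, ℂ) →L[ℂ] ℂ}
    (hT : IsHomogeneousOn J T) (φ : 𝓢(ι → K, ℂ)) :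
    ∃ (φ' : 𝓢(ι → K, ℂ)) (r : ℂ), r ≠ 0 ∧ T φ' = r * T φ ∧
      (∀ u : K, ‖u‖ = 1 → ∀ x, φ' (scaleOn J u x) = φ' x) ∧
      ∀ x, partOn J (1 : K) x ≠ 0 → ∫ a : K, φ (scaleOn J a x) = 0 →
        ∫ a : K, φ' (scaleOn J a x) = 0 :=
  (RCLike.I_eq_zero_or_im_I_eq_one (K := K)).elim
    (fun hI => exists_rotation_average_of_I_eq_zero hI hT φ)
    (fun hI => exists_rotation_average_of_im_I_eq_one hI hT φ)

/-- A homogeneous functional annihilates the functions whose integrals over lines vanish. -/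
theorem IsHomogeneousOn.apply_eq_zero {J : Finset ι} {T : 𝓢(ι → K, ℂ) →L[ℂ] ℂ}
    (hT : IsHomogeneousOn J T) {φ : 𝓢(ι → K, ℂ)}
    (hφ : ∀ x, partOn J (1 : K) x ≠ 0 → ∫ a : K, φ (scaleOn J a x) = 0) : T φ = 0 := by
  obtain ⟨φ', r, hr, hTφ, hrot, hint⟩ := exists_rotation_average hT φ
  have hd : Module.finrank ℝ K - 1 + 1 = Module.finrank ℝ K := Nat.sub_add_cancel Module.finrank_pos
  obtain ⟨ψ, hψ⟩ := exists_schwartzMap_radial J (Module.finrank ℝ K - 1) φ' fun x hx =>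
    radialMoment_eq_zero φ' J hrot (hint x hx (hφ x hx))
  -- The radial primitive satisfies φ' = (E + d) ψ, with E the Euler field in `J` and d the real
  -- dimension of `K`. Homogeneity gives T(E ψ) = -d T(ψ), hence T(φ') = 0.
  have h1 := hT.apply_fderiv_partOn 1 (φ := ψ) (ψ := φ' - (Module.finrank ℝ K : ℂ) • ψ)
    (fun x => by
      have := fderiv_integralScale_radial J (Module.finrank ℝ K - 1) φ' x
      rw [hd, ← funext hψ] at this
      rw [_root_.sub_apply, _root_.smul_apply, ← this]
      simp)
  rw [map_sub, map_smul] at h1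
  simp only [RCLike.one_re, mul_one, smul_eq_mul, Complex.ofReal_natCast] at h1
  have h2 : T φ' = 0 := by linear_combination h1
  rw [h2] at hTφ
  exact (mul_eq_zero.1 hTφ.symm).resolve_left hr

/-- After the substitution s = x_i a, the kernel depends only on the product y s, so the double
integral treats the two arguments of φ symmetrically. -/
theorem integral_pft_scaleOn_of_ne_zero {i j : ι} (hij : i ≠ j) (φ : 𝓢(ι → K, ℂ)) {x : ι → K}
    (hx : x i ≠ 0) : ∫ a : K, pft j φ (scaleOn {i, j} a x) =
      ((‖x i‖ ^ Module.finrank ℝ K)⁻¹ : ℝ) * ∫ s : K, ∫ y : K,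
        phase (-RCLike.re (y * s * (x j / x i))) * φ (Function.update (Function.update x i s) j y) := by
  rw [← integral_comp_mul (x i) _ hx]
  refine integral_congr_ae (.of_forall fun a => integral_congr_ae (.of_forall fun y => ?_))
  have h1 : scaleOn {i, j} a x j = a * x j := by simp [scaleOn_apply]
  have h2 : Function.update (scaleOn {i, j} a x) j y =
      Function.update (Function.update x i (x i * a)) j y := by
    ext k
    by_cases hk : k = j
    · subst hk; simp
    · by_cases hk' : k = i
      · subst hk'; simp [scaleOn_apply, hij, mul_comm]
      · simp [scaleOn_apply, hk, hk']
  simp only [h1, h2]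
  congr 4
  field_simp

/-- On the exceptional line x_i = 0, Fourier inversion gives the value of φ where both coordinates
vanish, which is again symmetric. -/
theorem integral_pft_scaleOn_of_eq_zero {i j : ι} (hij : i ≠ j) (φ : 𝓢(ι → K, ℂ)) {x : ι → K}
    (hx : x i = 0) (hxj : x j ≠ 0) : ∫ a : K, pft j φ (scaleOn {i, j} a x) =
      ((‖x j‖ ^ Module.finrank ℝ K)⁻¹ : ℝ) * φ (Function.update x j 0) := by
  have h1 : ∀ a, pft j φ (scaleOn {i, j} a x) = 𝓕 (φ.slice j x) (starRingEnd K (x j * a)) := by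
    intro a
    rw [pft_apply, pftFun_eq_fourier]
    have h2 : scaleOn {i, j} a x j = x j * a := by simp [scaleOn_apply, mul_comm]
    have h3 : φ.slice j (scaleOn {i, j} a x) = φ.slice j x := by
      ext y
      rw [SchwartzMap.slice_apply, SchwartzMap.slice_apply]
      congr 1
      ext k
      by_cases hk : k = j
      · subst hk; simp
      · by_cases hk' : k = i
        · subst hk'; simp [scaleOn_apply, hij, hx]
        · simp [scaleOn_apply, hk, hk']
    rw [h2, h3]
  simp only [h1]
  rw [integral_comp_mul (x j) (fun a => 𝓕 (φ.slice j x) (starRingEnd K a)) hxj,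
    integral_comp_conj fun a => 𝓕 (φ.slice j x) a]
  congr 1
  rw [← SchwartzMap.slice_apply, ← neg_zero, ← SchwartzMap.fourier_fourier,
    SchwartzMap.fourier_apply_eq_integral]
  simp [phase_zero]

theorem integral_pft_scaleOn_swap {i j : ι} (hij : i ≠ j) {φ ψ : 𝓢(ι → K, ℂ)}
    (hψ : ∀ x, ψ x = φ (x ∘ Equiv.swap i j)) {x : ι → K} (hx : partOn {i, j} (1 : K) x ≠ 0) :
    ∫ a : K, pft j ψ (scaleOn {i, j} a x) = ∫ a : K, pft j φ (scaleOn {i, j} a x) := by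
  by_cases hi : x i = 0
  · have hj : x j ≠ 0 := fun hj => hx (by
      ext k
      simp only [partOn_apply, Finset.mem_insert, Finset.mem_singleton, Pi.zero_apply,
        ite_eq_right_iff]
      rintro (rfl | rfl) <;> simp [hi, hj])
    rw [integral_pft_scaleOn_of_eq_zero hij _ hi hj, integral_pft_scaleOn_of_eq_zero hij _ hi hj, hψ]
    congr 2
    ext k
    simp only [Function.comp_apply]
    by_cases hk : k = i
    · subst hk; simp [hij, hi]
    · by_cases hk' : k = j
      · subst hk'; simp [hij, hi]
      · rw [Equiv.swap_apply_of_ne_of_ne hk hk']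
  · rw [integral_pft_scaleOn_of_ne_zero hij _ hi, integral_pft_scaleOn_of_ne_zero hij _ hi,
      integral_integral_swap]
    · congr 1
      refine integral_congr_ae (.of_forall fun y => integral_congr_ae (.of_forall fun s => ?_))
      have h1 : Function.update (Function.update x i s) j y ∘ Equiv.swap i j =
          Function.update (Function.update x i y) j s := by
        ext k
        simp only [Function.comp_apply]
        by_cases hk : k = i
        · subst hk; simp [hij]
        · by_cases hk' : k = j
          · subst hk'; simp [hij]
          · rw [Equiv.swap_apply_of_ne_of_ne hk hk']
            simp [hk, hk']
      simp only [hψ, h1, mul_comm y s]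
    · refine integrable_update_update ψ x hij
        (g := fun p => phase (-RCLike.re (p.2 * p.1 * (x j / x i)))) ?_ fun p => (norm_phase _).le
      exact continuous_phase.comp (RCLike.continuous_re.comp
        ((continuous_snd.mul continuous_fst).mul continuous_const)).neg

/-- A functional that is invariant under `(x_i, x_j) ↦ (a x_i, a⁻¹ x_j)` is invariant under the
exchange of the coordinates `x_i` and `x_j`. -/
theorem apply_swap_eq {i j : ι} (hij : i ≠ j) {T : 𝓢(ι → K, ℂ) →L[ℂ] ℂ}
    (hT : ∀ a : K, a ≠ 0 → ∀ φ ψ : 𝓢(ι → K, ℂ),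
      (∀ x, ψ x = φ (scaleOn {i} a (scaleOn {j} a⁻¹ x))) → T ψ = T φ)
    {φ ψ : 𝓢(ι → K, ℂ)} (hψ : ∀ x, ψ x = φ (x ∘ Equiv.swap i j)) : T ψ = T φ := by
  let V : 𝓢(ι → K, ℂ) →L[ℂ] 𝓢(ι → K, ℂ) := (pft j).comp ((pft j).comp (pft j))
  have hV : ∀ φ, V (pft j φ) = φ := fun φ => pft_pft_pft_pft j φ
  have hV' : ∀ φ, pft j (V φ) = φ := fun φ => pft_pft_pft_pft j φ
  -- The transform in x_j turns the weight a⁻¹ into a, and its Jacobian supplies the factor in the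
  -- homogeneity.
  have hhom : IsHomogeneousOn {i, j} (T.comp V) := by
    intro a ha φ₁ ψ₁ h1
    obtain ⟨φ₀, rfl⟩ : ∃ φ₀, φ₁ = pft j φ₀ := ⟨V φ₁, (hV' φ₁).symm⟩
    obtain ⟨χ₁, hχ₁⟩ := φ₀.exists_comp_scaleOn {i} ha
    obtain ⟨χ₂, hχ₂⟩ := χ₁.exists_comp_scaleOn {j} (inv_ne_zero ha)
    have h2 : T χ₂ = T φ₀ := hT a ha φ₀ χ₂ fun x => by rw [hχ₂, hχ₁]
    have h3 : ψ₁ = (((‖a‖ ^ Module.finrank ℝ K)⁻¹ : ℝ) : ℂ) • pft j χ₂ := by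
      ext x
      have h4 := pftFun_comp (k := j) (k' := j) (x := x) (x' := scaleOn {i, j} a x)
        (inv_ne_zero ha) (A := fun x => scaleOn {i} a (scaleOn {j} a⁻¹ x)) (fun y => by
          ext k
          by_cases hk : k = j
          · subst hk; simp [scaleOn_apply, hij.symm]
          · by_cases hk' : k = i
            · subst hk'; simp [scaleOn_apply, hij]
            · simp [scaleOn_apply, hk, hk']) (by simp [scaleOn_apply, ha]) φ₀
      rw [h1, _root_.smul_apply, pft_apply, pft_apply, show ⇑χ₂ = _ from funext fun x => by rw [hχ₂, hχ₁], h4,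
        smul_eq_mul, ← mul_assoc, ← Complex.ofReal_mul]
      have hn : ‖a‖ ≠ 0 := norm_ne_zero_iff.2 ha
      rw [norm_inv, inv_pow, inv_inv, inv_mul_cancel₀ (pow_ne_zero _ hn)]
      simp
    simp only [ContinuousLinearMap.comp_apply, h3, map_smul, hV, h2, smul_eq_mul]
  -- Exchanging the two coordinates before the transform leaves all its line integrals unchanged, so
  -- the transform of ψ - φ has vanishing line integrals.
  have h := hhom.apply_eq_zero (φ := pft j (ψ - φ)) fun x hx => by
    rw [map_sub]
    simp only [_root_.sub_apply]
    rw [integral_sub (integrable_comp_scaleOn _ _ hx) (integrable_comp_scaleOn _ _ hx),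
      integral_pft_scaleOn_swap hij hψ hx, sub_self]
  rw [ContinuousLinearMap.comp_apply, hV, map_sub, sub_eq_zero] at h
  exact h

end HyperbolicTorus

/-! ### Cut-off functions -/

noncomputable section Cutoff

set_option linter.unusedSectionVars false

open scoped ContDiff
open MeasureTheory Set

/-- All derivatives of y ↦ y⁻¹ are bounded on (1/2, ∞); writing it as a real power gives them in
closed form. -/
theorem _root_.Function.HasTemperateGrowth.inv_of_half_lt {E : Type*} [NormedAddCommGroup E]
    [NormedSpace ℝ E] {f : E → ℝ} (hf : f.HasTemperateGrowth) (h : ∀ x, 1 / 2 < f x) :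
    (fun x => (f x)⁻¹).HasTemperateGrowth := by
  have hunique : UniqueDiffOn ℝ (Ioi (1 / 2 : ℝ)) := isOpen_Ioi.uniqueDiffOn
  have hpos : ∀ x ∈ Ioi (1 / 2 : ℝ), 0 < x := fun x hx => lt_trans (by norm_num) hx
  have key : ((fun y : ℝ => y ^ (-1 : ℝ)) ∘ f).HasTemperateGrowth := by
    refine hf.comp' (t := Ioi (1 / 2)) (by rintro _ ⟨x, rfl⟩; exact h x) hunique
      (contDiffOn_fun_id.rpow_const_of_ne fun x hx => (hpos x hx).ne') fun N => ?_
    refine ⟨0, ∑ k ∈ Finset.range (N + 1), ‖Polynomial.eval (-1) (descPochhammer ℝ k)‖ * 2 ^ (k + 1),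
      by positivity, fun n hn x hx => ?_⟩
    have hc : ContDiffAt ℝ n (fun x : ℝ => x ^ (-1 : ℝ)) x :=
      Real.contDiffAt_rpow_const (Or.inl (hpos x hx).ne')
    rw [norm_iteratedFDerivWithin_eq_norm_iteratedDerivWithin,
      iteratedDerivWithin_eq_iteratedDeriv hunique hc hx, iteratedDeriv_eq_iterate,
      Real.iter_deriv_rpow_const, norm_mul, pow_zero, mul_one]
    refine le_trans ?_ (Finset.single_le_sum
      (f := fun k => ‖Polynomial.eval (-1) (descPochhammer ℝ k)‖ * (2 : ℝ) ^ (k + 1))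
      (fun _ _ => by positivity) (Finset.mem_range.2 (Nat.lt_succ_of_le hn)))
    gcongr
    have hx2 : x⁻¹ ≤ 2 := by
      rw [inv_le_comm₀ (hpos x hx) two_pos]
      have : 1 / 2 < x := hx
      linarith
    rw [show (-1 - (n : ℝ)) = -((n + 1 : ℕ) : ℝ) by push_cast; ring, Real.rpow_neg (hpos x hx).le,
      Real.rpow_natCast, ← inv_pow, norm_pow, Real.norm_of_nonneg (inv_nonneg.2 (hpos x hx).le)]
    exact pow_le_pow_left₀ (inv_nonneg.2 (hpos x hx).le) hx2 _
  have h2 : (fun x => (f x)⁻¹) = (fun y : ℝ => y ^ (-1 : ℝ)) ∘ f := by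
    ext x
    simp [Real.rpow_neg_one]
  rwa [h2]

variable {K : Type*} [RCLike K]

/-- The bump function underlying `cutoff`. -/
def cutoffBump (K : Type*) [RCLike K] : ContDiffBump (0 : K) := ⟨2, 3, by norm_num, by norm_num⟩

/-- A smooth function on `K` with compact support that is `1` near the origin. -/
def cutoff (w : K) : ℝ := cutoffBump K w

theorem contDiff_cutoff : ContDiff ℝ ∞ (cutoff (K := K)) := (cutoffBump K).contDiff

theorem hasCompactSupport_cutoff : HasCompactSupport (cutoff (K := K)) :=
  (cutoffBump K).hasCompactSupport

theorem hasTemperateGrowth_cutoff : (cutoff (K := K)).HasTemperateGrowth :=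
  (cutoffBump K).hasCompactSupport.hasTemperateGrowth (cutoffBump K).contDiff

theorem cutoff_eq_one {w : K} (hw : ‖w‖ ≤ 2) : cutoff w = 1 :=
  (cutoffBump K).one_of_mem_closedBall (by simpa [cutoffBump] using hw)

theorem norm_le_of_cutoff_ne_zero {w : K} (hw : cutoff w ≠ 0) : ‖w‖ ≤ 3 := by
  by_contra! h
  exact hw ((cutoffBump K).zero_of_le_dist (by simpa [cutoffBump] using h.le))

/-- A smooth function on `K` of temperate growth that is equal to `w⁻¹` outside a neighbourhood of
the origin. -/
def nearInv (w : K) : K :=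
  (‖w‖ ^ 2 + (⟨1, 2, by norm_num, by norm_num⟩ : ContDiffBump (0 : K)) w)⁻¹ • starRingEnd K w

theorem hasTemperateGrowth_nearInv : (nearInv (K := K)).HasTemperateGrowth := by
  let b : ContDiffBump (0 : K) := ⟨1, 2, by norm_num, by norm_num⟩
  have h1 : (fun w : K => ‖w‖ ^ 2 + b w).HasTemperateGrowth :=
    (Function.hasTemperateGrowth_norm_sq K).fun_add
      (b.hasCompactSupport.hasTemperateGrowth b.contDiff)
  have h2 := h1.inv_of_half_lt fun w => by
    have hb : 0 ≤ b w := b.nonneg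
    by_cases hw : ‖w‖ ≤ 1
    · rw [b.one_of_mem_closedBall (by simpa [b] using hw)]
      nlinarith [sq_nonneg ‖w‖]
    · nlinarith [norm_nonneg w]
  exact h2.fun_smul (RCLike.conjCLE (K := K)).toContinuousLinearMap.hasTemperateGrowth

/-- The radii are matched: `cutoff` is 1 up to radius 2, and the bump in the denominator of
`nearInv` vanishes from radius 2 on, so the inverse is exact wherever 1 - `cutoff` is not zero. -/
theorem nearInv_mul_self {w : K} (hw : 1 - cutoff w ≠ 0) : nearInv w * w = 1 := by
  have h2 : 2 < ‖w‖ := by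
    by_contra! h
    exact hw (by rw [cutoff_eq_one h, sub_self])
  have h0 : (‖w‖ : K) ≠ 0 := by simpa using fun h : w = 0 => by simp [h] at h2; linarith
  rw [nearInv, ContDiffBump.zero_of_le_dist _ (by simpa using h2.le), add_zero, smul_mul_assoc,
    RCLike.conj_mul, RCLike.real_smul_eq_coe_mul]
  push_cast
  exact inv_mul_cancel₀ (pow_ne_zero _ h0)

end Cutoff

/-! ### Functions that annihilate a functional -/

noncomputable section Kills

set_option linter.unusedSectionVars false

open scoped ContDiff
open MeasureTheory Set

/-! ### The ideal of functions that annihilate a functional. -/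

section General

variable {E K : Type*} [NormedAddCommGroup E] [NormedSpace ℝ E] [RCLike K]

/-- Multiplication by a function of temperate growth. -/
def mulBy (g : E → ℂ) : 𝓢(E, ℂ) →L[ℂ] 𝓢(E, ℂ) := SchwartzMap.smulLeftCLM ℂ g

theorem mulBy_apply {g : E → ℂ} (hg : g.HasTemperateGrowth) (φ : 𝓢(E, ℂ)) (x : E) :
    mulBy g φ x = g x * φ x := by
  rw [mulBy, SchwartzMap.smulLeftCLM_apply_apply hg, smul_eq_mul]

/-- The real part of a `K`-valued function, as a complex valued function. -/
def reC (P : E → K) (x : E) : ℂ := ((RCLike.re (P x) : ℝ) : ℂ)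

theorem hasTemperateGrowth_reC {P : E → K} (hP : P.HasTemperateGrowth) :
    (reC P).HasTemperateGrowth :=
  (Complex.ofRealCLM.comp (RCLike.reCLM (K := K))).hasTemperateGrowth.comp hP

theorem hasTemperateGrowth_const_mul {P : E → K} (hP : P.HasTemperateGrowth) (c : K) :
    (fun x => c * P x).HasTemperateGrowth :=
  (Function.HasTemperateGrowth.const c).fun_mul hP

theorem mulBy_reC_apply {P : E → K} (hP : P.HasTemperateGrowth) (c : K) (φ : 𝓢(E, ℂ)) (x : E) :
    mulBy (reC fun x => c * P x) φ x = RCLike.re (c * P x) * φ x :=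
  mulBy_apply (hasTemperateGrowth_reC (hasTemperateGrowth_const_mul hP c)) φ x

/-- The functional `F` is annihilated by the multiplication by the function `P`. -/
def Kills (F : 𝓢(E, ℂ) →L[ℂ] ℂ) (P : E → K) : Prop :=
  ∀ c : K, F.comp (mulBy (reC fun x => c * P x)) = 0

variable {F : 𝓢(E, ℂ) →L[ℂ] ℂ} {P Q g : E → K}

theorem re_mul_eq (a b : K) :
    RCLike.re (a * b) = RCLike.re a * RCLike.re (1 * b) + RCLike.im a * RCLike.re (RCLike.I * b) := by
  rw [RCLike.mul_re, RCLike.mul_re RCLike.I, RCLike.I_re, one_mul]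
  linear_combination (RCLike.im a) * RCLike.mul_im_I_ax b

/-- Multipliers are complex valued whereas P is `K`-valued, so P is tested through Re(c P). The
cases c = 1 and c = I suffice, with Re g and Im g as coefficients. -/
theorem Kills.apply_eq_zero (h : Kills F P) (hP : P.HasTemperateGrowth)
    (hg : g.HasTemperateGrowth) {φ χ : 𝓢(E, ℂ)} (hχ : ∀ x, χ x = RCLike.re (g x * P x) * φ x) :
    F χ = 0 := by
  have him : (fun x => ((RCLike.im (g x) : ℝ) : ℂ)).HasTemperateGrowth :=
    (Complex.ofRealCLM.comp (RCLike.imCLM (K := K))).hasTemperateGrowth.comp hg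
  have : χ = mulBy (reC fun x => 1 * P x) (mulBy (reC g) φ) +
      mulBy (reC fun x => RCLike.I * P x) (mulBy (fun x => ((RCLike.im (g x) : ℝ) : ℂ)) φ) := by
    ext x
    rw [hχ, _root_.add_apply, mulBy_reC_apply hP, mulBy_reC_apply hP, mulBy_apply him,
      mulBy_apply (hasTemperateGrowth_reC hg), re_mul_eq, reC]
    push_cast
    ring
  rw [this, map_add]
  have h1 := DFunLike.congr_fun (h 1) (mulBy (reC g) φ)
  have h2 := DFunLike.congr_fun (h RCLike.I) (mulBy (fun x => ((RCLike.im (g x) : ℝ) : ℂ)) φ)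
  simp only [ContinuousLinearMap.comp_apply, _root_.zero_apply] at h1 h2
  rw [h1, h2, add_zero]

theorem kills_iff (hP : P.HasTemperateGrowth) : Kills F P ↔
    ∀ (c : K) (φ χ : 𝓢(E, ℂ)), (∀ x, χ x = RCLike.re (c * P x) * φ x) → F χ = 0 := by
  refine ⟨fun h c φ χ hχ => h.apply_eq_zero hP (Function.HasTemperateGrowth.const c) hχ,
    fun h c => ContinuousLinearMap.ext fun φ => h c φ _ fun x => mulBy_reC_apply hP c φ x⟩

/-- With `Kills.add`, this makes the functions of temperate growth that annihilate `F` an ideal, and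
the eliminations below are computations in this ideal. -/
theorem Kills.mul (h : Kills F P) (hP : P.HasTemperateGrowth) (hg : g.HasTemperateGrowth) :
    Kills F fun x => g x * P x := by
  refine (kills_iff (hg.fun_mul hP)).2 fun c φ χ hχ =>
    h.apply_eq_zero hP (hasTemperateGrowth_const_mul hg c) (φ := φ) fun x => ?_
  rw [hχ, mul_assoc]

theorem Kills.add (h : Kills F P) (h' : Kills F Q) (hP : P.HasTemperateGrowth)
    (hQ : Q.HasTemperateGrowth) : Kills F fun x => P x + Q x := by
  intro c
  have : mulBy (reC fun x => c * (P x + Q x)) =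
      mulBy (reC fun x => c * P x) + mulBy (reC fun x => c * Q x) := by
    ext φ x
    rw [mulBy_reC_apply (hP.fun_add hQ), _root_.add_apply, _root_.add_apply, mulBy_reC_apply hP,
      mulBy_reC_apply hQ, mul_add, map_add]
    push_cast
    ring
  rw [this, ContinuousLinearMap.comp_add, h c, h' c, add_zero]

theorem Kills.of_eq (h : Kills F P) (hPQ : ∀ x, P x = Q x) : Kills F Q := by
  rwa [← funext hPQ]

theorem Kills.comp_mulBy (h : Kills F P) (hP : P.HasTemperateGrowth) {m : E → ℂ}
    (hm : m.HasTemperateGrowth) : Kills (F.comp (mulBy m)) P := by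
  refine (kills_iff hP).2 fun c φ χ hχ => ?_
  change F (mulBy m χ) = 0
  refine (kills_iff hP).1 h c (mulBy m φ) _ fun x => ?_
  rw [mulBy_apply hm, mulBy_apply hm, hχ]
  ring

theorem kills_comp_mulBy_of_mul_eq_zero (hP : P.HasTemperateGrowth) {m : E → ℂ}
    (hm : m.HasTemperateGrowth) (h : ∀ x, m x ≠ 0 → P x = 0) : Kills (F.comp (mulBy m)) P := by
  refine (kills_iff hP).2 fun c φ χ hχ => ?_
  have : mulBy m χ = 0 := by
    ext x
    rw [mulBy_apply hm, hχ]
    by_cases hx : m x = 0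
    · simp [hx]
    · simp [h x hx]
  rw [ContinuousLinearMap.comp_apply, this, map_zero]

theorem Kills.eq_zero_of_const {c : K} (hc : c ≠ 0) (h : Kills F fun _ => c) : F = 0 := by
  ext φ
  refine (kills_iff (Function.HasTemperateGrowth.const c)).1 h c⁻¹ φ φ fun x => ?_
  simp [hc]

end General

/-! ### Functionals annihilated by coordinates. -/

section Coordinates

variable {ι K : Type*} [Fintype ι] [DecidableEq ι] [RCLike K] {F : 𝓢(ι → K, ℂ) →L[ℂ] ℂ}

theorem hasTemperateGrowth_coord (k : ι) : (fun x : ι → K => x k).HasTemperateGrowth :=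
  (ContinuousLinearMap.proj (R := ℝ) (φ := fun _ : ι => K) k).hasTemperateGrowth

theorem hasTemperateGrowth_ofReal_cutoff {E : Type*} [NormedAddCommGroup E] [NormedSpace ℝ E]
    {P : E → K} (hP : P.HasTemperateGrowth) :
    (fun x => ((cutoff (P x) : ℝ) : ℂ)).HasTemperateGrowth :=
  Complex.ofRealCLM.hasTemperateGrowth.comp (hasTemperateGrowth_cutoff.comp hP)

/-- The function 1 - `cutoff` P is a multiple of P with coefficient of temperate growth, because
`nearInv` P inverts P where it does not vanish. So cutting off near P = 0 costs nothing. -/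
theorem Kills.apply_cutoff_mul {E : Type*} [NormedAddCommGroup E] [NormedSpace ℝ E]
    {F : 𝓢(E, ℂ) →L[ℂ] ℂ} {P : E → K} (h : Kills F P)
    (hP : P.HasTemperateGrowth) (φ : 𝓢(E, ℂ)) :
    F (mulBy (fun x => ((cutoff (P x) : ℝ) : ℂ)) φ) = F φ := by
  rw [← sub_eq_zero, ← map_sub]
  have hg : (fun x => ((1 - cutoff (P x) : ℝ)) • -nearInv (P x)).HasTemperateGrowth :=
    ((Function.HasTemperateGrowth.const (1 : ℝ)).fun_sub (hasTemperateGrowth_cutoff.comp hP)).fun_smul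
      (hasTemperateGrowth_nearInv.comp hP).fun_neg
  refine h.apply_eq_zero hP hg (φ := φ) fun x => ?_
  rw [_root_.sub_apply, mulBy_apply (hasTemperateGrowth_ofReal_cutoff hP)]
  by_cases hx : 1 - cutoff (P x) = 0
  · rw [hx]
    have : cutoff (P x) = 1 := by linarith
    simp [this]
  · rw [smul_mul_assoc, neg_mul, nearInv_mul_self hx, RCLike.smul_re, map_neg, RCLike.one_re]
    push_cast
    ring

theorem apply_prod_cutoff_mul (J : Finset ι) (h : ∀ k ∈ J, Kills F fun x => x k)
    (φ : 𝓢(ι → K, ℂ)) :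
    (fun x : ι → K => ∏ k ∈ J, ((cutoff (x k) : ℝ) : ℂ)).HasTemperateGrowth ∧
    F (mulBy (fun x : ι → K => ∏ k ∈ J, ((cutoff (x k) : ℝ) : ℂ)) φ) = F φ := by
  induction J using Finset.induction_on with
  | empty =>
    simp only [Finset.prod_empty]
    refine ⟨Function.HasTemperateGrowth.const 1, congrArg F ?_⟩
    ext x
    rw [mulBy_apply (Function.HasTemperateGrowth.const 1), one_mul]
  | insert k J hk ih =>
    obtain ⟨h1, h2⟩ := ih fun l hl => h l (Finset.mem_insert_of_mem hl)
    have hc := hasTemperateGrowth_ofReal_cutoff (hasTemperateGrowth_coord (K := K) k)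
    simp only [Finset.prod_insert hk]
    refine ⟨hc.fun_mul h1, ?_⟩
    rw [← h2, ← (h k (Finset.mem_insert_self k J)).apply_cutoff_mul (hasTemperateGrowth_coord k)
      (mulBy (fun x : ι → K => ∏ k ∈ J, ((cutoff (x k) : ℝ) : ℂ)) φ)]
    congr 1
    ext x
    rw [mulBy_apply (hc.fun_mul h1), mulBy_apply hc, mulBy_apply h1, mul_assoc]

/-- A functional that is annihilated by the coordinates in `J` depends only on the restriction of
the Schwartz functions to the subspace where these coordinates vanish. -/
theorem apply_eq_zero_of_kills_coord (J : Finset ι) (h : ∀ k ∈ J, Kills F fun x => x k)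
    {φ : 𝓢(ι → K, ℂ)} (hφ : ∀ x, (∀ k ∈ J, x k = 0) → φ x = 0) : F φ = 0 := by
  obtain ⟨h1, h2⟩ := apply_prod_cutoff_mul J h φ
  rw [← h2]
  -- The bound 3 is the outer radius of the bump defining `cutoff`.
  obtain ⟨a, b, hab⟩ := exists_eq_sum_coord_mul J h1 (R := 3) (by norm_num) (fun x hx k hk => by
    refine norm_le_of_cutoff_ne_zero fun h0 => hx (Finset.prod_eq_zero hk ?_)
    rw [h0, Complex.ofReal_zero]) φ hφ
  have : mulBy (fun x : ι → K => ∏ k ∈ J, ((cutoff (x k) : ℝ) : ℂ)) φ =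
      ∑ k ∈ J, (mulBy (reC fun x => 1 * x k) (a k) - mulBy (reC fun x => RCLike.I * x k) (b k)) := by
    ext x
    rw [mulBy_apply h1, hab, _root_.sum_apply]
    refine Finset.sum_congr rfl fun k _ => ?_
    rw [_root_.sub_apply, mulBy_reC_apply (hasTemperateGrowth_coord k),
      mulBy_reC_apply (hasTemperateGrowth_coord k), one_mul, RCLike.mul_re, RCLike.I_re, zero_mul,
      zero_sub, mul_comm (RCLike.im _), RCLike.mul_im_I_ax]
    push_cast
    ring
  rw [this, map_sum]
  refine Finset.sum_eq_zero fun k hk => ?_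
  have e1 := DFunLike.congr_fun (h k hk 1) (a k)
  have e2 := DFunLike.congr_fun (h k hk RCLike.I) (b k)
  simp only [ContinuousLinearMap.comp_apply, _root_.zero_apply] at e1 e2
  rw [map_sub, e1, e2, sub_zero]

/-! ### Functionals supported on graphs -/

/-- The shear `x_k ↦ x_k + h_k(x)`, for `k` in `W`. -/
def shear (W : Finset ι) (h : ι → (ι → K) → K) (x : ι → K) : ι → K :=
  x + ∑ k ∈ W, Pi.single k (h k x)

theorem shear_apply (W : Finset ι) (h : ι → (ι → K) → K) (x : ι → K) (l : ι) :
    shear W h x l = if l ∈ W then x l + h l x else x l := by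
  simp only [shear, Pi.add_apply, Finset.sum_apply, Pi.single_apply, Finset.sum_ite_eq]
  split_ifs <;> simp

theorem hasTemperateGrowth_shear {W : Finset ι} {h : ι → (ι → K) → K}
    (hh : ∀ k ∈ W, (h k).HasTemperateGrowth) : (shear W h).HasTemperateGrowth := by
  unfold shear
  refine Function.HasTemperateGrowth.id'.fun_add (Function.HasTemperateGrowth.sum fun k hk => ?_)
  exact (ContinuousLinearMap.single ℝ (fun _ : ι => K) k).hasTemperateGrowth.comp (hh k hk)

/-- The functions `h_k` depend only on the coordinates outside `W`. -/
def DependsOff (W : Finset ι) (h : ι → (ι → K) → K) : Prop :=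
  ∀ k ∈ W, ∀ x y : ι → K, (∀ l ∉ W, x l = y l) → h k x = h k y

theorem shear_shear {W : Finset ι} {h h' : ι → (ι → K) → K} (hW : DependsOff W h')
    (hh' : ∀ k x, h' k x = -h k x) (x : ι → K) : shear W h' (shear W h x) = x := by
  ext l
  rw [shear_apply, shear_apply]
  split_ifs with hl
  · rw [hW l hl (shear W h x) x fun m hm => by rw [shear_apply, if_neg hm], hh']
    ring
  · rfl

theorem DependsOff.neg {W : Finset ι} {h : ι → (ι → K) → K} (hW : DependsOff W h) :
    DependsOff W fun k x => -h k x :=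
  fun k hk x y hxy => congrArg Neg.neg (hW k hk x y hxy)

theorem exists_comp_shear {W : Finset ι} {h : ι → (ι → K) → K}
    (hh : ∀ k ∈ W, (h k).HasTemperateGrowth) (hW : DependsOff W h) :
    ∃ A : 𝓢(ι → K, ℂ) →L[ℂ] 𝓢(ι → K, ℂ), ∀ φ x, A φ x = φ (shear W h x) := by
  have hneg : (shear W fun k x => -h k x).HasTemperateGrowth :=
    hasTemperateGrowth_shear fun k hk => (hh k hk).fun_neg
  refine ⟨SchwartzMap.compCLM ℂ (hasTemperateGrowth_shear hh) ?_, fun φ x => rfl⟩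
  obtain ⟨k, C, hC⟩ := hneg.2 0
  refine ⟨k, C, fun x => ?_⟩
  have := hC (shear W h x)
  rwa [norm_iteratedFDeriv_zero, shear_shear hW.neg fun _ _ => rfl] at this

/-- The graph of the functions `h_k`, for `k` in `W`. -/
def graphSet (W : Finset ι) (h : ι → (ι → K) → K) : Set (ι → K) := {x | ∀ k ∈ W, x k = h k x}

/-- The shear straightens the graph to the subspace where the coordinates in `W` vanish. -/
theorem kills_coord_of_shear {W : Finset ι} {h : ι → (ι → K) → K}
    (hh : ∀ k ∈ W, (h k).HasTemperateGrowth) 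
    (hkill : ∀ k ∈ W, Kills F fun x => x k - h k x) {A : 𝓢(ι → K, ℂ) →L[ℂ] 𝓢(ι → K, ℂ)}
    (hA : ∀ φ x, A φ x = φ (shear W (fun k x => -h k x) x)) :
    ∀ k ∈ W, Kills (F.comp A) fun x => x k := by
  intro k hk
  refine (kills_iff (hasTemperateGrowth_coord k)).2 fun c φ χ hχ => ?_
  change F (A χ) = 0
  refine (kills_iff ((hasTemperateGrowth_coord k).fun_sub (hh k hk))).1 (hkill k hk) c (A φ) _
    fun x => ?_
  rw [hA, hA, hχ, shear_apply, if_pos hk, sub_eq_add_neg]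

/-- A functional that is annihilated by the functions `x_k - h_k(x)` depends only on the restriction
of the Schwartz functions to the graph of the `h_k`. -/
theorem apply_eq_zero_of_graph {W : Finset ι} {h : ι → (ι → K) → K}
    (hh : ∀ k ∈ W, (h k).HasTemperateGrowth) (hW : DependsOff W h)
    (hkill : ∀ k ∈ W, Kills F fun x => x k - h k x) {φ : 𝓢(ι → K, ℂ)}
    (hφ : ∀ x ∈ graphSet W h, φ x = 0) : F φ = 0 := by
  obtain ⟨A, hA⟩ := exists_comp_shear (fun k hk => (hh k hk).fun_neg) hW.neg
  obtain ⟨B, hB⟩ := exists_comp_shear hh hW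
  have hAB : A (B φ) = φ := by
    ext x
    rw [hA, hB, shear_shear hW fun k x => by rw [neg_neg]]
  rw [← hAB, ← ContinuousLinearMap.comp_apply]
  refine apply_eq_zero_of_kills_coord W (kills_coord_of_shear hh hkill hA) fun x hx => ?_
  rw [hB]
  refine hφ _ fun k hk => ?_
  rw [shear_apply, if_pos hk, hx k hk, zero_add]
  exact hW k hk _ _ fun l hl => by rw [shear_apply, if_neg hl]

theorem apply_eq_of_graph {W : Finset ι} {h : ι → (ι → K) → K}
    (hh : ∀ k ∈ W, (h k).HasTemperateGrowth) (hW : DependsOff W h)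
    (hkill : ∀ k ∈ W, Kills F fun x => x k - h k x) {φ ψ : 𝓢(ι → K, ℂ)}
    (hφ : ∀ x ∈ graphSet W h, φ x = ψ x) : F φ = F ψ := by
  rw [← sub_eq_zero, ← map_sub]
  exact apply_eq_zero_of_graph hh hW hkill fun x hx => by rw [_root_.sub_apply, hφ x hx, sub_self]

/-- A functional supported on a graph, invariant under a hyperbolic torus and anti-invariant under
an involution that acts on the graph as the Weyl element of the torus, vanishes. -/
theorem eq_zero_of_graph {W : Finset ι} {h : ι → (ι → K) → K}
    (hh : ∀ k ∈ W, (h k).HasTemperateGrowth) (hW : DependsOff W h)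
    (hkill : ∀ k ∈ W, Kills F fun x => x k - h k x) {i j : ι} (hij : i ≠ j) (hi : i ∉ W) (hj : j ∉ W)
    {t : K → (ι → K) → ι → K} (ht : ∀ a, a ≠ 0 → ∀ x ∈ graphSet W h, t a x ∈ graphSet W h ∧
      ∀ l ∉ W, t a x l = scaleOn {i} a (scaleOn {j} a⁻¹ x) l)
    (hT : ∀ a, a ≠ 0 → ∀ φ, ∃ ψ : 𝓢(ι → K, ℂ), (∀ x, ψ x = φ (t a x)) ∧ F ψ = F φ)
    {τ : (ι → K) → ι → K} (hτ : ∀ x ∈ graphSet W h, τ x ∈ graphSet W h ∧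
      ∀ l ∉ W, τ x l = x (Equiv.swap i j l))
    (hF : ∀ φ, ∃ ψ : 𝓢(ι → K, ℂ), (∀ x, ψ x = φ (τ x)) ∧ F ψ = -F φ) : F = 0 := by
  obtain ⟨A, hA⟩ := exists_comp_shear (fun k hk => (hh k hk).fun_neg) hW.neg
  obtain ⟨B, hB⟩ := exists_comp_shear hh hW
  have hAB : ∀ φ, A (B φ) = φ := fun φ => by
    ext x
    rw [hA, hB, shear_shear hW fun k x => by rw [neg_neg]]
  set S : (ι → K) → ι → K := shear W fun k x => -h k x with hS
  have hSΓ : ∀ x ∈ graphSet W h, ∀ l, S x l = if l ∈ W then 0 else x l := fun x hx l => by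
    rw [hS, shear_apply]
    split_ifs with hl
    · rw [hx l hl]; ring
    · rfl
  -- The functional sees only values on the graph, where t agrees, in the coordinates outside `W`,
  -- with the linear hyperbolic torus. After straightening, the functional is therefore invariant
  -- under that torus.
  have hinv : ∀ a : K, a ≠ 0 → ∀ φ ψ : 𝓢(ι → K, ℂ),
      (∀ x, ψ x = φ (scaleOn {i} a (scaleOn {j} a⁻¹ x))) → F.comp A ψ = F.comp A φ := by
    intro a ha φ ψ hψ
    obtain ⟨χ, hχ, hFχ⟩ := hT a ha (A φ)
    rw [ContinuousLinearMap.comp_apply, ContinuousLinearMap.comp_apply, ← hFχ]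
    refine apply_eq_of_graph hh hW hkill fun x hx => ?_
    obtain ⟨h1, h2⟩ := ht a ha x hx
    rw [hχ, hA, hA, hψ]
    congr 1
    ext l
    rw [hSΓ _ h1]
    split_ifs with hl
    · have hli : l ≠ i := fun h => hi (h ▸ hl)
      have hlj : l ≠ j := fun h => hj (h ▸ hl)
      simp [scaleOn_apply, hli, hlj, hSΓ x hx, hl]
    · rw [h2 l hl]
      simp [scaleOn_apply, hSΓ x hx, hl]
  ext φ
  have hcomp : ∀ φ : 𝓢(ι → K, ℂ), ∃ ψ : 𝓢(ι → K, ℂ), ∀ x, ψ x = φ (x ∘ Equiv.swap i j) := fun φ =>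
    ⟨SchwartzMap.compCLMOfContinuousLinearEquiv ℂ
      (ContinuousLinearEquiv.piCongrLeft ℝ (fun _ : ι => K) (Equiv.swap i j)) φ, fun x => by
        change φ _ = _
        congr 1
        ext l
        rw [Function.comp_apply]
        obtain ⟨m, rfl⟩ := (Equiv.swap i j).surjective l
        simp [ContinuousLinearEquiv.piCongrLeft, Homeomorph.piCongrLeft]⟩
  obtain ⟨ψ, hψ⟩ := hcomp (B φ)
  have h1 := apply_swap_eq hij hinv hψ
  obtain ⟨χ, hχ, hFχ⟩ := hF (A (B φ))
  have h2 : F (A ψ) = F χ := by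
    refine apply_eq_of_graph hh hW hkill fun x hx => ?_
    obtain ⟨h3, h4⟩ := hτ x hx
    rw [hχ, hA, hA, hψ]
    congr 1
    ext l
    rw [hSΓ _ h3, Function.comp_apply, hSΓ x hx]
    have hmem : Equiv.swap i j l ∈ W ↔ l ∈ W := by
      by_cases hli : l = i
      · subst hli; simp [hi, hj]
      · by_cases hlj : l = j
        · subst hlj; simp [hi, hj]
        · rw [Equiv.swap_apply_of_ne_of_ne hli hlj]
    simp only [hmem]
    split_ifs with hl
    · rfl
    · rw [h4 l hl]
  simp only [ContinuousLinearMap.comp_apply, hAB] at h1 h2 hFχ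
  -- The exchange of the coordinates fixes the straightened functional, and the involution changes
  -- its sign, so F φ = -F φ.
  rw [h1, hFχ] at h2
  simpa using self_eq_neg.1 h2

end Coordinates

end Kills

/-! ### Functionals supported on the zero set of a function -/

noncomputable section Nilpotent

set_option linter.unusedSectionVars false

open scoped ContDiff
open MeasureTheory Set

variable {E K : Type*} [NormedAddCommGroup E] [NormedSpace ℝ E] [RCLike K]

/-- By the Leibniz and chain rules, each derivative falling on g(c P) costs one factor c; the growth
of P is absorbed by the decay of φ. -/
theorem exists_seminorm_comp_smul_le {P : E → K} (hP : P.HasTemperateGrowth) {g : K → ℂ}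
    (hg : ContDiff ℝ ∞ g) (hgc : HasCompactSupport g) (φ : 𝓢(E, ℂ)) (k l : ℕ) :
    ∃ C : ℝ, 0 ≤ C ∧ ∀ c : ℝ, 1 ≤ c →
      SchwartzMap.seminorm ℂ k l (mulBy (fun x => g (c • P x)) φ) ≤ C * c ^ l := by
  have hgt := hgc.hasTemperateGrowth hg
  obtain ⟨q, B, hB0, hB⟩ := hP.norm_iteratedFDeriv_le_uniform l
  have hgb : ∃ A : ℝ, 0 ≤ A ∧ ∀ i ≤ l, ∀ w, ‖iteratedFDeriv ℝ i g w‖ ≤ A := by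
    have h : ∀ i, ∃ A : ℝ, ∀ w, ‖iteratedFDeriv ℝ i g w‖ ≤ A := fun i =>
      (hgc.iteratedFDeriv i).exists_bound_of_continuous
        (hg.continuous_iteratedFDeriv (by exact_mod_cast le_top))
    choose A hA using h
    have hA0 : ∀ i, 0 ≤ A i := fun i => (norm_nonneg _).trans (hA i 0)
    refine ⟨∑ i ∈ Finset.range (l + 1), A i, Finset.sum_nonneg fun i _ => hA0 i,
      fun i hi w => (hA i w).trans ?_⟩
    exact Finset.single_le_sum (fun i _ => hA0 i) (Finset.mem_range.2 (Nat.lt_succ_of_le hi))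
  obtain ⟨A, hA0, hA⟩ := hgb
  choose M hM0 hM using fun i => φ.one_add_norm_pow_mul_norm_iteratedFDeriv_le (k + q * i) (l - i)
  refine ⟨∑ i ∈ Finset.range (l + 1), (l.choose i : ℝ) * (i.factorial * A * (1 + B) ^ i * M i),
    Finset.sum_nonneg fun i _ => by have := hM0 i; positivity, fun c hc => ?_⟩
  have hc0 : 0 ≤ c := zero_le_one.trans hc
  have hcP : (fun x => c • P x).HasTemperateGrowth :=
    (Function.HasTemperateGrowth.const c).fun_smul hP
  refine SchwartzMap.seminorm_le_bound ℂ k l _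
    (mul_nonneg (Finset.sum_nonneg fun i _ => by have := hM0 i; positivity) (by positivity))
    fun x => ?_
  have hfun : ⇑(mulBy (fun x => g (c • P x)) φ) = fun x => g (c • P x) * φ x :=
    funext fun x => mulBy_apply (hgt.comp hcP) φ x
  have hcomp : ∀ i ≤ l, ‖iteratedFDeriv ℝ i (fun x => g (c • P x)) x‖ ≤
      i.factorial * A * (c * ((1 + B) * (1 + ‖x‖) ^ q)) ^ i := by
    intro i hi
    refine norm_iteratedFDeriv_comp_le (g := g) (f := fun x => c • P x) hg hcP.1
      (by exact_mod_cast le_top) x (fun j hj => hA j (hj.trans hi) _) fun j hj1 hj => ?_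
    rw [iteratedFDeriv_const_smul_apply' (hP.1.contDiffAt.of_le (by exact_mod_cast le_top)),
      norm_smul, Real.norm_of_nonneg hc0]
    have h1 : (1 : ℝ) ≤ (1 + ‖x‖) ^ q := one_le_pow₀ (by linarith [norm_nonneg x])
    have h2 : 1 ≤ c * ((1 + B) * (1 + ‖x‖) ^ q) :=
      one_le_mul_of_one_le_of_one_le hc (one_le_mul_of_one_le_of_one_le (by linarith) h1)
    refine le_trans ?_ (le_self_pow₀ h2 (by omega))
    gcongr
    refine (hB j (hj.trans hi) x).trans ?_
    gcongr
    linarith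
  rw [hfun]
  calc ‖x‖ ^ k * ‖iteratedFDeriv ℝ l (fun x => g (c • P x) * φ x) x‖
      ≤ ‖x‖ ^ k * ∑ i ∈ Finset.range (l + 1), (l.choose i : ℝ) *
          ‖iteratedFDeriv ℝ i (fun x => g (c • P x)) x‖ * ‖iteratedFDeriv ℝ (l - i) φ x‖ := by
        gcongr
        exact norm_iteratedFDeriv_mul_le (N := ∞) (hg.comp hcP.1) (φ.smooth ⊤) x
          (by exact_mod_cast le_top)
    _ = ∑ i ∈ Finset.range (l + 1), ‖x‖ ^ k * ((l.choose i : ℝ) *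
          ‖iteratedFDeriv ℝ i (fun x => g (c • P x)) x‖ * ‖iteratedFDeriv ℝ (l - i) φ x‖) :=
        Finset.mul_sum _ _ _
    _ ≤ ∑ i ∈ Finset.range (l + 1),
          ((l.choose i : ℝ) * (i.factorial * A * (1 + B) ^ i * M i)) * c ^ l := by
        refine Finset.sum_le_sum fun i hi => ?_
        have hil : i ≤ l := Nat.lt_succ_iff.1 (Finset.mem_range.1 hi)
        calc ‖x‖ ^ k * ((l.choose i : ℝ) *
              ‖iteratedFDeriv ℝ i (fun x => g (c • P x)) x‖ * ‖iteratedFDeriv ℝ (l - i) φ x‖)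
            ≤ (1 + ‖x‖) ^ k * ((l.choose i : ℝ) *
              (i.factorial * A * (c * ((1 + B) * (1 + ‖x‖) ^ q)) ^ i) *
                ‖iteratedFDeriv ℝ (l - i) φ x‖) := by
              gcongr
              · linarith
              · exact hcomp i hil
          _ = (l.choose i : ℝ) * (i.factorial * A * (1 + B) ^ i *
              ((1 + ‖x‖) ^ (k + q * i) * ‖iteratedFDeriv ℝ (l - i) φ x‖)) * c ^ i := by
              rw [pow_add, pow_mul, mul_pow, mul_pow]; ring
          _ ≤ _ := by
              have := hM0 i
              gcongr
              · exact hM i x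
    _ = _ := (Finset.sum_mul _ _ _).symm

/-- Continuity bounds `F` by finitely many seminorms, and n is the largest number of derivatives
among them. It depends on `F` only, not on P, g or φ. -/
theorem exists_order (F : 𝓢(E, ℂ) →L[ℂ] ℂ) : ∃ n : ℕ, ∀ {P : E → K}, P.HasTemperateGrowth →
    ∀ {g : K → ℂ}, ContDiff ℝ ∞ g → HasCompactSupport g → ∀ φ : 𝓢(E, ℂ), ∃ C : ℝ, 0 ≤ C ∧
      ∀ c : ℝ, 1 ≤ c → ‖F (mulBy (fun x => g (c • P x)) φ)‖ ≤ C * c ^ n := by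
  obtain ⟨s, C, -, h⟩ := Seminorm.bound_of_continuous (schwartz_withSeminorms ℂ E ℂ)
    ((normSeminorm ℂ ℂ).comp F.toLinearMap) (by exact F.continuous.norm)
  refine ⟨s.sup Prod.snd, fun {P} hP {g} hg hgc φ => ?_⟩
  choose D hD0 hD using fun p : ℕ × ℕ => exists_seminorm_comp_smul_le hP hg hgc φ p.1 p.2
  refine ⟨C * ∑ p ∈ s, D p, mul_nonneg C.2 (Finset.sum_nonneg fun p _ => hD0 p), fun c hc => ?_⟩
  have h1 := h (mulBy (fun x => g (c • P x)) φ)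
  refine (show ‖F (mulBy (fun x => g (c • P x)) φ)‖ ≤
    (C : ℝ) * s.sup (schwartzSeminormFamily ℂ E ℂ) (mulBy (fun x => g (c • P x)) φ) from h1).trans ?_
  rw [mul_assoc]
  refine mul_le_mul_of_nonneg_left ?_ C.2
  refine Seminorm.finset_sup_apply_le
    (mul_nonneg (Finset.sum_nonneg fun p _ => hD0 p) (by positivity)) fun p hp => ?_
  refine (hD p c hc).trans ?_
  gcongr
  · exact Finset.sum_nonneg fun p _ => hD0 p
  · exact Finset.single_le_sum (fun p _ => hD0 p) hp
  · exact Finset.le_sup (f := Prod.snd) hp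

/-- A smooth function on `K` that is homogeneous of degree `N`. -/
structure IsHomogeneousFun (N : ℕ) (m : K → ℂ) : Prop where
  temperate : m.HasTemperateGrowth
  smul : ∀ (c : ℝ) (w : K), m (c • w) = (c : ℂ) ^ N * m w

theorem isHomogeneousFun_one : IsHomogeneousFun 0 fun _ : K => 1 :=
  ⟨Function.HasTemperateGrowth.const 1, fun c w => by simp⟩

theorem IsHomogeneousFun.mul_re {N : ℕ} {m : K → ℂ} (hm : IsHomogeneousFun N m) (c : K) :
    IsHomogeneousFun (N + 1) fun w => m w * RCLike.re (c * w) := by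
  refine ⟨hm.temperate.fun_mul
    (hasTemperateGrowth_reC (hasTemperateGrowth_const_mul Function.HasTemperateGrowth.id' c)),
    fun t w => ?_⟩
  rw [hm.smul, mul_smul_comm, RCLike.smul_re]
  push_cast
  ring

/-- Since `F` ignores the region away from P = 0, m(P) may be multiplied by `cutoff` (c P), which by
homogeneity yields c^(-N) g(c P) with g of compact support. The value is O(c^(n-N)) and tends to 0
as c grows. -/
theorem apply_homogeneous_eq_zero {F : 𝓢(E, ℂ) →L[ℂ] ℂ} {P : E → K} (hP : P.HasTemperateGrowth)
    (hF : ∀ c : ℝ, 0 < c → F.comp (mulBy fun x => ((1 - cutoff (c • P x) : ℝ) : ℂ)) = 0) {n N : ℕ}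
    (hn : n < N) (hord : ∀ {g : K → ℂ}, ContDiff ℝ ∞ g → HasCompactSupport g → ∀ φ : 𝓢(E, ℂ),
      ∃ C : ℝ, 0 ≤ C ∧ ∀ c : ℝ, 1 ≤ c → ‖F (mulBy (fun x => g (c • P x)) φ)‖ ≤ C * c ^ n)
    {m : K → ℂ} (hm : IsHomogeneousFun N m) : F.comp (mulBy fun x => m (P x)) = 0 := by
  ext φ
  have hg : ContDiff ℝ ∞ fun w : K => m w * (cutoff w : ℂ) :=
    hm.temperate.1.mul (Complex.ofRealCLM.contDiff.comp contDiff_cutoff)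
  have hgc : HasCompactSupport fun w : K => m w * (cutoff w : ℂ) :=
    (hasCompactSupport_cutoff.comp_left (g := Complex.ofReal) Complex.ofReal_zero).mul_left
  obtain ⟨C, hC0, hC⟩ := hord hg hgc φ
  have hmP : (fun x => m (P x)).HasTemperateGrowth := hm.temperate.comp hP
  have key : ∀ c : ℝ, 1 ≤ c → ‖F (mulBy (fun x => m (P x)) φ)‖ ≤ C / c := by
    intro c hc
    have hc0 : 0 < c := zero_lt_one.trans_le hc
    have hcP : (fun x => c • P x).HasTemperateGrowth :=
      (Function.HasTemperateGrowth.const c).fun_smul hP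
    have h1 : mulBy (fun x => m (P x)) φ =
        mulBy (fun x => ((1 - cutoff (c • P x) : ℝ) : ℂ)) (mulBy (fun x => m (P x)) φ) +
        ((c : ℂ) ^ N)⁻¹ • mulBy (fun x => m (c • P x) * (cutoff (c • P x) : ℂ)) φ := by
      ext x
      have hcut : (fun x => ((1 - cutoff (c • P x) : ℝ) : ℂ)).HasTemperateGrowth := by
        push_cast
        exact (Function.HasTemperateGrowth.const (1 : ℂ)).fun_sub
          (hasTemperateGrowth_ofReal_cutoff hcP)
      have hcN : (c : ℂ) ^ N ≠ 0 := pow_ne_zero _ (by exact_mod_cast hc0.ne')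
      have hmc : (fun x => m (c • P x) * (cutoff (c • P x) : ℂ)).HasTemperateGrowth :=
        (hm.temperate.comp hcP).fun_mul (hasTemperateGrowth_ofReal_cutoff hcP)
      rw [_root_.add_apply, _root_.smul_apply, mulBy_apply hcut, mulBy_apply hmP,
        mulBy_apply hmc, hm.smul,
        smul_eq_mul]
      push_cast
      field_simp
      ring
    have h2 := DFunLike.congr_fun (hF c hc0) (mulBy (fun x => m (P x)) φ)
    rw [ContinuousLinearMap.comp_apply, _root_.zero_apply] at h2
    rw [h1, map_add, h2, zero_add, map_smul, norm_smul, norm_inv, norm_pow, Complex.norm_real,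
      Real.norm_of_nonneg hc0.le, inv_mul_le_iff₀ (by positivity)]
    refine (hC c hc).trans ?_
    rw [mul_div_assoc', le_div_iff₀ hc0, mul_assoc, ← pow_succ, mul_comm C]
    exact mul_le_mul_of_nonneg_right (pow_le_pow_right₀ hc hn) hC0
  have hlim : Filter.Tendsto (fun c : ℝ => C / c) Filter.atTop (nhds 0) :=
    Filter.Tendsto.div_atTop tendsto_const_nhds Filter.tendsto_id
  have h0 : ‖F (mulBy (fun x => m (P x)) φ)‖ ≤ 0 :=
    ge_of_tendsto hlim (by filter_upwards [Filter.eventually_ge_atTop 1] with c hc using key c hc)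
  exact norm_le_zero_iff.1 h0

/-- A class of functionals that are supported on the zero set of `P` is trivial, as soon as
its members that are annihilated by `P` vanish. -/
theorem eq_zero_of_supported {𝒞 : (𝓢(E, ℂ) →L[ℂ] ℂ) → Prop} {P : E → K} (hP : P.HasTemperateGrowth)
    (hmul : ∀ F, 𝒞 F → ∀ c : K, 𝒞 (F.comp (mulBy (reC fun x => c * P x))))
    (hsupp : ∀ F, 𝒞 F → ∀ c : ℝ, 0 < c →
      F.comp (mulBy fun x => ((1 - cutoff (c • P x) : ℝ) : ℂ)) = 0)
    (hkill : ∀ F, 𝒞 F → Kills F P → F = 0) {F : 𝓢(E, ℂ) →L[ℂ] ℂ} (hF : 𝒞 F) : F = 0 := by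
  obtain ⟨n, hn⟩ := exists_order (K := K) F
  -- Descending induction on the degree j of a product of factors Re(c P), where k bounds the
  -- distance to a degree beyond the order of `F`. If all products with one more factor annihilate
  -- `F`, then `hkill` applies to `F` multiplied by the present one.
  have key : ∀ (k j : ℕ) (m : K → ℂ), IsHomogeneousFun j m → n < j + k →
      𝒞 (F.comp (mulBy fun x => m (P x))) → F.comp (mulBy fun x => m (P x)) = 0 := by
    intro k
    induction k with
    | zero =>
      intro j m hm hj _
      exact apply_homogeneous_eq_zero hP (hsupp F hF) (by simpa using hj) (hn hP) hm
    | succ k ih =>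
      intro j m hm hj h𝒞
      refine hkill _ h𝒞 fun c => ?_
      have h1 : (F.comp (mulBy fun x => m (P x))).comp (mulBy (reC fun x => c * P x)) =
          F.comp (mulBy fun x => m (P x) * RCLike.re (c * P x)) := by
        ext φ
        change F (mulBy (fun x => m (P x)) (mulBy (reC fun x => c * P x) φ)) =
          F (mulBy (fun x => m (P x) * RCLike.re (c * P x)) φ)
        congr 1
        ext x
        have hmP : (fun x => m (P x)).HasTemperateGrowth := hm.temperate.comp hP
        have hmc : (fun x => m (P x) * (RCLike.re (c * P x) : ℂ)).HasTemperateGrowth :=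
          (hm.mul_re c).temperate.comp hP
        rw [mulBy_apply hmP, mulBy_reC_apply hP, mulBy_apply hmc, mul_assoc]
      have h2 := hmul _ h𝒞 c
      rw [h1] at h2 ⊢
      exact ih (j + 1) _ (hm.mul_re c) (by omega) h2
  have hone : F.comp (mulBy fun _ => 1) = F := by
    ext φ
    change F (mulBy (fun _ => 1) φ) = F φ
    congr 1
    ext x
    rw [mulBy_apply (Function.HasTemperateGrowth.const 1), one_mul]
  have := key (n + 1) 0 _ isHomogeneousFun_one (by omega) (by rwa [hone])
  rwa [hone] at this

end Nilpotent

/-! ### Symmetries of functionals -/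

noncomputable section Symmetries

set_option linter.unusedSectionVars false

open scoped ContDiff LineDeriv
open MeasureTheory Set

attribute [fun_prop] hasTemperateGrowth_coord hasTemperateGrowth_nearInv hasTemperateGrowth_cutoff

@[fun_prop]
theorem hasTemperateGrowth_phase : phase.HasTemperateGrowth := by
  have h : ∀ n : ℕ, iteratedDeriv n phase = fun r => (2 * Real.pi * Complex.I) ^ n * phase r := by
    intro n
    induction n with
    | zero => ext r; simp
    | succ n ih =>
      ext r
      rw [iteratedDeriv_succ, ih, ((hasDerivAt_phase r).const_mul _).deriv, pow_succ]
      ring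
  refine ⟨?_, fun n => ⟨0, ‖(2 * Real.pi * Complex.I : ℂ)‖ ^ n, fun r => ?_⟩⟩
  · have h1 : ContDiff ℝ ∞ fun r : ℝ => ((2 * Real.pi * r : ℝ) : ℂ) :=
      Complex.ofRealCLM.contDiff.comp (contDiff_const.mul contDiff_id)
    exact (h1.mul contDiff_const).cexp
  · rw [norm_iteratedFDeriv_eq_norm_iteratedDeriv, h, norm_mul, norm_phase, norm_pow, pow_zero]

@[fun_prop]
theorem Function.HasTemperateGrowth.ofReal {E : Type*} [NormedAddCommGroup E] [NormedSpace ℝ E]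
    {f : E → ℝ} (hf : f.HasTemperateGrowth) : (fun x => (f x : ℂ)).HasTemperateGrowth :=
  Complex.ofRealCLM.hasTemperateGrowth.comp hf

@[fun_prop]
theorem Function.HasTemperateGrowth.rclike_re {E K : Type*} [NormedAddCommGroup E]
    [NormedSpace ℝ E] [RCLike K] {f : E → K} (hf : f.HasTemperateGrowth) :
    (fun x => RCLike.re (f x)).HasTemperateGrowth :=
  (RCLike.reCLM (K := K)).hasTemperateGrowth.comp hf

@[fun_prop]
theorem Function.HasTemperateGrowth.rclike_im {E K : Type*} [NormedAddCommGroup E]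
    [NormedSpace ℝ E] [RCLike K] {f : E → K} (hf : f.HasTemperateGrowth) :
    (fun x => RCLike.im (f x)).HasTemperateGrowth :=
  (RCLike.imCLM (K := K)).hasTemperateGrowth.comp hf

variable {E : Type*} [NormedAddCommGroup E] [NormedSpace ℝ E]

theorem fderiv_apply_eq_of_line {m : E → ℂ} {x v : E} (hm : DifferentiableAt ℝ m x) {q : ℝ}
    (h : ∀ t : ℝ, m (x + t • v) = phase (t * q) * m x) :
    fderiv ℝ m x v = 2 * Real.pi * Complex.I * q * m x := by
  have h1 : HasDerivAt (fun t : ℝ => m (x + t • v)) (fderiv ℝ m x v) 0 := by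
    have h2 : HasDerivAt (fun t : ℝ => x + t • v) v 0 := by
      simpa using ((hasDerivAt_id (0 : ℝ)).smul_const v).const_add x
    have h3 : HasFDerivAt m (fderiv ℝ m x) (x + (0 : ℝ) • v) := by
      simpa using hm.hasFDerivAt
    exact h3.comp_hasDerivAt 0 h2
  have h2 : HasDerivAt (fun t : ℝ => phase (t * q) * m x) (2 * Real.pi * Complex.I * q * m x) 0 := by
    have h3 : HasDerivAt (fun t : ℝ => t * q) q 0 := by
      simpa using (hasDerivAt_id (0 : ℝ)).mul_const q
    have h4 : HasDerivAt phase (2 * Real.pi * Complex.I * phase (0 * q)) (0 * q) :=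
      hasDerivAt_phase _
    have h5 := (h4.scomp 0 h3).mul_const (m x)
    simp only [zero_mul, phase_zero, mul_one, Complex.real_smul] at h5
    exact h5.congr_deriv (by ring)
  rw [← h1.unique (h2.congr_of_eventuallyEq (.of_forall h))]

/-- Multiplication by m conjugates the derivative along v into itself plus 2πi q. The case q = 0
covers multipliers constant along v. -/
theorem fderiv_mul_apply_of_line {m : E → ℂ} {φ ψ : 𝓢(E, ℂ)} {x v : E}
    (hm : DifferentiableAt ℝ m x) {q : ℝ} (h : ∀ t : ℝ, m (x + t • v) = phase (t * q) * m x)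
    (hψ : ∀ x, ψ x = m x * φ x) :
    fderiv ℝ ψ x v = m x * (2 * Real.pi * Complex.I * q * φ x + fderiv ℝ φ x v) := by
  rw [show (ψ : E → ℂ) = fun x => m x * φ x from funext hψ,
    fderiv_fun_mul hm φ.differentiableAt]
  simp only [_root_.add_apply, _root_.smul_apply, smul_eq_mul]
  rw [fderiv_apply_eq_of_line hm h]
  ring

section Coordinates

variable {ι K : Type*} [Fintype ι] [DecidableEq ι] [RCLike K] {F : 𝓢(ι → K, ℂ) →L[ℂ] ℂ}

theorem exists_fderiv_single (φ : 𝓢(ι → K, ℂ)) (k : ι) {h : (ι → K) → K}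
    (hh : h.HasTemperateGrowth) :
    ∃ ψ : 𝓢(ι → K, ℂ), ∀ x, ψ x = fderiv ℝ φ x (Pi.single k (h x)) := by
  refine ⟨mulBy (fun x => ((RCLike.re (h x) : ℝ) : ℂ)) (∂_{(Pi.single k 1 : ι → K)} φ) +
    mulBy (fun x => ((RCLike.im (h x) : ℝ) : ℂ)) (∂_{(Pi.single k RCLike.I : ι → K)} φ),
    fun x => ?_⟩
  rw [_root_.add_apply, mulBy_apply (by fun_prop), mulBy_apply (by fun_prop),
    SchwartzMap.lineDerivOp_apply_eq_fderiv, SchwartzMap.lineDerivOp_apply_eq_fderiv,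
    ← Complex.real_smul, ← Complex.real_smul, ← map_smul, ← map_smul, ← map_add]
  congr 1
  rw [← Pi.single_smul, ← Pi.single_smul, ← Pi.single_add]
  congr 1
  rw [RCLike.real_smul_eq_coe_mul, RCLike.real_smul_eq_coe_mul, mul_one, RCLike.re_add_im]

theorem exists_comp_diag (φ : 𝓢(ι → K, ℂ)) {s : ι → K} (hs : ∀ k, s k ≠ 0) :
    ∃ ψ : 𝓢(ι → K, ℂ), ∀ x, ψ x = φ (s * x) :=
  ⟨SchwartzMap.compCLMOfContinuousLinearEquiv ℂ (ContinuousLinearEquiv.piCongrRight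
    fun k => (LinearEquiv.smulOfNeZero K K (s k) (hs k)).restrictScalars ℝ
      |>.toContinuousLinearEquiv) φ, fun _ => rfl⟩

theorem exists_comp_perm (φ : 𝓢(ι → K, ℂ)) (σ : Equiv.Perm ι) :
    ∃ ψ : 𝓢(ι → K, ℂ), ∀ x, ψ x = φ (x ∘ σ) :=
  ⟨SchwartzMap.compCLMOfContinuousLinearEquiv ℂ
    (LinearEquiv.funCongrLeft ℝ K σ).toContinuousLinearEquiv φ, fun _ => rfl⟩

/-- Invariance under a diagonal linear map. -/
def DiagInv (F : 𝓢(ι → K, ℂ) →L[ℂ] ℂ) (s : ι → K) : Prop :=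
  ∀ φ ψ : 𝓢(ι → K, ℂ), (∀ x, ψ x = φ (s * x)) → F ψ = F φ

/-- Anti-invariance under a permutation of the coordinates. -/
def PermAnti (F : 𝓢(ι → K, ℂ) →L[ℂ] ℂ) (σ : Equiv.Perm ι) : Prop :=
  ∀ φ ψ : 𝓢(ι → K, ℂ), (∀ x, ψ x = φ (x ∘ σ)) → F ψ = -F φ

/-- The weights on the transformed coordinates are inverted; the condition that their norms have
product 1 removes the Jacobian. -/
theorem DiagInv.comp_pftList_inverse {s : ι → K} (h : DiagInv F s) (hs : ∀ k, s k ≠ 0) {l : List ι}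
    (hl : l.Nodup) (hsl : (l.map fun k => ‖s k‖).prod = 1) {V : 𝓢(ι → K, ℂ) →L[ℂ] 𝓢(ι → K, ℂ)}
    (hV : ∀ φ, pftList l (V φ) = φ) (hV' : ∀ φ, V (pftList l φ) = φ) :
    DiagInv (F.comp V) fun k => if k ∈ l then (s k)⁻¹ else s k := by
  intro φ ψ hψ
  obtain ⟨χ, hχ⟩ := exists_comp_diag (V φ) hs
  have : pftList l χ = ψ := by
    ext x
    rw [pftList_comp_diag hl hs hχ, hsl, hV, hψ]
    simp
  change F (V ψ) = F (V φ)
  rw [← this, hV']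
  exact h _ _ hχ

theorem PermAnti.comp_pftList_inverse {σ : Equiv.Perm ι} (h : PermAnti F σ) {l : List ι}
    (hl : (l.map σ.symm).Perm l) {V : 𝓢(ι → K, ℂ) →L[ℂ] 𝓢(ι → K, ℂ)}
    (hV : ∀ φ, pftList l (V φ) = φ) (hV' : ∀ φ, V (pftList l φ) = φ) :
    PermAnti (F.comp V) σ := by
  intro φ ψ hψ
  obtain ⟨χ, hχ⟩ := exists_comp_perm (V φ) σ
  have : pftList l χ = ψ := by
    ext x
    rw [pftList_comp_perm σ hχ, pftList_perm hl, hV, hψ]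
  change F (V ψ) = -F (V φ)
  rw [← this, hV']
  exact h _ _ hχ

theorem DiagInv.comp_mulBy {s : ι → K} (h : DiagInv F s) {m : (ι → K) → ℂ}
    (hm : m.HasTemperateGrowth) (hms : ∀ x, m (s * x) = m x) : DiagInv (F.comp (mulBy m)) s :=
  fun φ ψ hψ => h (mulBy m φ) (mulBy m ψ) fun x => by rw [mulBy_apply hm, mulBy_apply hm, hψ, hms]

/-- The multiplier need not be invariant under σ: it suffices that `F` does not distinguish it from
its transform. This is what happens for the entries (2, 0) and (0, 2). -/
theorem PermAnti.comp_mulBy {σ : Equiv.Perm ι} (h : PermAnti F σ) {m m' : (ι → K) → ℂ}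
    (hm : m.HasTemperateGrowth) (hm' : m'.HasTemperateGrowth) (hms : ∀ x, m' (x ∘ σ) = m x)
    (hF : ∀ φ, F (mulBy m' φ) = F (mulBy m φ)) : PermAnti (F.comp (mulBy m)) σ := by
  intro φ ψ hψ
  change F (mulBy m ψ) = -F (mulBy m φ)
  rw [← hF φ]
  exact h _ _ fun x => by rw [mulBy_apply hm, mulBy_apply hm', hψ, hms]

theorem PermAnti.comp_mulBy_of_invariant {σ : Equiv.Perm ι} (h : PermAnti F σ) {m : (ι → K) → ℂ}
    (hm : m.HasTemperateGrowth) (hms : ∀ x, m (x ∘ σ) = m x) : PermAnti (F.comp (mulBy m)) σ :=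
  h.comp_mulBy hm hm hms fun _ => rfl

/-- The permutation is compared with the exchange of i and j only at points of the graph and only in
the free coordinates. This leaves room for free coordinates that σ moves into `W`. -/
theorem eq_zero_of_graph_of_symmetric {W : Finset ι} {h : ι → (ι → K) → K}
    (hh : ∀ k ∈ W, (h k).HasTemperateGrowth) (hW : DependsOff W h)
    (hkill : ∀ k ∈ W, Kills F fun x => x k - h k x) {i j : ι} (hij : i ≠ j) (hi : i ∉ W) (hj : j ∉ W)
    {s : K → ι → K} (hs : ∀ a, a ≠ 0 → ∀ k, s a k ≠ 0)
    (hsW : ∀ a l, l ∉ W → s a l = if l = i then a else if l = j then a⁻¹ else 1)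
    (hgs : ∀ a, a ≠ 0 → ∀ x ∈ graphSet W h, s a * x ∈ graphSet W h)
    (hT : ∀ a, a ≠ 0 → DiagInv F (s a)) {σ : Equiv.Perm ι}
    (hσ : ∀ x ∈ graphSet W h, x ∘ σ ∈ graphSet W h ∧ ∀ l ∉ W, x (σ l) = x (Equiv.swap i j l))
    (hF : PermAnti F σ) : F = 0 := by
  refine eq_zero_of_graph hh hW hkill hij hi hj (t := fun a x => s a * x) (τ := fun x => x ∘ σ)
    (fun a ha x hx => ⟨hgs a ha x hx, fun l hl => ?_⟩) (fun a ha φ => ?_) hσ (fun φ => ?_)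
  · rw [Pi.mul_apply, hsW a l hl, scaleOn_apply, scaleOn_apply]
    by_cases h1 : l = i
    · subst h1; simp [hij]
    · by_cases h2 : l = j
      · subst h2; simp [h1]
      · simp [h1, h2]
  · obtain ⟨ψ, hψ⟩ := exists_comp_diag φ (hs a ha)
    exact ⟨ψ, hψ, hT a ha _ _ hψ⟩
  · obtain ⟨ψ, hψ⟩ := exists_comp_perm φ σ
    exact ⟨ψ, hψ, hF _ _ hψ⟩

end Coordinates

end Symmetries

/-! ### The functional after the partial Fourier transform -/

noncomputable section Model

set_option linter.unusedSectionVars false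

open scoped ContDiff LineDeriv
open MeasureTheory Set

variable {K : Type*} [RCLike K]

namespace GL3Model

/-- The entries of the last row and the last column, except the corner. -/
def arms : Finset (Fin 3 × Fin 3) := {(0, 2), (1, 2), (2, 0), (2, 1)}

/-- The functions that occur in the equations of the unipotent radicals. -/
def armEqn (lam : K) (k : Fin 3 × Fin 3) (x : Fin 3 × Fin 3 → K) : K :=
  if k = (0, 2) then x (2, 0) * x (0, 0) + x (2, 1) * x (0, 1) + lam
  else if k = (1, 2) then x (2, 0) * x (1, 0) + x (2, 1) * x (1, 1)
  else if k = (2, 0) then x (0, 2) * x (0, 0) + x (1, 2) * x (1, 0) + lam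
  else x (0, 2) * x (0, 1) + x (1, 2) * x (1, 1)

/-- The potential of the functions `armEqn`. -/
def potential (lam : K) (x : Fin 3 × Fin 3 → K) : K :=
  x (0, 2) * (x (2, 0) * x (0, 0) + x (2, 1) * x (0, 1) + lam) +
    x (1, 2) * (x (2, 0) * x (1, 0) + x (2, 1) * x (1, 1)) + lam * x (2, 0)

/-- The weights of the torus. -/
def torus (a : K) (k : Fin 3 × Fin 3) : K :=
  if k = (1, 0) ∨ k = (2, 1) then a else if k = (0, 1) ∨ k = (1, 2) then a⁻¹ else 1

/-- Transposition, as a permutation of the entries. -/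
def transp : Equiv.Perm (Fin 3 × Fin 3) := Equiv.prodComm _ _

@[simp] theorem transp_apply (i j : Fin 3) : transp (i, j) = (j, i) := rfl

theorem torus_ne_zero {a : K} (ha : a ≠ 0) (k : Fin 3 × Fin 3) : torus a k ≠ 0 := by
  unfold torus
  split_ifs <;> simp [ha]

@[fun_prop]
theorem hasTemperateGrowth_armEqn (lam : K) (k : Fin 3 × Fin 3) :
    (armEqn lam k).HasTemperateGrowth := by
  unfold armEqn
  split_ifs <;> fun_prop

@[fun_prop]
theorem hasTemperateGrowth_potential (lam : K) : (potential lam).HasTemperateGrowth := by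
  unfold potential
  fun_prop

theorem potential_torus (lam : K) {a : K} (ha : a ≠ 0) (x : Fin 3 × Fin 3 → K) :
    potential lam (torus a * x) = potential lam x := by
  simp [potential, torus]
  field_simp

theorem potential_transp (lam : K) (x : Fin 3 × Fin 3 → K) :
    potential lam (x ∘ transp) = potential lam x := by
  simp [potential]
  ring

/-- The potential is affine in each arm entry with slope `armEqn`, so the arm equations have a
common integrating factor. -/
theorem potential_add_single (lam : K) {k : Fin 3 × Fin 3} (hk : k ∈ arms) (t : ℝ) (d : K)
    (x : Fin 3 × Fin 3 → K) :
    potential lam (x + t • (Pi.single k d : Fin 3 × Fin 3 → K)) = potential lam x + t • (d * armEqn lam k x) := by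
  simp only [arms, Finset.mem_insert, Finset.mem_singleton] at hk
  rcases hk with rfl | rfl | rfl | rfl <;>
    simp [potential, armEqn, RCLike.real_smul_eq_coe_mul] <;> ring

theorem corner_add_single {k : Fin 3 × Fin 3} (hk : k ∈ arms) (t : ℝ) (d : K)
    (x : Fin 3 × Fin 3 → K) : (x + t • (Pi.single k d : Fin 3 × Fin 3 → K) : Fin 3 × Fin 3 → K) (2, 2) = x (2, 2) := by
  simp only [arms, Finset.mem_insert, Finset.mem_singleton] at hk
  rcases hk with rfl | rfl | rfl | rfl <;> simp

/-- The properties of the partial Fourier transform of an equivariant functional that are used in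
the proof of its vanishing. -/
structure Model (lam : K) (F : 𝓢(Fin 3 × Fin 3 → K, ℂ) →L[ℂ] ℂ) : Prop where
  inv : ∀ a, a ≠ 0 → DiagInv F (torus a)
  anti : PermAnti F transp
  eqn : ∀ k ∈ arms, ∀ (c : K) (φ ψ : 𝓢(Fin 3 × Fin 3 → K, ℂ)),
    (∀ x, ψ x = 2 * Real.pi * Complex.I * RCLike.re (c * armEqn lam k x) * φ x +
      fderiv ℝ φ x (Pi.single k (c * x (2, 2)))) → F ψ = 0

variable {lam : K} {F : 𝓢(Fin 3 × Fin 3 → K, ℂ) →L[ℂ] ℂ}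

theorem exists_eqn (lam c : K) (k : Fin 3 × Fin 3) (φ : 𝓢(Fin 3 × Fin 3 → K, ℂ)) :
    ∃ ψ : 𝓢(Fin 3 × Fin 3 → K, ℂ), ∀ x,
      ψ x = 2 * Real.pi * Complex.I * RCLike.re (c * armEqn lam k x) * φ x +
        fderiv ℝ φ x (Pi.single k (c * x (2, 2))) := by
  obtain ⟨χ, hχ⟩ := exists_fderiv_single φ k
    (hasTemperateGrowth_const_mul (hasTemperateGrowth_coord (K := K) (2, 2)) c)
  refine ⟨mulBy (fun x => 2 * Real.pi * Complex.I * RCLike.re (c * armEqn lam k x)) φ + χ,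
    fun x => ?_⟩
  rw [_root_.add_apply, hχ, mulBy_apply (by fun_prop)]

/-- Functions of the corner are fixed by the torus and by transposition and are constant along the
arms, so they commute with every condition. -/
theorem Model.comp_mulBy (hF : Model lam F) {μ : K → ℂ} (hμ : μ.HasTemperateGrowth) :
    Model lam (F.comp (mulBy fun x => μ (x (2, 2)))) := by
  have hm : (fun x : Fin 3 × Fin 3 → K => μ (x (2, 2))).HasTemperateGrowth :=
    hμ.comp (hasTemperateGrowth_coord (K := K) (2, 2))
  refine ⟨fun a ha => (hF.inv a ha).comp_mulBy hm fun x => by simp [torus],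
    hF.anti.comp_mulBy_of_invariant hm fun x => rfl, fun k hk c φ ψ hψ => ?_⟩
  change F (mulBy (fun x => μ (x (2, 2))) ψ) = 0
  refine hF.eqn k hk c (mulBy (fun x => μ (x (2, 2))) φ) _ fun x => ?_
  rw [mulBy_apply hm, mulBy_apply hm, fderiv_mul_apply_of_line (q := 0)
    (hm.1.differentiable (by simp) x) (fun t => ?_) (mulBy_apply hm φ), hψ]
  · push_cast
    ring
  · rw [corner_add_single hk, mul_zero, phase_zero, one_mul]

/-- Allows the constant c in the equations to vary with the corner, so that c can be taken to be w
divided by x₂₂ where the corner is invertible. -/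
theorem Model.apply_eqn (hF : Model lam F) {k : Fin 3 × Fin 3} (hk : k ∈ arms) {η : K → K}
    (hη : η.HasTemperateGrowth) {φ ψ : 𝓢(Fin 3 × Fin 3 → K, ℂ)}
    (hψ : ∀ x, ψ x = 2 * Real.pi * Complex.I * RCLike.re (η (x (2, 2)) * armEqn lam k x) * φ x +
      fderiv ℝ φ x (Pi.single k (η (x (2, 2)) * x (2, 2)))) : F ψ = 0 := by
  have hη' : (fun x : Fin 3 × Fin 3 → K => η (x (2, 2))).HasTemperateGrowth :=
    hη.comp (hasTemperateGrowth_coord (K := K) (2, 2))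
  have hre : (fun x : Fin 3 × Fin 3 → K => ((RCLike.re (η (x (2, 2))) : ℝ) : ℂ)).HasTemperateGrowth := by
    fun_prop
  have him : (fun x : Fin 3 × Fin 3 → K => ((RCLike.im (η (x (2, 2))) : ℝ) : ℂ)).HasTemperateGrowth := by
    fun_prop
  obtain ⟨ψ₁, h₁⟩ := exists_eqn lam 1 k
    (mulBy (fun x => ((RCLike.re (η (x (2, 2))) : ℝ) : ℂ)) φ)
  obtain ⟨ψ₂, h₂⟩ := exists_eqn lam RCLike.I k
    (mulBy (fun x => ((RCLike.im (η (x (2, 2))) : ℝ) : ℂ)) φ)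
  have : ψ = ψ₁ + ψ₂ := by
    ext x
    have hs : (Pi.single k (η (x (2, 2)) * x (2, 2)) : Fin 3 × Fin 3 → K) =
        (RCLike.re (η (x (2, 2))) : ℝ) • (Pi.single k (1 * x (2, 2)) : Fin 3 × Fin 3 → K) +
        (RCLike.im (η (x (2, 2))) : ℝ) • (Pi.single k (RCLike.I * x (2, 2)) : Fin 3 × Fin 3 → K) := by
      rw [← Pi.single_smul, ← Pi.single_smul, ← Pi.single_add]
      congr 1
      rw [RCLike.real_smul_eq_coe_mul, RCLike.real_smul_eq_coe_mul, ← mul_assoc, ← mul_assoc,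
        ← add_mul, mul_one, RCLike.re_add_im]
    rw [_root_.add_apply, h₁, h₂, mulBy_apply hre, mulBy_apply him,
      fderiv_mul_apply_of_line (q := 0) (hre.1.differentiable (by simp) x) (fun t => ?_)
        (mulBy_apply hre φ),
      fderiv_mul_apply_of_line (q := 0) (him.1.differentiable (by simp) x) (fun t => ?_)
        (mulBy_apply him φ), hψ, hs, map_add, map_smul, map_smul, re_mul_eq, Complex.real_smul,
        Complex.real_smul]
    · push_cast
      ring
    · rw [corner_add_single hk, mul_zero, phase_zero, one_mul]
    · rw [corner_add_single hk, mul_zero, phase_zero, one_mul]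
  rw [this, map_add, hF.eqn k hk 1 _ _ h₁, hF.eqn k hk RCLike.I _ _ h₂, add_zero]

/-- A functional that is invariant under translations in the arms, invariant under the torus and
anti-invariant under transposition vanishes. -/
theorem eq_zero_of_lineDeriv {G : 𝓢(Fin 3 × Fin 3 → K, ℂ) →L[ℂ] ℂ}
    (hinv : ∀ a, a ≠ 0 → DiagInv G (torus a)) (hanti : PermAnti G transp)
    (hG : ∀ k ∈ arms, ∀ (w : K) (φ ψ : 𝓢(Fin 3 × Fin 3 → K, ℂ)),
      (∀ x, ψ x = fderiv ℝ φ x (Pi.single k w)) → G ψ = 0) : G = 0 := by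
  obtain ⟨V, hV, hV'⟩ := exists_pftList_inverse (K := K)
    ([(0, 2), (1, 2), (2, 0), (2, 1)] : List (Fin 3 × Fin 3))
  have hl : ([(0, 2), (1, 2), (2, 0), (2, 1)] : List (Fin 3 × Fin 3)).Nodup := by decide
  have hmem : ∀ k, k ∈ ([(0, 2), (1, 2), (2, 0), (2, 1)] : List (Fin 3 × Fin 3)) ↔ k ∈ arms := by
    decide
  suffices h : G.comp V = 0 by
    ext φ
    rw [← hV' φ]
    exact DFunLike.congr_fun h _
  -- Translation invariance becomes, after a Fourier transform in the arms, annihilation by the four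
  -- arm coordinates. On the remaining subspace the torus acts only on the entries (1, 0) and (0,
  -- 1); its inverted weights on the arms play no role.
  refine eq_zero_of_graph_of_symmetric (W := arms) (h := fun _ _ => 0) (i := (1, 0)) (j := (0, 1))
    (fun k _ => Function.HasTemperateGrowth.const 0) (fun k _ x y _ => rfl) ?_ (by decide)
    (by decide) (by decide) (fun a ha k => ?_) ?_ ?_
    (fun a ha => (hinv a ha).comp_pftList_inverse (torus_ne_zero ha) hl ?_ hV hV') ?_
    (hanti.comp_pftList_inverse ?_ hV hV')
  · intro k hk
    simp only [sub_zero]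
    refine (kills_iff (hasTemperateGrowth_coord k)).2 fun c φ χ hχ => ?_
    obtain ⟨ψ, hψ⟩ := exists_fderiv_single (V φ) k
      (Function.HasTemperateGrowth.const (E := Fin 3 × Fin 3 → K) c)
    have h1 := pftList_fderiv_single hl (fun _ _ _ _ => rfl) hψ
    have h2 : pftList [(0, 2), (1, 2), (2, 0), (2, 1)] ψ = (2 * Real.pi * Complex.I : ℂ) • χ := by
      ext x
      rw [h1, if_pos ((hmem k).2 hk), hV, _root_.smul_apply, hχ, smul_eq_mul, mul_assoc]
    have h3 : (2 * Real.pi * Complex.I : ℂ) * G (V χ) = 0 := by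
      rw [← smul_eq_mul, ← map_smul, ← map_smul, ← h2, hV']
      exact hG k hk c _ _ hψ
    exact (mul_eq_zero.1 h3).resolve_left Complex.two_pi_I_ne_zero
  · split_ifs
    · exact inv_ne_zero (torus_ne_zero ha k)
    · exact torus_ne_zero ha k
  · intro a l hl
    rw [if_neg (mt (hmem l).1 hl)]
    revert hl
    obtain ⟨i, j⟩ := l
    fin_cases i <;> fin_cases j <;> simp [torus, arms]
  · intro a ha x hx k hk
    rw [Pi.mul_apply, hx k hk, mul_zero]
  · simp [torus, ha]
  · intro x hx
    refine ⟨fun k hk => hx _ ?_, fun l hl => congrArg x ?_⟩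
    · revert k; decide
    · revert l; decide
  · decide

/-- The inverse of `w ↦ c w` near infinity. -/
def farInv (c : ℝ) (w : K) : K := c • nearInv (c • w)

@[fun_prop]
theorem hasTemperateGrowth_farInv (c : ℝ) : (farInv (K := K) c).HasTemperateGrowth := by
  unfold farInv
  fun_prop

/-- The factor c in `farInv` compensates the inner scaling, so that w itself is inverted. -/
theorem farInv_mul_self {c : ℝ} {w : K} (h : 1 - cutoff (c • w) ≠ 0) : farInv c w * w = 1 := by
  rw [farInv, smul_mul_assoc, ← mul_smul_comm, nearInv_mul_self h]

/-- A gauge transformation: where x₂₂ is invertible, multiplication by exp(-2πi Re(potential/x₂₂))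
cancels the zeroth order terms of the arm equations. The result is invariant under translations in
the arms and vanishes by `eq_zero_of_lineDeriv`. -/
theorem Model.corner_supported (hF : Model lam F) (c : ℝ) :
    F.comp (mulBy fun x => ((1 - cutoff (c • x (2, 2)) : ℝ) : ℂ)) = 0 := by
  set q : (Fin 3 × Fin 3 → K) → ℝ := fun x => RCLike.re (farInv c (x (2, 2)) * potential lam x)
    with hq
  have hqt : q.HasTemperateGrowth := by fun_prop
  set m : (Fin 3 × Fin 3 → K) → ℂ := fun x =>
    ((1 - cutoff (c • x (2, 2)) : ℝ) : ℂ) * phase (-q x) with hm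
  have hmt : m.HasTemperateGrowth := by fun_prop
  have h0 : F.comp (mulBy m) = 0 := by
    refine eq_zero_of_lineDeriv (fun a ha => (hF.inv a ha).comp_mulBy hmt fun x => ?_)
      (hF.anti.comp_mulBy_of_invariant hmt fun x => ?_) fun k hk w φ ψ hψ => ?_
    · simp only [hm, hq, potential_torus lam ha]
      simp [torus]
    · simp only [hm, hq, potential_transp]
      rfl
    · change F (mulBy m ψ) = 0
      -- Dividing w by x₂₂ makes the coefficient of the derivative equal to w; where the quotient is
      -- not exact, m vanishes.
      refine hF.apply_eqn hk (η := fun y => w * farInv c y) (by fun_prop) (φ := mulBy m φ) fun x => ?_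
      have hline : ∀ (d : K) (t : ℝ), m (x + t • (Pi.single k d : Fin 3 × Fin 3 → K)) =
          phase (t * -RCLike.re (farInv c (x (2, 2)) * (d * armEqn lam k x))) * m x := by
        intro d t
        simp only [hm, hq, corner_add_single hk, potential_add_single lam hk]
        rw [mul_left_comm, ← phase_add, mul_add, mul_smul_comm, map_add, RCLike.smul_re]
        congr 2
        ring
      rw [mulBy_apply hmt, mulBy_apply hmt, fderiv_mul_apply_of_line
        (hmt.1.differentiable (by simp) x) (hline _) (mulBy_apply hmt φ), hψ]
      by_cases hx : 1 - cutoff (c • x (2, 2)) = 0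
      · have hmx : m x = 0 := by rw [hm]; simp only [hx, Complex.ofReal_zero, zero_mul]
        simp only [hmx, zero_mul, mul_zero, add_zero]
      · have h1 : w * farInv c (x (2, 2)) * x (2, 2) = w := by
          rw [mul_assoc, farInv_mul_self hx, mul_one]
        rw [h1, mul_left_comm (farInv c _), ← mul_assoc w]
        push_cast
        ring
  ext φ
  -- The phase has modulus one and is undone by its inverse, which leaves the bare cut-off.
  have : mulBy (fun x : Fin 3 × Fin 3 → K => ((1 - cutoff (c • x (2, 2)) : ℝ) : ℂ)) φ =
      mulBy m (mulBy (fun x => phase (q x)) φ) := by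
    ext x
    rw [mulBy_apply (by fun_prop), mulBy_apply hmt, mulBy_apply (by fun_prop), hm]
    rw [mul_assoc, ← mul_assoc (phase _), ← phase_add, neg_add_cancel, phase_zero, one_mul]
  rw [ContinuousLinearMap.comp_apply, this]
  exact DFunLike.congr_fun h0 _

end GL3Model

end Model

/-! ### Vanishing of the transformed functional -/

noncomputable section Vanishing

set_option linter.unusedSectionVars false

open scoped ContDiff LineDeriv
open MeasureTheory Set

variable {K : Type*} [RCLike K]

/-- Ideal membership with explicit coefficients for three generators; each elimination step below is
one such identity. -/
theorem Kills.of_eq_add {E : Type*} [NormedAddCommGroup E] [NormedSpace ℝ E]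
    {F : 𝓢(E, ℂ) →L[ℂ] ℂ} {P₁ P₂ P₃ Q g₁ g₂ g₃ : E → K} (h₁ : Kills F P₁) (h₂ : Kills F P₂)
    (h₃ : Kills F P₃) (hP₁ : P₁.HasTemperateGrowth) (hP₂ : P₂.HasTemperateGrowth)
    (hP₃ : P₃.HasTemperateGrowth) (hg₁ : g₁.HasTemperateGrowth) (hg₂ : g₂.HasTemperateGrowth)
    (hg₃ : g₃.HasTemperateGrowth) (hQ : ∀ x, Q x = g₁ x * P₁ x + g₂ x * P₂ x + g₃ x * P₃ x) :
    Kills F Q :=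
  (((h₁.mul hP₁ hg₁).add (h₂.mul hP₂ hg₂) (hg₁.fun_mul hP₁) (hg₂.fun_mul hP₂)).add (h₃.mul hP₃ hg₃)
    ((hg₁.fun_mul hP₁).fun_add (hg₂.fun_mul hP₂)) (hg₃.fun_mul hP₃)).of_eq fun x => (hQ x).symm

namespace GL3Model

/-- The properties of a functional as in `Model` that is annihilated by the corner entry. -/
structure Residual (lam : K) (F : 𝓢(Fin 3 × Fin 3 → K, ℂ) →L[ℂ] ℂ) : Prop where
  inv : ∀ a, a ≠ 0 → DiagInv F (torus a)
  anti : PermAnti F transp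
  corner : Kills F fun x => x (2, 2)
  eqn : ∀ k ∈ arms, Kills F (armEqn lam k)
  sub : Kills F fun x => x (0, 2) - x (2, 0)

variable {lam : K} {F : 𝓢(Fin 3 × Fin 3 → K, ℂ) →L[ℂ] ℂ}

/-- The derivative term of the equation contains the factor x₂₂, so it vanishes on the subspace that
carries `F`, and only the multiplication by `armEqn` is left. -/
theorem Model.kills_armEqn (hF : Model lam F) (hz : Kills F fun x => x (2, 2))
    {k : Fin 3 × Fin 3} (hk : k ∈ arms) : Kills F (armEqn lam k) := by
  refine (kills_iff (hasTemperateGrowth_armEqn lam k)).2 fun c φ χ hχ => ?_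
  obtain ⟨ρ, hρ⟩ := exists_fderiv_single φ k
    (hasTemperateGrowth_const_mul (hasTemperateGrowth_coord (K := K) (2, 2)) c)
  have h0 : F ρ = 0 := by
    refine apply_eq_zero_of_kills_coord {(2, 2)} (by simpa using hz) fun x hx => ?_
    rw [hρ, hx _ (Finset.mem_singleton_self _), mul_zero, Pi.single_zero, map_zero]
  have h1 : F ((2 * Real.pi * Complex.I : ℂ) • χ + ρ) = 0 := by
    refine hF.eqn k hk c φ _ fun x => ?_
    rw [_root_.add_apply, _root_.smul_apply, hχ, hρ, smul_eq_mul]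
    ring
  rw [map_add, h0, add_zero, map_smul, smul_eq_mul] at h1
  exact (mul_eq_zero.1 h1).resolve_left Complex.two_pi_I_ne_zero

/-- The new relation comes from x₀₂e₀₂ + x₁₂e₁₂ - x₂₀e₂₀ - x₂₁e₂₁ = λ(x₀₂ - x₂₀), in which all terms
not containing λ cancel. -/
theorem Model.residual (hF : Model lam F) (hlam : lam ≠ 0) (hz : Kills F fun x => x (2, 2)) :
    Residual lam F := by
  have he : ∀ k ∈ arms, Kills F (armEqn lam k) := fun k hk => hF.kills_armEqn hz hk
  refine ⟨hF.inv, hF.anti, hz, he, ?_⟩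
  have h1 := (he (0, 2) (by decide)).of_eq_add (he (2, 0) (by decide)) (he (2, 1) (by decide))
    (by fun_prop) (by fun_prop) (by fun_prop) (g₁ := fun x => lam⁻¹ * x (0, 2))
    (g₂ := fun x => -(lam⁻¹ * x (2, 0))) (g₃ := fun x => -(lam⁻¹ * x (2, 1))) (by fun_prop)
    (by fun_prop) (by fun_prop) fun x => rfl
  refine h1.of_eq_add (he (1, 2) (by decide)) hz (by fun_prop) (by fun_prop) (by fun_prop)
    (g₁ := fun _ => 1) (g₂ := fun x => lam⁻¹ * x (1, 2)) (g₃ := fun _ => 0) (by fun_prop)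
    (by fun_prop) (by fun_prop) fun x => ?_
  simp [armEqn]
  field_simp
  ring

theorem Residual.comp_mulBy (hF : Residual lam F) {m m' : (Fin 3 × Fin 3 → K) → ℂ}
    (hm : m.HasTemperateGrowth) (hm' : m'.HasTemperateGrowth)
    (hinv : ∀ a, a ≠ 0 → ∀ x, m (torus a * x) = m x) (hmm' : ∀ x, m' (x ∘ transp) = m x)
    (hφ : ∀ φ, F (mulBy m' φ) = F (mulBy m φ)) : Residual lam (F.comp (mulBy m)) where
  inv a ha := (hF.inv a ha).comp_mulBy hm (hinv a ha)
  anti := hF.anti.comp_mulBy hm hm' hmm' hφ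
  corner := hF.corner.comp_mulBy (by fun_prop) hm
  eqn k hk := (hF.eqn k hk).comp_mulBy (by fun_prop) hm
  sub := hF.sub.comp_mulBy (by fun_prop) hm

/-- Functions that differ by the exchange of the entries `(0, 2)` and `(2, 0)` have the same
effect. -/
theorem Residual.apply_mulBy_eq (hF : Residual lam F) {μ : K → ℂ} (hμ : μ.HasTemperateGrowth)
    (φ : 𝓢(Fin 3 × Fin 3 → K, ℂ)) :
    F (mulBy (fun x => μ (x (0, 2))) φ) = F (mulBy (fun x => μ (x (2, 0))) φ) := by
  have h1 : (fun x : Fin 3 × Fin 3 → K => μ (x (0, 2))).HasTemperateGrowth :=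
    hμ.comp (hasTemperateGrowth_coord (0, 2))
  have h2 : (fun x : Fin 3 × Fin 3 → K => μ (x (2, 0))).HasTemperateGrowth :=
    hμ.comp (hasTemperateGrowth_coord (2, 0))
  refine apply_eq_of_graph (W := {(0, 2)}) (h := fun _ x => x (2, 0))
    (fun k _ => by fun_prop) (fun k _ x y hxy => hxy _ (by decide))
    (fun k hk => ?_) fun x hx => ?_
  · rw [Finset.mem_singleton] at hk
    subst hk
    exact hF.sub
  · rw [mulBy_apply h1, mulBy_apply h2, hx (0, 2) (Finset.mem_singleton_self _)]

/-- The graph that carries a functional as in `Residual` where the entry `(2, 0)` is invertible. -/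
def graphA (lam : K) (κ : K → K) (k : Fin 3 × Fin 3) (x : Fin 3 × Fin 3 → K) : K :=
  if k = (0, 2) then x (2, 0)
  else if k = (1, 0) then -(κ (x (2, 0)) * x (2, 1) * x (1, 1))
  else if k = (0, 1) then -(κ (x (2, 0)) * x (1, 2) * x (1, 1))
  else if k = (0, 0) then κ (x (2, 0)) ^ 2 * x (2, 1) * x (1, 2) * x (1, 1) - κ (x (2, 0)) * lam
  else 0

theorem hasTemperateGrowth_graphA (lam : K) {κ : K → K} (hκ : κ.HasTemperateGrowth)
    (k : Fin 3 × Fin 3) : (graphA lam κ k).HasTemperateGrowth := by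
  unfold graphA
  simp only [sq]
  split_ifs <;> fun_prop

/-- With x₀₂ = x₂₀ invertible, the equations (2, 1), (1, 2) and (0, 2) are solved for x₀₁, x₁₀ and
x₀₀. The free coordinates are x₂₀, x₁₁, x₂₁ and x₁₂, and the torus moves only the last two. -/
theorem Residual.eq_zero_of_invertible (hF : Residual lam F) {κ : K → K} (hκ : κ.HasTemperateGrowth)
    (hinv : Kills F fun x => κ (x (2, 0)) * x (2, 0) - 1) : F = 0 := by
  have hκ' : (fun x : Fin 3 × Fin 3 → K => κ (x (2, 0))).HasTemperateGrowth :=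
    hκ.comp (hasTemperateGrowth_coord (2, 0))
  have h01 : Kills F fun x => x (0, 1) - graphA lam κ (0, 1) x :=
    (hF.eqn (2, 1) (by decide)).of_eq_add hF.sub hinv (by fun_prop) (by fun_prop) (by fun_prop)
      (g₁ := fun x => κ (x (2, 0))) (g₂ := fun x => -(κ (x (2, 0)) * x (0, 1)))
      (g₃ := fun x => -x (0, 1)) (by fun_prop) (by fun_prop) (by fun_prop) fun x => by
        simp [armEqn, graphA]; ring
  have hW : DependsOff {(2, 2), (0, 2), (1, 0), (0, 1), (0, 0)} (graphA lam κ) := by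
    intro k _ x y hxy
    simp only [graphA, hxy (2, 0) (by decide), hxy (2, 1) (by decide), hxy (1, 2) (by decide),
      hxy (1, 1) (by decide)]
  refine eq_zero_of_graph_of_symmetric (W := {(2, 2), (0, 2), (1, 0), (0, 1), (0, 0)})
    (h := graphA lam κ) (i := (2, 1)) (j := (1, 2)) (s := torus) (σ := transp)
    (fun k _ => hasTemperateGrowth_graphA lam hκ k) hW ?_ (by decide) (by decide) (by decide)
    (fun a ha => torus_ne_zero ha) ?_ ?_ hF.inv ?_ hF.anti
  · intro k hk
    simp only [Finset.mem_insert, Finset.mem_singleton] at hk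
    rcases hk with rfl | rfl | rfl | rfl | rfl
    · exact hF.corner.of_eq fun x => by simp [graphA]
    · exact hF.sub.of_eq fun x => by simp [graphA]
    · exact (hF.eqn (1, 2) (by decide)).of_eq_add hF.sub hinv (by fun_prop) (by fun_prop)
        (by fun_prop) (g₁ := fun x => κ (x (2, 0))) (g₂ := fun _ => 0) (g₃ := fun x => -x (1, 0))
        (by fun_prop) (by fun_prop) (by fun_prop) fun x => by simp [armEqn, graphA]; ring
    · exact h01
    · exact (hF.eqn (0, 2) (by decide)).of_eq_add h01 hinv (by fun_prop)
        ((hasTemperateGrowth_coord _).fun_sub (hasTemperateGrowth_graphA lam hκ _))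
        (by fun_prop) (g₁ := fun x => κ (x (2, 0))) (g₂ := fun x => -(κ (x (2, 0)) * x (2, 1)))
        (g₃ := fun x => -x (0, 0)) (by fun_prop) (by fun_prop) (by fun_prop) fun x => by
          simp [armEqn, graphA]; ring
  · intro a l
    obtain ⟨i, j⟩ := l
    fin_cases i <;> fin_cases j <;> simp [torus]
  · intro a ha x hx k hk
    have h1 := hx k hk
    simp only [Finset.mem_insert, Finset.mem_singleton] at hk
    rcases hk with rfl | rfl | rfl | rfl | rfl <;> simp [graphA] at h1 <;>
      simp [graphA, torus, h1] <;> field_simp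
    simp
  · intro x hx
    have hup : x (0, 2) = x (2, 0) := hx (0, 2) (by decide)
    refine ⟨fun k hk => ?_, fun l hl => ?_⟩
    · have h1 := hx (2, 2) (by decide)
      have h2 := hx (1, 0) (by decide)
      have h3 := hx (0, 1) (by decide)
      have h4 := hx (0, 0) (by decide)
      simp [graphA] at h1 h2 h3 h4
      simp only [Finset.mem_insert, Finset.mem_singleton] at hk
      rcases hk with rfl | rfl | rfl | rfl | rfl <;> simp [graphA, h1, h2, h3, h4, hup]
      exact Or.inl (by ring)
    -- Transposition sends the free entry (2, 0) to (0, 2), outside the free coordinates, but both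
    -- entries agree on the graph.
    · have : l = (2, 0) ∨ transp l = Equiv.swap (2, 1) (1, 2) l := by revert l; decide
      rcases this with rfl | h
      · exact hup
      · rw [h]

/-- The graph that carries a functional as in `Residual` where the entry `(2, 0)` vanishes and the
product of the entries `(2, 1)` and `(1, 2)` is invertible. -/
def graphB (lam : K) (κ : K → K) (k : Fin 3 × Fin 3) (x : Fin 3 × Fin 3 → K) : K :=
  if k = (0, 1) then -(κ (x (2, 1) * x (1, 2)) * x (1, 2) * lam)
  else if k = (1, 0) then -(κ (x (2, 1) * x (1, 2)) * x (2, 1) * lam)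
  else 0

theorem hasTemperateGrowth_graphB (lam : K) {κ : K → K} (hκ : κ.HasTemperateGrowth)
    (k : Fin 3 × Fin 3) : (graphB lam κ k).HasTemperateGrowth := by
  have hκ' : (fun x : Fin 3 × Fin 3 → K => κ (x (2, 1) * x (1, 2))).HasTemperateGrowth :=
    hκ.comp (f := fun x : Fin 3 × Fin 3 → K => x (2, 1) * x (1, 2)) (by fun_prop)
  unfold graphB
  split_ifs <;> fun_prop

/-- With x₂₀ = x₀₂ = 0 the equations read x₂₁x₀₁ = -λ, x₁₂x₁₀ = -λ and x₂₁x₁₁ = x₁₂x₁₁ = 0. They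
determine x₀₁, x₁₀ and x₁₁ and leave x₀₀, x₂₁, x₁₂ free. -/
theorem Residual.eq_zero_of_invertible_mul (hF : Residual lam F) (hp : Kills F fun x => x (2, 0))
    {κ : K → K} (hκ : κ.HasTemperateGrowth)
    (hinv : Kills F fun x => κ (x (2, 1) * x (1, 2)) * (x (2, 1) * x (1, 2)) - 1) : F = 0 := by
  have hκ' : (fun x : Fin 3 × Fin 3 → K => κ (x (2, 1) * x (1, 2))).HasTemperateGrowth :=
    hκ.comp (f := fun x : Fin 3 × Fin 3 → K => x (2, 1) * x (1, 2)) (by fun_prop)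
  have hu : Kills F fun x => x (0, 2) :=
    hF.sub.of_eq_add hp hp (by fun_prop) (by fun_prop) (by fun_prop) (g₁ := fun _ => 1)
      (g₂ := fun _ => 1) (g₃ := fun _ => 0) (by fun_prop) (by fun_prop) (by fun_prop)
      fun x => by simp
  have hW : DependsOff {(2, 2), (0, 2), (2, 0), (1, 0), (0, 1), (1, 1)} (graphB lam κ) := by
    intro k _ x y hxy
    simp only [graphB, hxy (2, 1) (by decide), hxy (1, 2) (by decide)]
  refine eq_zero_of_graph_of_symmetric (W := {(2, 2), (0, 2), (2, 0), (1, 0), (0, 1), (1, 1)})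
    (h := graphB lam κ) (i := (2, 1)) (j := (1, 2)) (s := torus) (σ := transp)
    (fun k _ => hasTemperateGrowth_graphB lam hκ k) hW ?_ (by decide) (by decide) (by decide)
    (fun a ha => torus_ne_zero ha) ?_ ?_ hF.inv ?_ hF.anti
  · intro k hk
    simp only [Finset.mem_insert, Finset.mem_singleton] at hk
    rcases hk with rfl | rfl | rfl | rfl | rfl | rfl
    · exact hF.corner.of_eq fun x => by simp [graphB]
    · exact hu.of_eq fun x => by simp [graphB]
    · exact hp.of_eq fun x => by simp [graphB]
    · exact (hF.eqn (2, 0) (by decide)).of_eq_add hu hinv (by fun_prop) (by fun_prop) (by fun_prop)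
        (g₁ := fun x => κ (x (2, 1) * x (1, 2)) * x (2, 1))
        (g₂ := fun x => -(κ (x (2, 1) * x (1, 2)) * x (2, 1) * x (0, 0)))
        (g₃ := fun x => -x (1, 0)) (by fun_prop) (by fun_prop) (by fun_prop) fun x => by
          simp [armEqn, graphB]; ring
    · exact (hF.eqn (0, 2) (by decide)).of_eq_add hp hinv (by fun_prop) (by fun_prop) (by fun_prop)
        (g₁ := fun x => κ (x (2, 1) * x (1, 2)) * x (1, 2))
        (g₂ := fun x => -(κ (x (2, 1) * x (1, 2)) * x (1, 2) * x (0, 0)))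
        (g₃ := fun x => -x (0, 1)) (by fun_prop) (by fun_prop) (by fun_prop) fun x => by
          simp [armEqn, graphB]; ring
    · exact (hF.eqn (1, 2) (by decide)).of_eq_add hp hinv (by fun_prop) (by fun_prop) (by fun_prop)
        (g₁ := fun x => κ (x (2, 1) * x (1, 2)) * x (1, 2))
        (g₂ := fun x => -(κ (x (2, 1) * x (1, 2)) * x (1, 2) * x (1, 0)))
        (g₃ := fun x => -x (1, 1)) (by fun_prop) (by fun_prop) (by fun_prop) fun x => by
          simp [armEqn, graphB]; ring
  · intro a l
    obtain ⟨i, j⟩ := l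
    fin_cases i <;> fin_cases j <;> simp [torus]
  · intro a ha x hx k hk
    have h1 := hx k hk
    have h2 : a * x (2, 1) * (a⁻¹ * x (1, 2)) = x (2, 1) * x (1, 2) := by field_simp
    simp only [Finset.mem_insert, Finset.mem_singleton] at hk
    rcases hk with rfl | rfl | rfl | rfl | rfl | rfl <;> simp [graphB] at h1 <;>
      simp [graphB, torus, h1, h2] <;> ring
  · intro x hx
    refine ⟨fun k hk => ?_, fun l hl => congrArg x ?_⟩
    · have h1 := hx (transp k) (by revert k; decide)
      have h2 : x (1, 2) * x (2, 1) = x (2, 1) * x (1, 2) := mul_comm _ _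
      simp only [Finset.mem_insert, Finset.mem_singleton] at hk
      rcases hk with rfl | rfl | rfl | rfl | rfl | rfl <;> simp [graphB] at h1 <;>
        simp [graphB, h1, h2]
    · revert l; decide

/-- Modulo x₂₀ and x₀₂, the product (x₂₁x₀₁)(x₁₂x₁₀) equals λ² by the equations, while it is a
multiple of x₂₁x₁₂. Hence the nonzero constant λ² lies in the ideal. -/
theorem Residual.eq_zero_of_kills (hF : Residual lam F) (hlam : lam ≠ 0)
    (hp : Kills F fun x => x (2, 0)) (hrv : Kills F fun x => x (2, 1) * x (1, 2)) : F = 0 := by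
  have hu : Kills F fun x => x (0, 2) :=
    hF.sub.of_eq_add hp hp (by fun_prop) (by fun_prop) (by fun_prop) (g₁ := fun _ => 1)
      (g₂ := fun _ => 1) (g₃ := fun _ => 0) (by fun_prop) (by fun_prop) (by fun_prop)
      fun x => by simp
  have h1 := hrv.of_eq_add hu hp (by fun_prop) (by fun_prop) (by fun_prop)
    (g₁ := fun x => x (0, 1) * x (1, 0)) (g₂ := fun x => -(lam * x (0, 0)))
    (g₃ := fun x => x (1, 2) * x (1, 0) * x (0, 0)) (by fun_prop) (by fun_prop) (by fun_prop)
    fun x => rfl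
  refine Kills.eq_zero_of_const (pow_ne_zero 2 hlam)
    (h1.of_eq_add (hF.eqn (2, 0) (by decide)) (hF.eqn (0, 2) (by decide)) (by fun_prop)
      (by fun_prop) (by fun_prop) (g₁ := fun _ => 1) (g₂ := fun _ => lam)
      (g₃ := fun x => -(x (1, 2) * x (1, 0))) (by fun_prop) (by fun_prop) (by fun_prop)
      fun x => ?_)
  simp [armEqn]
  ring

theorem hasTemperateGrowth_one_sub_cutoff {E : Type*} [NormedAddCommGroup E] [NormedSpace ℝ E]
    {P : E → K} (hP : P.HasTemperateGrowth) (c : ℝ) :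
    (fun x => ((1 - cutoff (c • P x) : ℝ) : ℂ)).HasTemperateGrowth := by
  fun_prop

/-- The product x₂₁x₁₂ is invariant under the torus and under transposition, so multiplication by
its functions preserves the class and the support argument applies to it. -/
theorem Residual.eq_zero_of_kills_entry (hF : Residual lam F) (hlam : lam ≠ 0)
    (hp : Kills F fun x => x (2, 0)) : F = 0 := by
  have hP : (fun x : Fin 3 × Fin 3 → K => x (2, 1) * x (1, 2)).HasTemperateGrowth := by fun_prop
  have hmul : ∀ {m : (Fin 3 × Fin 3 → K) → ℂ} {F : 𝓢(Fin 3 × Fin 3 → K, ℂ) →L[ℂ] ℂ} (μ : K → ℂ),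
      m.HasTemperateGrowth → (∀ x, m x = μ (x (2, 1) * x (1, 2))) →
      Residual lam F ∧ (Kills F fun x => x (2, 0)) →
      Residual lam (F.comp (mulBy m)) ∧ Kills (F.comp (mulBy m)) fun x => x (2, 0) := by
    intro m F μ hm hmμ hF
    refine ⟨hF.1.comp_mulBy hm hm (fun a ha x => ?_) (fun x => ?_) fun _ => rfl,
      hF.2.comp_mulBy (by fun_prop) hm⟩
    · rw [hmμ, hmμ]
      congr 1
      simp [torus]
      field_simp
    · rw [hmμ, hmμ]
      exact congrArg μ (mul_comm _ _)
  refine eq_zero_of_supported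
    (𝒞 := fun F => Residual lam F ∧ Kills F fun x => x (2, 0)) hP
    (fun F hF c => hmul (fun y => ((RCLike.re (c * y) : ℝ) : ℂ))
      (hasTemperateGrowth_reC (hasTemperateGrowth_const_mul hP c)) (fun x => rfl) hF)
    (fun F hF c _ => ?_) (fun F hF h => hF.1.eq_zero_of_kills hlam hF.2 h) ⟨hF, hp⟩
  have hm := hasTemperateGrowth_one_sub_cutoff hP c
  obtain ⟨h1, h2⟩ := hmul (fun y => ((1 - cutoff (c • y) : ℝ) : ℂ)) hm (fun x => rfl) hF
  refine h1.eq_zero_of_invertible_mul h2 (hasTemperateGrowth_farInv c)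
    (kills_comp_mulBy_of_mul_eq_zero (by fun_prop) hm fun x hx => ?_)
  rw [farInv_mul_self (Complex.ofReal_ne_zero.1 hx), sub_self]

/-- The entry x₂₀ is not invariant under transposition, but its functions act on `F` like those of
x₀₂, so the class is still preserved. -/
theorem Residual.eq_zero (hF : Residual lam F) (hlam : lam ≠ 0) : F = 0 := by
  have hP : (fun x : Fin 3 × Fin 3 → K => x (2, 0)).HasTemperateGrowth := by fun_prop
  have hmul : ∀ {F : 𝓢(Fin 3 × Fin 3 → K, ℂ) →L[ℂ] ℂ} {μ : K → ℂ}, μ.HasTemperateGrowth →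
      Residual lam F → Residual lam (F.comp (mulBy fun x => μ (x (2, 0)))) := by
    intro F μ hμ hF
    refine hF.comp_mulBy (m' := fun x => μ (x (0, 2))) (hμ.comp hP)
      (hμ.comp (hasTemperateGrowth_coord (0, 2))) (fun a ha x => by simp [torus]) (fun x => rfl)
      (hF.apply_mulBy_eq hμ)
  refine eq_zero_of_supported (𝒞 := Residual lam) hP
    (fun F hF c => hmul (μ := fun y => ((RCLike.re (c * y) : ℝ) : ℂ)) (by fun_prop) hF)
    (fun F hF c _ => ?_) (fun F hF h => hF.eq_zero_of_kills_entry hlam h) hF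
  have h1 := hmul (μ := fun y => ((1 - cutoff (c • y) : ℝ) : ℂ)) (by fun_prop) hF
  refine h1.eq_zero_of_invertible (hasTemperateGrowth_farInv c)
    (kills_comp_mulBy_of_mul_eq_zero (by fun_prop)
      (hasTemperateGrowth_one_sub_cutoff hP c) fun x hx => ?_)
  rw [farInv_mul_self (Complex.ofReal_ne_zero.1 hx), sub_self]

theorem Model.eq_zero (hF : Model lam F) (hlam : lam ≠ 0) : F = 0 :=
  eq_zero_of_supported (𝒞 := Model lam) (hasTemperateGrowth_coord (2, 2))
    (fun F hF c => hF.comp_mulBy (μ := fun y => ((RCLike.re (c * y) : ℝ) : ℂ)) (by fun_prop))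
    (fun F hF c _ => hF.corner_supported c) (fun F hF h => (hF.residual hlam h).eq_zero hlam) hF

end GL3Model

end Vanishing

/-! ### Unitary characters of the additive group -/

noncomputable section Characters

/-- Averaging over an interval expresses the character through its own primitive, so continuity
implies differentiability. It then solves g' = d g, and |g| = 1 makes d imaginary. -/
theorem AddChar.exists_eq_phase_real {ψ : AddChar ℝ Circle} (hψ : Continuous ψ) :
    ∃ α : ℝ, ∀ t, (ψ t : ℂ) = phase (α * t) := by
  set g : ℝ → ℂ := fun t => ψ t with hg
  have hgc : Continuous g := continuous_subtype_val.comp hψ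
  have hadd : ∀ s t, g (s + t) = g s * g t := fun s t => by simp [hg, AddChar.map_add_eq_mul]
  have h0 : g 0 = 1 := by simp [hg]
  have hI : ∀ t, HasDerivAt (fun u => ∫ s in (0 : ℝ)..u, g s) (g t) t := fun t =>
    intervalIntegral.integral_hasDerivAt_right (hgc.intervalIntegrable _ _)
      hgc.aestronglyMeasurable.stronglyMeasurableAtFilter hgc.continuousAt
  -- If all these integrals vanished, so would the derivative of the primitive at 0, which is g(0) =
  -- 1.
  obtain ⟨δ, hδ⟩ : ∃ δ : ℝ, ∫ s in (0 : ℝ)..δ, g s ≠ 0 := by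
    by_contra! h
    have h1 := hI 0
    rw [show (fun u : ℝ => ∫ s in (0 : ℝ)..u, g s) = fun _ => 0 from funext h, h0] at h1
    exact zero_ne_one ((hasDerivAt_const (0 : ℝ) (0 : ℂ)).unique h1)
  have hgI : ∀ t, g t = ((∫ s in (0 : ℝ)..(t + δ), g s) - ∫ s in (0 : ℝ)..t, g s) /
      ∫ s in (0 : ℝ)..δ, g s := by
    intro t
    rw [eq_div_iff hδ, ← intervalIntegral.integral_const_mul,
      intervalIntegral.integral_interval_sub_left (hgc.intervalIntegrable _ _)
        (hgc.intervalIntegrable _ _)]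
    simp only [← hadd]
    rw [intervalIntegral.integral_comp_add_left, add_zero]
  obtain ⟨d, hd⟩ : ∃ d, HasDerivAt g d 0 := by
    rw [show g = _ from funext hgI]
    exact ⟨_, (((hI (0 + δ)).comp_add_const 0 δ).sub (hI 0)).div_const _⟩
  have hd' : ∀ t, HasDerivAt g (g t * d) t := by
    intro t
    have h1 : HasDerivAt (fun s => g (s - t)) d t :=
      HasDerivAt.comp_sub_const t t (by rwa [sub_self])
    refine (h1.const_mul (g t)).congr_of_eventuallyEq (.of_forall fun s => ?_)
    change g s = g t * g (s - t)
    rw [← hadd, add_sub_cancel]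
  have hconst : ∀ t : ℝ, g t * Complex.exp (-(d * t)) = 1 := by
    have hder : ∀ t : ℝ, HasDerivAt (fun t : ℝ => g t * Complex.exp (-(d * t))) 0 t := by
      intro t
      have h1 : HasDerivAt (fun t : ℝ => -(d * (t : ℂ))) (-d) t := by
        exact ((hasDerivAt_id t).ofReal_comp.const_mul d).neg.congr_deriv (by simp)
      exact ((hd' t).mul h1.cexp).congr_deriv (by ring)
    intro t
    rw [is_const_of_deriv_eq_zero (fun s => (hder s).differentiableAt) (fun s => (hder s).deriv) t 0]
    simp [h0]
  have hexp : ∀ t : ℝ, g t = Complex.exp (d * t) := by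
    intro t
    have h1 := hconst t
    rw [Complex.exp_neg] at h1
    exact (mul_inv_eq_one₀ (Complex.exp_ne_zero _)).1 h1
  have hre : d.re = 0 := by
    have h1 : ‖g 1‖ = 1 := Circle.norm_coe _
    rw [hexp, Complex.norm_exp, Real.exp_eq_one_iff] at h1
    simpa using h1
  refine ⟨d.im / (2 * Real.pi), fun t => ?_⟩
  change g t = _
  rw [hexp, phase]
  congr 1
  have hdI : d = d.im * Complex.I := by
    apply Complex.ext <;> simp [hre]
  have : (Real.pi : ℂ) ≠ 0 := by exact_mod_cast Real.pi_ne_zero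
  rw [hdI]
  push_cast
  simp
  field_simp

variable {K : Type*} [RCLike K]

theorem AddChar.exists_eq_phase {ψ : AddChar K Circle} (hψ : Continuous ψ) (hψ' : ψ ≠ 1) :
    ∃ lam : K, lam ≠ 0 ∧ ∀ x, (ψ x : ℂ) = phase (RCLike.re (lam * x)) := by
  have key : ∀ v : K, ∃ α : ℝ, ∀ t : ℝ, (ψ (t • v) : ℂ) = phase (α * t) := by
    intro v
    exact AddChar.exists_eq_phase_real
      (ψ := ψ.compAddMonoidHom (LinearMap.toSpanSingleton ℝ K v).toAddMonoidHom)
      (hψ.comp (continuous_id.smul continuous_const))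
  obtain ⟨α, hα⟩ := key 1
  obtain ⟨β, hβ⟩ := key RCLike.I
  -- The minus sign matches Re(I x) = -Im x. The formula also covers the real case, where I = 0.
  have hlam : ∀ x, (ψ x : ℂ) = phase (RCLike.re (((α : K) - β * RCLike.I) * x)) := by
    intro x
    have hx : x = RCLike.re x • (1 : K) + RCLike.im x • RCLike.I := by
      rw [RCLike.real_smul_eq_coe_mul, RCLike.real_smul_eq_coe_mul, mul_one, RCLike.re_add_im]
    conv_lhs => rw [hx, AddChar.map_add_eq_mul, Circle.coe_mul, hα, hβ, ← phase_add]
    congr 1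
    rw [sub_mul, map_sub, RCLike.re_ofReal_mul, mul_assoc, RCLike.re_ofReal_mul, RCLike.I_mul_re]
    ring
  refine ⟨_, fun h => hψ' ?_, hlam⟩
  ext x
  rw [hlam, h, zero_mul, map_zero, phase_zero]
  rfl

end Characters

/-! ### The equations of an equivariant functional -/

noncomputable section Equations

set_option linter.unusedSectionVars false

open scoped ContDiff LineDeriv
open MeasureTheory Set

/-- The determinant, on the group of continuous linear automorphisms. -/
def clmDet (E : Type*) [AddCommGroup E] [Module ℝ E] [TopologicalSpace E] : (E ≃L[ℝ] E) →* ℝˣ :=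
  MonoidHom.mk' (fun A => LinearEquiv.det A.toLinearEquiv)
    fun A B => map_mul LinearEquiv.det A.toLinearEquiv B.toLinearEquiv

/-- The determinants on matrix space are never expanded: relations between the automorphisms show
that their squares are 1. -/
theorem abs_det_eq_one_of_sq {E : Type*} [AddCommGroup E] [Module ℝ E] [TopologicalSpace E]
    {A : E ≃L[ℝ] E} (h : clmDet E A * clmDet E A = 1) : |LinearMap.det (A : E →ₗ[ℝ] E)| = 1 := by
  have h1 : (clmDet E A : ℝ) = LinearMap.det (A : E →ₗ[ℝ] E) := LinearEquiv.coe_det _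
  have h2 := congrArg Units.val h
  rw [Units.val_mul, h1, Units.val_one] at h2
  exact abs_eq_abs.2 (mul_self_eq_one_iff.1 h2) |>.trans abs_one

theorem Tempered.apply_eq_of_equivariant {E : Type*} [NormedAddCommGroup E] [NormedSpace ℝ E]
    {H : Type*} [Group H] {ρ : H →* (E ≃L[ℝ] E)} {χ : H →* Circle} {f : 𝓢'(E, ℂ)}
    (hf : f ∈ Tempered.equivariant ρ χ) {h : H}
    (hdet : |LinearMap.det (ρ h : E →ₗ[ℝ] E)| = 1) {φ ψ : 𝓢(E, ℂ)} (hψ : ∀ x, ψ x = φ (ρ h x)) :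
    f φ = (χ h : ℂ) * f ψ := by
  have h1 := DFunLike.congr_fun (hf h) ψ
  rw [Tempered.pullback_apply, hdet, inv_one, Complex.ofReal_one, one_mul] at h1
  refine Eq.trans ?_ h1
  congr 1
  ext x
  change φ x = ψ ((ρ h).symm x)
  rw [hψ, ContinuousLinearEquiv.apply_symm_apply]

variable {K : Type*} [RCLike K]

namespace GL3Model

/-- The element `diag(a, 1, a)` of `L3`. -/
def diagL (a : Kˣ) : L3 K :=
  ⟨⟨!![(a : K), 0, 0; 0, 1, 0; 0, 0, (a : K)],
    !![((a⁻¹ : Kˣ) : K), 0, 0; 0, 1, 0; 0, 0, ((a⁻¹ : Kˣ) : K)],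
    by ext i j; fin_cases i <;> fin_cases j <;> simp [Matrix.mul_apply, Fin.sum_univ_three],
    by ext i j; fin_cases i <;> fin_cases j <;> simp [Matrix.mul_apply, Fin.sum_univ_three]⟩, a, rfl⟩

/-- The element of `N3` with entries `c` and `d`. -/
def unipN (c d : K) : N3 K :=
  ⟨⟨!![1, 0, d; 0, 1, c; 0, 0, 1], !![1, 0, -d; 0, 1, -c; 0, 0, 1],
    by ext i j; fin_cases i <;> fin_cases j <;> simp [Matrix.mul_apply, Fin.sum_univ_three],
    by ext i j; fin_cases i <;> fin_cases j <;> simp [Matrix.mul_apply, Fin.sum_univ_three]⟩,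
    c, d, rfl⟩

/-- The entries of a matrix, as a function on pairs. -/
def entries (K : Type*) [RCLike K] : gl3 K ≃L[ℝ] (Fin 3 × Fin 3 → K) :=
  (LinearEquiv.curry ℝ K (Fin 3) (Fin 3)).symm.toContinuousLinearEquiv

theorem entries_symm_apply (x : Fin 3 × Fin 3 → K) (i j : Fin 3) :
    (entries K).symm x i j = x (i, j) := rfl

/-- The action in terms of the entries. -/
def act (h : H3tilde K) : (Fin 3 × Fin 3 → K) ≃L[ℝ] (Fin 3 × Fin 3 → K) :=
  (entries K).symm.trans ((rho K h).trans (entries K))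

theorem act_apply (h : H3tilde K) (x : Fin 3 × Fin 3 → K) (k : Fin 3 × Fin 3) :
    act h x k = rho K h ((entries K).symm x) k.1 k.2 := rfl

/-- A tempered generalized function on matrices, as a functional on Schwartz functions of the
entries. -/
def onEntries (f : 𝓢'(gl3 K, ℂ)) : 𝓢(Fin 3 × Fin 3 → K, ℂ) →L[ℂ] ℂ :=
  ContinuousLinearMap.comp (f : 𝓢(gl3 K, ℂ) →L[ℂ] ℂ)
    (SchwartzMap.compCLMOfContinuousLinearEquiv ℂ (entries K))

theorem onEntries_apply (f : 𝓢'(gl3 K, ℂ)) (φ : 𝓢(Fin 3 × Fin 3 → K, ℂ)) :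
    onEntries f φ = f (SchwartzMap.compCLMOfContinuousLinearEquiv ℂ (entries K) φ) := rfl

theorem eq_zero_of_onEntries {f : 𝓢'(gl3 K, ℂ)} (h : onEntries f = 0) : f = 0 := by
  ext φ
  have h1 := DFunLike.congr_fun h
    (SchwartzMap.compCLMOfContinuousLinearEquiv ℂ (entries K).symm φ)
  rw [onEntries_apply] at h1
  refine Eq.trans (congrArg f ?_) h1
  ext x
  change φ x = φ ((entries K).symm (entries K x))
  rw [ContinuousLinearEquiv.symm_apply_apply]

variable {f : 𝓢'(gl3 K, ℂ)} {ψ : AddChar K Circle} {h : H3tilde K}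

theorem onEntries_act (hf : f ∈ Tempered.equivariant (rho K) (chi ψ))
    (hdet : clmDet (gl3 K) (rho K h) * clmDet (gl3 K) (rho K h) = 1)
    {φ χ : 𝓢(Fin 3 × Fin 3 → K, ℂ)} (hχ : ∀ x, χ x = φ (act h x)) :
    onEntries f φ = (chi ψ h : ℂ) * onEntries f χ := by
  refine Tempered.apply_eq_of_equivariant hf (abs_det_eq_one_of_sq hdet) fun x => ?_
  exact hχ (entries K x)

theorem rho_diagL (a : Kˣ) (x : gl3 K) :
    rho K (SemidirectProduct.inl (H3.mk (diagL a) 1 1)) x =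
      !![x 0 0, a * x 0 1, x 0 2; x 1 0 * (a : K)⁻¹, x 1 1, x 1 2 * (a : K)⁻¹;
        x 2 0, a * x 2 1, x 2 2] := by
  rw [rho_H3]
  have h1 : (((diagL a : L3 K) : GL (Fin 3) K)⁻¹ : GL (Fin 3) K).val =
    !![((a⁻¹ : Kˣ) : K), 0, 0; 0, 1, 0; 0, 0, ((a⁻¹ : Kˣ) : K)] := rfl
  have h2 : ((diagL a : L3 K) : GL (Fin 3) K).val = !![(a : K), 0, 0; 0, 1, 0; 0, 0, (a : K)] := rfl
  rw [h1, h2]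
  ext i j
  simp only [Matrix.mul_apply, Fin.sum_univ_three, OneMemClass.coe_one, Units.val_one, mul_one,
    Matrix.transpose_one]
  fin_cases i <;> fin_cases j <;> simp [mul_comm]

theorem rho_unipN (c d c' d' : K) (x : gl3 K) :
    rho K (SemidirectProduct.inl (H3.mk 1 (unipN c d) (unipN c' d'))) x =
      !![x 0 0 + d * x 2 0 + (x 0 2 + d * x 2 2) * d', x 0 1 + d * x 2 1 + (x 0 2 + d * x 2 2) * c',
          x 0 2 + d * x 2 2;
        x 1 0 + c * x 2 0 + (x 1 2 + c * x 2 2) * d', x 1 1 + c * x 2 1 + (x 1 2 + c * x 2 2) * c',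
          x 1 2 + c * x 2 2;
        x 2 0 + x 2 2 * d', x 2 1 + x 2 2 * c', x 2 2] := by
  rw [rho_H3]
  have h1 : ∀ c d : K, ((unipN c d : N3 K) : GL (Fin 3) K).val =
    !![1, 0, d; 0, 1, c; 0, 0, 1] := fun _ _ => rfl
  rw [h1, h1]
  simp only [OneMemClass.coe_one, inv_one, Units.val_one, mul_one, one_mul]
  ext i j
  simp only [Matrix.mul_apply, Fin.sum_univ_three, Matrix.transpose_apply]
  fin_cases i <;> fin_cases j <;> simp

theorem clmDet_rho_tau : clmDet (gl3 K) (rho K (tau K)) * clmDet (gl3 K) (rho K (tau K)) = 1 := by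
  have h : rho K (tau K) * rho K (tau K) = 1 := by
    refine ContinuousLinearEquiv.ext (funext fun x => ?_)
    change rho K (tau K) (rho K (tau K) x) = x
    rw [rho_tau, rho_tau, Matrix.transpose_transpose]
  exact (map_mul (clmDet (gl3 K)) _ _).symm.trans ((congrArg _ h).trans (map_one (clmDet (gl3 K))))

/-- Transposition conjugates the torus element to its inverse, so its product with transposition is
an involution. -/
theorem clmDet_rho_diagL (a : Kˣ) :
    clmDet (gl3 K) (rho K (SemidirectProduct.inl (H3.mk (diagL a) 1 1))) *
      clmDet (gl3 K) (rho K (SemidirectProduct.inl (H3.mk (diagL a) 1 1))) = 1 := by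
  set A := rho K (SemidirectProduct.inl (H3.mk (diagL a) 1 1)) with hA
  have h : (rho K (tau K) * A) * (rho K (tau K) * A) = 1 := by
    refine ContinuousLinearEquiv.ext (funext fun x => ?_)
    change rho K (tau K) (A (rho K (tau K) (A x))) = x
    simp only [hA, rho_diagL, rho_tau]
    have ha := a.ne_zero
    ext i j
    fin_cases i <;> fin_cases j <;> simp <;> field_simp
  have h1 := (map_mul (clmDet (gl3 K)) _ _).symm.trans
    ((congrArg _ h).trans (map_one (clmDet (gl3 K))))
  have h2 : clmDet (gl3 K) (rho K (tau K) * A) = clmDet (gl3 K) (rho K (tau K)) * clmDet (gl3 K) A :=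
    map_mul (clmDet (gl3 K)) _ _
  rw [h2, mul_mul_mul_comm, clmDet_rho_tau, one_mul] at h1
  exact h1

/-- Conjugation by x ↦ D x D with D = diag(2, 2, 1) doubles the unipotent parameters and so squares
the automorphism; its determinant equals its own square and is therefore 1. -/
theorem clmDet_rho_unipN (c d c' d' : K) :
    clmDet (gl3 K) (rho K (SemidirectProduct.inl (H3.mk 1 (unipN c d) (unipN c' d')))) = 1 := by
  set A := rho K (SemidirectProduct.inl (H3.mk 1 (unipN c d) (unipN c' d'))) with hA
  let D : GL (Fin 3) K := ⟨!![2, 0, 0; 0, 2, 0; 0, 0, 1], !![2⁻¹, 0, 0; 0, 2⁻¹, 0; 0, 0, 1],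
    by ext i j; fin_cases i <;> fin_cases j <;> simp [Matrix.mul_apply, Fin.sum_univ_three],
    by ext i j; fin_cases i <;> fin_cases j <;> simp [Matrix.mul_apply, Fin.sum_univ_three]⟩
  have hD : ∀ x, leftRight D D x = !![4 * x 0 0, 4 * x 0 1, 2 * x 0 2;
      4 * x 1 0, 4 * x 1 1, 2 * x 1 2; 2 * x 2 0, 2 * x 2 1, x 2 2] := by
    intro x
    have h1 : D.val = !![2, 0, 0; 0, 2, 0; 0, 0, 1] := rfl
    rw [leftRight_apply, h1]
    ext i j
    simp only [Matrix.mul_apply, Fin.sum_univ_three]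
    fin_cases i <;> fin_cases j <;> simp <;> ring
  have h : leftRight D D * A = (A * A) * leftRight D D := by
    refine ContinuousLinearEquiv.ext (funext fun x => ?_)
    change leftRight D D (A x) = A (A (leftRight D D x))
    simp only [hA, rho_unipN, hD]
    ext i j
    fin_cases i <;> fin_cases j <;> simp <;> ring
  have h1 := (map_mul (clmDet (gl3 K)) _ _).symm.trans
    ((congrArg _ h).trans (map_mul (clmDet (gl3 K)) _ _))
  have h2 : clmDet (gl3 K) (A * A) = clmDet (gl3 K) A * clmDet (gl3 K) A :=
    map_mul (clmDet (gl3 K)) _ _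
  rw [h2, mul_comm] at h1
  simpa using h1

theorem onEntries_diagInv (hf : f ∈ Tempered.equivariant (rho K) (chi ψ)) {a : K} (ha : a ≠ 0) :
    DiagInv (onEntries f) fun k => if k = (0, 1) ∨ k = (2, 1) then a
      else if k = (1, 0) ∨ k = (1, 2) then a⁻¹ else 1 := by
  intro φ χ hχ
  have h1 := onEntries_act hf (clmDet_rho_diagL (Units.mk0 a ha)) (φ := φ) (χ := χ) fun x => by
    rw [hχ]
    congr 1
    ext ⟨i, j⟩
    rw [act_apply, rho_diagL]
    fin_cases i <;> fin_cases j <;> simp [entries_symm_apply, mul_comm]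
  rw [h1, chi_H3]
  simp

theorem onEntries_permAnti (hf : f ∈ Tempered.equivariant (rho K) (chi ψ)) :
    PermAnti (onEntries f) transp := by
  intro φ χ hχ
  have h1 := onEntries_act hf clmDet_rho_tau (φ := φ) (χ := χ) fun x => by
    rw [hχ]
    congr 1
    ext ⟨i, j⟩
    rw [act_apply, rho_tau]
    rfl
  rw [h1, chi_tau]
  ring

/-- The action is affine in t, so equivariance can be differentiated at t = 0. The sign comes from
f(φ ∘ h) = χ(h)⁻¹ f(φ), as equivariance is imposed on pull-backs of f while φ is a test function. -/
theorem onEntries_deriv (hf : f ∈ Tempered.equivariant (rho K) (chi ψ)) {h : ℝ → H3tilde K}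
    (hdet : ∀ t, clmDet (gl3 K) (rho K (h t)) * clmDet (gl3 K) (rho K (h t)) = 1) {q : ℝ}
    (hq : ∀ t, (chi ψ (h t) : ℂ) = phase (t * q))
    {X : (Fin 3 × Fin 3 → K) →ₗ[ℝ] (Fin 3 × Fin 3 → K)} (hX : ∀ t x, act (h t) x = x + t • X x)
    {φ χ : 𝓢(Fin 3 × Fin 3 → K, ℂ)} (hχ : ∀ x, χ x = fderiv ℝ φ x (X x)) :
    onEntries f χ = -(2 * Real.pi * Complex.I) * q * onEntries f φ := by
  set Φ : ℝ → 𝓢(Fin 3 × Fin 3 → K, ℂ) := fun t =>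
    SchwartzMap.compCLMOfContinuousLinearEquiv ℂ (act (h t)) φ
  have h1 : HasDerivAt (fun t => onEntries f (Φ t)) (onEntries f χ) 0 :=
    SchwartzMap.hasDerivAt_apply_comp_linear (onEntries f) (LinearMap.toContinuousLinearMap X)
      (.of_forall fun t x => by
        change φ (act (h t) x) = _
        rw [hX]
        rfl) hχ
  have h2 : ∀ t, onEntries f (Φ t) = phase (t * -q) * onEntries f φ := by
    intro t
    rw [onEntries_act hf (hdet t) (φ := φ) (χ := Φ t) fun x => rfl, hq, ← mul_assoc, ← phase_add,
      mul_neg, neg_add_cancel, phase_zero, one_mul]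
  have h3 : HasDerivAt (fun t : ℝ => phase (t * -q) * onEntries f φ)
      (-(2 * Real.pi * Complex.I) * q * onEntries f φ) 0 := by
    have h4 : HasDerivAt (fun t : ℝ => t * -q) (-q) 0 := by
      simpa using (hasDerivAt_id (0 : ℝ)).mul_const (-q)
    have h5 : HasDerivAt phase (2 * Real.pi * Complex.I * phase (0 * -q)) (0 * -q) :=
      hasDerivAt_phase _
    have h6 := (h5.scomp 0 h4).mul_const (onEntries f φ)
    simp only [zero_mul, phase_zero, mul_one, Complex.real_smul] at h6
    exact h6.congr_deriv (by push_cast; ring)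
  exact h1.unique (h3.congr_of_eventuallyEq (.of_forall h2))

/-- The linear map that multiplies the entries by weights and moves them. -/
def weightedMove (w : Fin 3 × Fin 3 → K) (s : Fin 3 × Fin 3 → Fin 3 × Fin 3) :
    (Fin 3 × Fin 3 → K) →ₗ[ℝ] (Fin 3 × Fin 3 → K) where
  toFun x k := w k * x (s k)
  map_add' x y := by ext k; simp [mul_add]
  map_smul' r x := by ext k; simp

variable {lam : K}

theorem onEntries_row (hf : f ∈ Tempered.equivariant (rho K) (chi ψ))
    (hlam : ∀ x, (ψ x : ℂ) = phase (RCLike.re (lam * x))) (c d : K)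
    {φ χ : 𝓢(Fin 3 × Fin 3 → K, ℂ)} (hχ : ∀ x, χ x = fderiv ℝ φ x (weightedMove
      (fun k => if k.1 = 0 then d else if k.1 = 1 then c else 0) (fun k => (2, k.2)) x)) :
    onEntries f χ = -(2 * Real.pi * Complex.I) * RCLike.re (lam * d) * onEntries f φ := by
  refine onEntries_deriv hf
    (h := fun t => SemidirectProduct.inl (H3.mk 1 (unipN (t • c) (t • d)) (unipN 0 0)))
    (fun t => by rw [clmDet_rho_unipN, one_mul]) (fun t => ?_) (fun t x => ?_) hχ
  · rw [chi_H3]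
    change ((ψ (t • d) * ψ 0 : Circle) : ℂ) = _
    rw [AddChar.map_zero_eq_one, mul_one, hlam, mul_smul_comm, RCLike.smul_re]
  · ext ⟨i, j⟩
    rw [act_apply, rho_unipN]
    fin_cases i <;> fin_cases j <;>
      simp [entries_symm_apply, weightedMove, RCLike.real_smul_eq_coe_mul, mul_assoc]

theorem onEntries_col (hf : f ∈ Tempered.equivariant (rho K) (chi ψ))
    (hlam : ∀ x, (ψ x : ℂ) = phase (RCLike.re (lam * x))) (c d : K)
    {φ χ : 𝓢(Fin 3 × Fin 3 → K, ℂ)} (hχ : ∀ x, χ x = fderiv ℝ φ x (weightedMove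
      (fun k => if k.2 = 0 then d else if k.2 = 1 then c else 0) (fun k => (k.1, 2)) x)) :
    onEntries f χ = -(2 * Real.pi * Complex.I) * RCLike.re (lam * d) * onEntries f φ := by
  refine onEntries_deriv hf
    (h := fun t => SemidirectProduct.inl (H3.mk 1 (unipN 0 0) (unipN (t • c) (t • d))))
    (fun t => by rw [clmDet_rho_unipN, one_mul]) (fun t => ?_) (fun t x => ?_) hχ
  · rw [chi_H3]
    change ((ψ 0 * ψ (t • d) : Circle) : ℂ) = _
    rw [AddChar.map_zero_eq_one, one_mul, hlam, mul_smul_comm, RCLike.smul_re]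
  · ext ⟨i, j⟩
    rw [act_apply, rho_unipN]
    fin_cases i <;> fin_cases j <;>
      simp [entries_symm_apply, weightedMove, RCLike.real_smul_eq_coe_mul] <;> ring

/-- The entries of the upper left block. -/
abbrev block : List (Fin 3 × Fin 3) := [(0, 0), (0, 1), (1, 0), (1, 1)]

/-- Of the three terms of the vector field, the two along block entries become multiplications under
the transform and the one along k remains a derivative. The constant q from the character joins the
multiplication terms. -/
theorem eqn_of_deriv {T : 𝓢(Fin 3 × Fin 3 → K, ℂ) →L[ℂ] ℂ}
    {V : 𝓢(Fin 3 × Fin 3 → K, ℂ) →L[ℂ] 𝓢(Fin 3 × Fin 3 → K, ℂ)}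
    (hV : ∀ φ, pftList block (V φ) = φ) (hV' : ∀ φ, V (pftList block φ) = φ)
    {k k₁ k₂ s s₁ s₂ : Fin 3 × Fin 3} (hk : k ∉ block) (hk₁ : k₁ ∈ block) (hk₂ : k₂ ∈ block)
    (hs : s ∉ block) (hs₁ : s₁ ∉ block) (hs₂ : s₂ ∉ block) {c : K} {q : ℝ}
    (hT : ∀ φ χ : 𝓢(Fin 3 × Fin 3 → K, ℂ), (∀ x, χ x = fderiv ℝ φ x (Pi.single k₁ (c * x s₁) +
      Pi.single k₂ (c * x s₂) + Pi.single k (c * x s))) →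
      T χ = -(2 * Real.pi * Complex.I) * q * T φ)
    {φ ψ : 𝓢(Fin 3 × Fin 3 → K, ℂ)}
    (hψ : ∀ x, ψ x = 2 * Real.pi * Complex.I *
      (RCLike.re (c * (x s₁ * x k₁ + x s₂ * x k₂)) + q : ℝ) * φ x +
        fderiv ℝ φ x (Pi.single k (c * x s))) : T.comp V ψ = 0 := by
  have hl : (block).Nodup := by decide
  have hind : ∀ {s : Fin 3 × Fin 3}, s ∉ block → ∀ k ∈ block, ∀ (x : Fin 3 × Fin 3 → K) y,
      c * Function.update x k y s = c * x s := by
    intro s hs k hk x y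
    rw [Function.update_of_ne (ne_of_mem_of_not_mem hk hs).symm]
  have ht : ∀ s : Fin 3 × Fin 3, (fun x : Fin 3 × Fin 3 → K => c * x s).HasTemperateGrowth :=
    fun s => by fun_prop
  obtain ⟨χ₁, h₁⟩ := exists_fderiv_single (V φ) k₁ (ht s₁)
  obtain ⟨χ₂, h₂⟩ := exists_fderiv_single (V φ) k₂ (ht s₂)
  obtain ⟨χ₀, h₀⟩ := exists_fderiv_single (V φ) k (ht s)
  have h3 := hT (V φ) (χ₁ + χ₂ + χ₀) fun x => by
    rw [_root_.add_apply, _root_.add_apply, h₁, h₂, h₀, map_add, map_add]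
  have h4 : V ψ = χ₁ + χ₂ + χ₀ + (2 * Real.pi * Complex.I * q : ℂ) • V φ := by
    rw [← hV' (χ₁ + χ₂ + χ₀ + (2 * Real.pi * Complex.I * q : ℂ) • V φ)]
    congr 1
    ext x
    rw [map_add, map_add, map_add, map_smul, hV, _root_.add_apply, _root_.add_apply,
      _root_.add_apply, _root_.smul_apply, pftList_fderiv_single hl (hind hs₁) h₁, if_pos hk₁,
      pftList_fderiv_single hl (hind hs₂) h₂, if_pos hk₂, pftList_fderiv_single hl (hind hs) h₀,
      if_neg hk, hV, hψ, mul_add c, ← mul_assoc c, ← mul_assoc c, map_add, smul_eq_mul]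
    push_cast
    ring
  rw [ContinuousLinearMap.comp_apply, h4, map_add, h3, map_smul, smul_eq_mul]
  ring

theorem eq_zero_of_equivariant (hf : f ∈ Tempered.equivariant (rho K) (chi ψ)) (hlam0 : lam ≠ 0)
    (hlam : ∀ x, (ψ x : ℂ) = phase (RCLike.re (lam * x))) : f = 0 := by
  obtain ⟨V, hV, hV'⟩ := exists_pftList_inverse (K := K) block
  suffices h : (onEntries f).comp V = 0 by
    refine eq_zero_of_onEntries (ContinuousLinearMap.ext fun φ => ?_)
    rw [← hV' φ]
    exact DFunLike.congr_fun h _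
  refine Model.eq_zero (lam := lam) ⟨fun a ha => ?_,
    (onEntries_permAnti hf).comp_pftList_inverse (by decide) hV hV', fun k hk c φ ψ hψ => ?_⟩ hlam0
  -- The transform inverts the weights of the block entries (0, 1) and (1, 0) only, which turns the
  -- original weights into those of `torus`; their norms have product 1.
  · convert (onEntries_diagInv hf ha).comp_pftList_inverse (fun k => ?_) (l := block) (by decide)
      ?_ hV hV' using 1
    · ext ⟨i, j⟩
      fin_cases i <;> fin_cases j <;> simp [torus]
    · split_ifs <;> simp [ha]
    · simp [ha]
  · simp only [arms, Finset.mem_insert, Finset.mem_singleton] at hk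
    rcases hk with rfl | rfl | rfl | rfl
    -- The character sees only the parameter d of the unipotent group, so q = Re(λc) for the entries
    -- (0, 2) and (2, 0), and q = 0 for (1, 2) and (2, 1).
    · refine eqn_of_deriv hV hV' (c := c) (φ := φ) (k := (0, 2)) (k₁ := (0, 0)) (k₂ := (0, 1)) (s₁ := (2, 0)) (s₂ := (2, 1))
        (s := (2, 2)) (q := RCLike.re (lam * c)) (by decide) (by decide) (by decide) (by decide)
        (by decide) (by decide) (fun φ χ hχ => onEntries_row hf hlam 0 c fun x => ?_)
        fun x => (hψ x).trans ?_
      · rw [hχ]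
        congr 1
        ext ⟨i, j⟩
        fin_cases i <;> fin_cases j <;> simp [weightedMove]
      · have : c * armEqn lam (0, 2) x =
            c * (x (2, 0) * x (0, 0) + x (2, 1) * x (0, 1)) + lam * c := by
          simp [armEqn]; ring
        rw [this, map_add]
    · refine eqn_of_deriv hV hV' (c := c) (φ := φ) (k := (1, 2)) (k₁ := (1, 0)) (k₂ := (1, 1)) (s₁ := (2, 0)) (s₂ := (2, 1))
        (s := (2, 2)) (q := RCLike.re (lam * 0)) (by decide) (by decide) (by decide) (by decide)
        (by decide) (by decide) (fun φ χ hχ => onEntries_row hf hlam c 0 fun x => ?_)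
        fun x => (hψ x).trans ?_
      · rw [hχ]
        congr 1
        ext ⟨i, j⟩
        fin_cases i <;> fin_cases j <;> simp [weightedMove]
      · simp [armEqn]
    · refine eqn_of_deriv hV hV' (c := c) (φ := φ) (k := (2, 0)) (k₁ := (0, 0)) (k₂ := (1, 0)) (s₁ := (0, 2)) (s₂ := (1, 2))
        (s := (2, 2)) (q := RCLike.re (lam * c)) (by decide) (by decide) (by decide) (by decide)
        (by decide) (by decide) (fun φ χ hχ => onEntries_col hf hlam 0 c fun x => ?_)
        fun x => (hψ x).trans ?_
      · rw [hχ]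
        congr 1
        ext ⟨i, j⟩
        fin_cases i <;> fin_cases j <;> simp [weightedMove]
      · have : c * armEqn lam (2, 0) x =
            c * (x (0, 2) * x (0, 0) + x (1, 2) * x (1, 0)) + lam * c := by
          simp [armEqn]; ring
        rw [this, map_add]
    · refine eqn_of_deriv hV hV' (c := c) (φ := φ) (k := (2, 1)) (k₁ := (0, 1)) (k₂ := (1, 1)) (s₁ := (0, 2)) (s₂ := (1, 2))
        (s := (2, 2)) (q := RCLike.re (lam * 0)) (by decide) (by decide) (by decide) (by decide)
        (by decide) (by decide) (fun φ χ hχ => onEntries_col hf hlam c 0 fun x => ?_)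
        fun x => (hψ x).trans ?_
      · rw [hχ]
        congr 1
        ext ⟨i, j⟩
        fin_cases i <;> fin_cases j <;> simp [weightedMove]
      · simp [armEqn]

end GL3Model

end Equations

theorem mainTheorem11 (K : Type*) [RCLike K] (ψ : AddChar K Circle) (hψ : Continuous ψ)
    (hψ_ne : ψ ≠ 1) :
    Tempered.equivariant (GL3Model.rho K) (GL3Model.chi ψ) = ⊥ := by
  obtain ⟨lam, hlam0, hlam⟩ := AddChar.exists_eq_phase hψ hψ_ne
  exact (Submodule.eq_bot_iff _).2 fun f hf => GL3Model.eq_zero_of_equivariant hf hlam0 hlam
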